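/- **Theorem 1.1 (Exponential off-diagonal localization for Coulomb).** There is a universal constant $c>0$ such that the following holds. Let $N\ge 2$, let $\rho$ be a measure on $\mathbb R^3$ with $\rho(\mathbb R^3)=N$, let $\varepsilon>0$, and let $\psi_\varepsilon$ be a minimizer of the (bosonic) Levy–Lieb problem with Coulomb interaction $$\min\Big\{\int_{\mathbb R^{3N}}\Big(\varepsilon|\nabla\psi(x)|^2+\sum_{1\le i<j\le N}\frac{|\psi(x)|^2}{|x_i-x_j|}\Big)\,dx\;:\;\psi\in H^1(\mathbb R^{3N};\mathbb C),\ \psi \text{ symmetric under permutations of } x_1,\dots,x_N\in\mathbb R^3,\ \psi\mapsto\rho\Big\},$$ where $\psi\mapsto\rho$ means that $\rho=N\int_{\mathbb R^{3(N-1)}}|\psi|^2$, i.e. $\rho$ is $N$ times the one-particle marginal of $|\psi|^2\,dx$. For $r>0$ put $$\kappa(\rho,r)=\sup_{x\in\mathbb R^3}\frac{\rho(B(x,r))}{N},\qquad D_r=\{(x_1,\dots,x_N)\in\mathbb R^{3N}:\ |x_i-x_j|\le r\text{ for some } i\neq j\}.$$ If $\beta>0$ satisfies $\kappa(\rho,\beta)\le\frac1{4(N-1)}$,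 if $0<\alpha\le\frac{\beta}{32N}$, and if $\varepsilon N^2\ll\frac{\alpha}{16}$ in the sense that $\varepsilon N^2\le c\,\frac{\alpha}{16}$, then $$\int_{D_\alpha}|\psi_\varepsilon(x)|^2\,dx\le\exp\Big(-\frac1{24}\sqrt{\frac{\alpha}{\varepsilon}}\Big).$$ -/

import Mathlib

open MeasureTheory
open scoped ENNReal ContDiff

noncomputable section

namespace LevyLieb

/-- The physical space `ℝ³` with its Euclidean norm. -/
abbrev R3 : Type := EuclideanSpace ℝ (Fin 3)

/-- The configuration space `ℝ^{3N} = (ℝ³)^N`; its `volume` is the `3N`-dimensional Lebesgue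
measure. (Only the Lebesgue measure, the smooth structure and the components `x i ∈ ℝ³` of this
space are used below, never its norm.) -/
abbrev Config (N : ℕ) : Type := Fin N → R3

/-- The coordinate direction of `ℝ^{3N}` that moves particle `i` along the `k`-th axis of `ℝ³`. -/
def coordDir {N : ℕ} (i : Fin N) (k : Fin 3) : Config N :=
  Pi.single i (EuclideanSpace.single k (1 : ℝ))

/-- `g` is the weak partial derivative of `ψ` in the `k`-th coordinate of particle `i`:
`∫ (∂φ) ψ = - ∫ φ g` for all test functions `φ ∈ C_c^∞(ℝ^{3N})`. -/
def IsWeakPartial {N : ℕ} (ψ : Config N → ℂ) (i : Fin N) (k : Fin 3) (g : Config N → ℂ) : Prop :=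
  ∀ φ : Config N → ℝ, ContDiff ℝ ∞ φ → HasCompactSupport φ →
    ∫ x, (fderiv ℝ φ x (coordDir i k)) • ψ x = - ∫ x, φ x • g x

/-- The Sobolev space `H¹(ℝ^{3N}; ℂ)`. -/
def MemH1 {N : ℕ} (ψ : Config N → ℂ) : Prop :=
  MemLp ψ 2 volume ∧
    ∀ (i : Fin N) (k : Fin 3), ∃ g : Config N → ℂ, MemLp g 2 volume ∧ IsWeakPartial ψ i k g

open Classical in
/-- The weak partial derivative in `L²` of a function in `H¹`. It is unique up to equality almost
everywhere; for functions that have none it is `0`, a value that is never used. -/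
def weakPartial {N : ℕ} (ψ : Config N → ℂ) (i : Fin N) (k : Fin 3) : Config N → ℂ :=
  if h : ∃ g : Config N → ℂ, MemLp g 2 volume ∧ IsWeakPartial ψ i k g then h.choose else 0

/-- The squared length `|∇ψ(x)|²` of the weak gradient in `ℝ^{3N}`. -/
def gradSq {N : ℕ} (ψ : Config N → ℂ) (x : Config N) : ℝ≥0∞ :=
  ∑ i : Fin N, ∑ k : Fin 3, ‖weakPartial ψ i k x‖ₑ ^ 2

/-- The Coulomb interaction `v_ee(x) = ∑_{i<j} 1 / |x_i - x_j|`, equal to `+∞` when two particles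
coincide. -/
def coulomb {N : ℕ} (x : Config N) : ℝ≥0∞ :=
  ∑ i : Fin N, ∑ j ∈ Finset.Ioi i, (edist (x i) (x j))⁻¹

/-- The energy `∫ ε |∇ψ|² + v_ee |ψ|² dx ∈ [0, ∞]`. -/
def energy {N : ℕ} (ε : ℝ) (ψ : Config N → ℂ) : ℝ≥0∞ :=
  ∫⁻ x, (ENNReal.ofReal ε * gradSq ψ x + coulomb x * ‖ψ x‖ₑ ^ 2)

/-- Bosonic symmetry: `ψ` is invariant under permutations of the particles. -/
def IsSymmetric {N : ℕ} (ψ : Config N → ℂ) : Prop :=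
  ∀ σ : Equiv.Perm (Fin N), ∀ᵐ x : Config N, ψ (fun i => x (σ i)) = ψ x

/-- `ψ ↦ ρ`: the one-body density of `ψ` is `ρ`, that is, `ρ` is `N` times the marginal on `ℝ³` of
the measure `|ψ|² dx`. (All `N` marginals agree when `ψ` is symmetric.) -/
def HasOneBodyDensity {N : ℕ} (ψ : Config N → ℂ) (ρ : Measure R3) : Prop :=
  ∀ i : Fin N, (N : ℝ≥0∞) •
    ((volume : Measure (Config N)).withDensity (fun x => ‖ψ x‖ₑ ^ 2)).map (fun x => x i) = ρ

/-- The competitors in the Levy-Lieb constrained search: symmetric `H¹` wave-functions whose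
one-body density is `ρ`. -/
def Admissible {N : ℕ} (ρ : Measure R3) (ψ : Config N → ℂ) : Prop :=
  MemH1 ψ ∧ IsSymmetric ψ ∧ HasOneBodyDensity ψ ρ

/-- `ψ` is a minimizer for the Levy-Lieb functional at `ρ`. -/
def IsMinimizer {N : ℕ} (ε : ℝ) (ρ : Measure R3) (ψ : Config N → ℂ) : Prop :=
  Admissible ρ ψ ∧ ∀ φ : Config N → ℂ, Admissible ρ φ → energy ε ψ ≤ energy ε φ

/-- The concentration `κ(ρ, r) = sup_x ρ(B(x, r)) / N`. -/
def kappa (N : ℕ) (ρ : Measure R3) (r : ℝ) : ℝ≥0∞ :=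
  ⨆ x : R3, ρ (Metric.ball x r) / (N : ℝ≥0∞)

/-- The enlarged diagonal `D_α`. -/
def enlargedDiagonal (N : ℕ) (α : ℝ) : Set (Config N) :=
  {x | ∃ i j : Fin N, i ≠ j ∧ dist (x i) (x j) ≤ α}

end LevyLieb

end

/-!
The proof is an Agmon estimate in which the competitor is produced by exchanging a particle between
two independent copies of the minimizer.

Write `p = |ψ|`, and let `Ψ(x, y) = p(x) p(y)` on the doubled configuration space. Given a real
function `χ` with `0 ≤ χ ≤ 1/2`, leave the part `√(1 - χ²) Ψ` of the pair as it is, and in the part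
`χ Ψ` exchange the coordinates of one particle between `x` and `y`. The exchange preserves the sum
of the one-particle marginals over the two copies. Hence, averaging the two marginals on single
configurations of the resulting density and symmetrizing over permutations, one obtains the square
of an admissible wave-function (`fiberNorm (amplitudes i₀ U)`). Kinetic energy does not increase
when passing to marginals, and the localization costs only an IMS error of order `ε ∫ |∇χ|² Ψ²`.
Minimality therefore bounds the Coulomb energy released by the exchange by this error
(`IsMinimizer.exchange_inequality`).

Kinetic energies are handled through `L²` norms of increments. A function in `L²` has a weak
derivative in `L²` exactly when its difference quotients are bounded in `L²`
(`IsWeakDeriv.sqDiff_le`, `exists_isWeakDeriv`). For increments, the diamagnetic inequality,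
convexity under marginals (`sqDiff_fiberNorm_le`) and the IMS formula (`sqDiff_localization_le`)
come down to pointwise inequalities, and no product or chain rule for weak derivatives is needed. To
cancel the Coulomb energy of the minimizer one has to know that it is finite; this is a qualitative
form of Hardy's inequality (`lintegral_inv_edist_mul_sq_lt_top`).

The amplitude is `χ = g(|x₀ - x₁|) θ(x, y) / 2`. The cutoff `θ` vanishes when the exchange of
particle `0` would create a pair at distance at most `β / 2`; the concentration hypothesis
guarantees that, for every `x`, at least half of the mass of `y` has `θ = 1`. The weight is
`g(r) = (e^{-γ r} - e^{-4 γ α})₊`, so that on the support of `χ` an interaction of at least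
`1 / (4 α)` is released and at most `4 N / β ≤ 1 / (8 α)` is created. For `γ = √(α / ε) / (96 α)` the
gain absorbs the kinetic cost, whence `∫ g² p² ≤ e^{-8 γ α}` (`IsMinimizer.weightedMass_le`), and a
given pair is at distance at most `α` with probability at most `4 e^{-6 γ α} = 4 e^{-√(α / ε) / 16}`.
The remaining factor `N²` from the number of pairs is absorbed because `√(α / ε) ≥ 400 N`.
-/

namespace LevyLieb

open Filter Topology

set_option linter.unusedSectionVars false

/-! ### Weak derivatives and difference quotients in `L²` -/

section WeakDerivative

variable {E : Type*} [NormedAddCommGroup E] [NormedSpace ℝ E] [FiniteDimensional ℝ E]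
  [MeasurableSpace E] [BorelSpace E] {μ : Measure E} [μ.IsAddHaarMeasure]

/-- `v` is the weak derivative of the real function `u` in the direction `e`. -/
def IsWeakDeriv (μ : Measure E) (u v : E → ℝ) (e : E) : Prop :=
  ∀ η : E → ℝ, ContDiff ℝ ∞ η → HasCompactSupport η →
    ∫ x, fderiv ℝ η x e * u x ∂μ = - ∫ x, η x * v x ∂μ

/-- The squared `L²` norm of the increment `u(· + e) - u`, with values in `[0, ∞]`. -/
noncomputable def sqDiff (μ : Measure E) (u : E → ℝ) (e : E) : ℝ≥0∞ :=
  ∫⁻ x, ‖u (x + e) - u x‖ₑ ^ 2 ∂μ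

theorem eLpNorm_two_sq {α F : Type*} [MeasurableSpace α] [NormedAddCommGroup F] (ν : Measure α)
    (f : α → F) : eLpNorm f 2 ν ^ 2 = ∫⁻ x, ‖f x‖ₑ ^ 2 ∂ν := by
  have h := eLpNorm_nnreal_pow_eq_lintegral (f := f) (μ := ν) (p := 2) two_ne_zero
  simpa using h

theorem abs_integral_mul_le {α : Type*} [MeasurableSpace α] {ν : Measure α} {f g : α → ℝ}
    (hf : MemLp f 2 ν) (hg : MemLp g 2 ν) :
    |∫ x, f x * g x ∂ν| ≤ (eLpNorm f 2 ν).toReal * (eLpNorm g 2 ν).toReal := by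
  have h := abs_real_inner_le_norm (hg.toLp g) (hf.toLp f)
  rw [L2.inner_def, Lp.norm_toLp, Lp.norm_toLp] at h
  rw [mul_comm]
  convert h using 2
  refine integral_congr_ae ?_
  filter_upwards [hf.coeFn_toLp, hg.coeFn_toLp] with x h1 h2
  simp [h1, h2]

/-- Riesz representation: a linear functional on test functions that is bounded in the `L²` norm
is integration against an `L²` function. -/
theorem exists_memLp_of_bounded (L : (E → ℝ) → ℝ) (C : ℝ) (hC : 0 ≤ C)
    (hadd : ∀ η₁ η₂ : E → ℝ, ContDiff ℝ ∞ η₁ → HasCompactSupport η₁ → ContDiff ℝ ∞ η₂ →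
      HasCompactSupport η₂ → L (η₁ + η₂) = L η₁ + L η₂)
    (hsmul : ∀ (a : ℝ) (η : E → ℝ), ContDiff ℝ ∞ η → HasCompactSupport η → L (a • η) = a * L η)
    (hbound : ∀ η : E → ℝ, ContDiff ℝ ∞ η → HasCompactSupport η →
      |L η| ≤ C * (eLpNorm η 2 μ).toReal) :
    ∃ g : E → ℝ, MemLp g 2 μ ∧ eLpNorm g 2 μ ≤ ENNReal.ofReal C ∧
      ∀ η : E → ℝ, ContDiff ℝ ∞ η → HasCompactSupport η → L η = ∫ x, η x * g x ∂μ := by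
  let T : Submodule ℝ (E → ℝ) :=
    { carrier := {η | ContDiff ℝ ∞ η ∧ HasCompactSupport η}
      add_mem' := fun ha hb => ⟨ha.1.add hb.1, ha.2.add hb.2⟩
      zero_mem' := ⟨contDiff_const, HasCompactSupport.zero⟩
      smul_mem' := fun a η h => ⟨h.1.const_smul a, h.2.smul_left (f := fun _ => a)⟩ }
  have hT : ∀ η : T, MemLp (η : E → ℝ) 2 μ := fun η =>
    η.2.1.continuous.memLp_of_hasCompactSupport η.2.2
  let J : T →ₗ[ℝ] Lp ℝ 2 μ :=
    { toFun := fun η => (hT η).toLp η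
      map_add' := fun a b => MemLp.toLp_add (hT a) (hT b)
      map_smul' := fun a b => MemLp.toLp_const_smul a (hT b) }
  have hJ : Function.Injective J := by
    intro a b hab
    have h1 : (a : E → ℝ) =ᵐ[μ] b := (MemLp.toLp_eq_toLp_iff (hT a) (hT b)).1 hab
    exact Subtype.ext ((Continuous.ae_eq_iff_eq μ a.2.1.continuous b.2.1.continuous).1 h1)
  let e := LinearEquiv.ofInjective J hJ
  let L₀ : T →ₗ[ℝ] ℝ :=
    { toFun := fun η => L η
      map_add' := fun a b => hadd _ _ a.2.1 a.2.2 b.2.1 b.2.2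
      map_smul' := fun a b => hsmul _ _ b.2.1 b.2.2 }
  have hnorm : ∀ y : LinearMap.range J, ‖(L₀ ∘ₗ e.symm.toLinearMap) y‖ ≤ C * ‖y‖ := by
    intro y
    obtain ⟨η, rfl⟩ := e.surjective y
    have h1 : ‖e η‖ = (eLpNorm (η : E → ℝ) 2 μ).toReal := Lp.norm_toLp _ (hT η)
    rw [h1]
    simpa [L₀] using hbound η η.2.1 η.2.2
  let f : StrongDual ℝ (LinearMap.range J) := LinearMap.mkContinuous _ C hnorm
  obtain ⟨G, hG, hGn⟩ := exists_extension_norm_eq (LinearMap.range J) f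
  let g : Lp ℝ 2 μ := (InnerProductSpace.toDual ℝ _).symm G
  have hg : ‖g‖ ≤ C := by
    simp only [g, LinearIsometryEquiv.norm_map, hGn]
    exact LinearMap.mkContinuous_norm_le _ hC _
  refine ⟨g, Lp.memLp g, ?_, ?_⟩
  · rw [← ENNReal.ofReal_toReal (Lp.memLp g).eLpNorm_ne_top]
    exact ENNReal.ofReal_le_ofReal hg
  · intro η h1 h2
    let ηT : T := ⟨η, h1, h2⟩
    have h3 : G (J ηT) = L η := by
      have h4 := hG (e ηT)
      have h5 : ((e ηT : LinearMap.range J) : Lp ℝ 2 μ) = J ηT := rfl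
      rw [← h5, h4]
      simp [f, L₀, ηT]
    have h6 : G (J ηT) = inner ℝ g (J ηT) := (InnerProductSpace.toDual_symm_apply).symm
    rw [← h3, h6, L2.inner_def]
    refine integral_congr_ae ?_
    filter_upwards [(hT ηT).coeFn_toLp] with x hx
    have : (J ηT : E → ℝ) x = η x := hx
    simp [this]

/-- Duality: the `L²` norm is controlled by pairings with test functions. -/
theorem eLpNorm_le_of_forall_test {w : E → ℝ} (hw : MemLp w 2 μ) (C : ℝ) (hC : 0 ≤ C)
    (h : ∀ η : E → ℝ, ContDiff ℝ ∞ η → HasCompactSupport η →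
      |∫ x, η x * w x ∂μ| ≤ C * (eLpNorm η 2 μ).toReal) :
    eLpNorm w 2 μ ≤ ENNReal.ofReal C := by
  have hint : ∀ η : E → ℝ, ContDiff ℝ ∞ η → HasCompactSupport η →
      Integrable (fun x => η x * w x) μ := fun η h1 h2 =>
    MemLp.integrable_mul (p := 2) (q := 2) (h1.continuous.memLp_of_hasCompactSupport h2) hw
  obtain ⟨g, hg, hgC, hgL⟩ := exists_memLp_of_bounded (μ := μ) (fun η => ∫ x, η x * w x ∂μ) C hC
    (fun η₁ η₂ h1 h2 h3 h4 => by
      rw [← integral_add (hint _ h1 h2) (hint _ h3 h4)]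
      simp [add_mul])
    (fun a η _ _ => by
      rw [← integral_const_mul]
      simp [mul_assoc]) h
  have : ∀ᵐ x ∂μ, w x = g x := ae_eq_of_integral_contDiff_smul_eq
    (hw.locallyIntegrable one_le_two) (hg.locallyIntegrable one_le_two)
    (fun η h1 h2 => by simpa using hgL η h1 h2)
  rwa [eLpNorm_congr_ae this]

/-- Pairings with translated test functions are differentiable in the translation parameter: they
are values of a convolution. -/
theorem hasDerivAt_integral_translate {u η : E → ℝ} (hu : LocallyIntegrable u μ)
    (hη : ContDiff ℝ ∞ η) (hc : HasCompactSupport η) (e : E) (t : ℝ) :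
    HasDerivAt (fun t : ℝ => ∫ x, η (x - t • e) * u x ∂μ)
      (-∫ x, fderiv ℝ η (x - t • e) e * u x ∂μ) t := by
  let η' : E → ℝ := fun x => η (-x)
  have hη' : ContDiff ℝ 1 η' := (hη.comp contDiff_neg).of_le (by simp)
  have hc' : HasCompactSupport η' := hc.comp_homeomorph (Homeomorph.neg E)
  let M := ContinuousLinearMap.mul ℝ ℝ
  have h1 := hc'.hasFDerivAt_convolution_right M hu hη' (t • e)
  have h2 : HasDerivAt (fun t : ℝ => t • e) e t := by
    simpa using (hasDerivAt_id t).smul_const e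
  have h3 := h1.comp_hasDerivAt t h2
  have h4 : (convolution u (fderiv ℝ η') (ContinuousLinearMap.precompR E M) μ (t • e)) e
      = -∫ x, fderiv ℝ η (x - t • e) e * u x ∂μ := by
    rw [convolution_precompR_apply M hu (hc'.fderiv ℝ) (hη'.continuous_fderiv one_ne_zero)]
    rw [convolution_def, ← integral_neg]
    congr 1
    ext x
    have : fderiv ℝ η' (t • e - x) = - fderiv ℝ η (x - t • e) := by
      have h5 : HasFDerivAt η' ((fderiv ℝ η (x - t • e)).comp (-ContinuousLinearMap.id ℝ E))
          (t • e - x) := by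
        refine HasFDerivAt.comp (g := η) _ ?_ (hasFDerivAt_id (t • e - x)).neg
        simpa using (hη.differentiable (by simp) (x - t • e)).hasFDerivAt
      rw [h5.fderiv]
      ext
      simp
    simp [M, this, mul_comm]
  rw [h4] at h3
  have h5 : (fun t : ℝ => ∫ x, η (x - t • e) * u x ∂μ)
      = (convolution u η' M μ ∘ fun t => t • e) := by
    ext s
    simp [Function.comp, convolution_def, M, η', mul_comm]
  rw [h5]
  exact h3

theorem eLpNorm_translate {F : Type*} [NormedAddCommGroup F] {u : E → F} (hu : MemLp u 2 μ)
    (a : E) : eLpNorm (fun x => u (x + a)) 2 μ = eLpNorm u 2 μ :=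
  eLpNorm_comp_measurePreserving hu.aestronglyMeasurable (measurePreserving_add_right μ a)

theorem memLp_translate {F : Type*} [NormedAddCommGroup F] {u : E → F} (hu : MemLp u 2 μ)
    (a : E) : MemLp (fun x => u (x + a)) 2 μ :=
  hu.comp_measurePreserving (measurePreserving_add_right μ a)

/-- Shifting an increment from one factor to the other. -/
theorem integral_mul_translate_sub {u η : E → ℝ} (hu : MemLp u 2 μ) (hη : MemLp η 2 μ) (a : E) :
    ∫ x, η x * (u (x + a) - u x) ∂μ = (∫ x, η (x - a) * u x ∂μ) - ∫ x, η x * u x ∂μ := by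
  have h1 : Integrable (fun x => η x * u (x + a)) μ := MemLp.integrable_mul hη (memLp_translate hu a)
  have h2 : Integrable (fun x => η x * u x) μ := MemLp.integrable_mul hη hu
  simp_rw [mul_sub]
  rw [integral_sub h1 h2]
  congr 1
  have := integral_add_right_eq_self (μ := μ) (fun x => η (x - a) * u x) a
  rw [← this]
  simp

/-- The `L²` modulus of continuity of a function with weak derivative in `L²`. -/
theorem IsWeakDeriv.sqDiff_le {u v : E → ℝ} {e : E} (h : IsWeakDeriv μ u v e) (hu : MemLp u 2 μ)
    (hv : MemLp v 2 μ) (t : ℝ) :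
    sqDiff μ u (t • e) ≤ ENNReal.ofReal (t ^ 2) * ∫⁻ x, ‖v x‖ₑ ^ 2 ∂μ := by
  have key : eLpNorm (fun x => u (x + t • e) - u x) 2 μ ≤
      ENNReal.ofReal (|t| * (eLpNorm v 2 μ).toReal) := by
    refine eLpNorm_le_of_forall_test ((memLp_translate hu _).sub hu) _ (by positivity) ?_
    intro η h1 h2
    have hη : MemLp η 2 μ := h1.continuous.memLp_of_hasCompactSupport h2
    simp only [Pi.sub_apply]
    rw [integral_mul_translate_sub hu hη]
    have hd := fun s : ℝ => hasDerivAt_integral_translate (hu.locallyIntegrable one_le_two) h1 h2 e s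
    have hb : ∀ s : ℝ, ‖-∫ x, fderiv ℝ η (x - s • e) e * u x ∂μ‖ ≤
        (eLpNorm η 2 μ).toReal * (eLpNorm v 2 μ).toReal := by
      intro s
      have hs1 : ContDiff ℝ ∞ (fun x => η (x - s • e)) := h1.comp (contDiff_id.sub contDiff_const)
      have hs2 : HasCompactSupport (fun x => η (x - s • e)) :=
        h2.comp_homeomorph (Homeomorph.subRight (s • e))
      have := h _ hs1 hs2
      simp_rw [fderiv_comp_sub] at this
      rw [this, neg_neg]
      have h5 := abs_integral_mul_le (hs1.continuous.memLp_of_hasCompactSupport hs2) hv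
      have h6 := eLpNorm_translate hη (-(s • e))
      simp_rw [← sub_eq_add_neg] at h6
      rwa [h6] at h5
    have := Convex.norm_image_sub_le_of_norm_hasDerivWithin_le (s := Set.univ) (x := 0) (y := t)
      (fun s _ => (hd s).hasDerivWithinAt) (fun s _ => hb s) convex_univ trivial trivial
    simp only [zero_smul, sub_zero, Real.norm_eq_abs] at this
    calc _ ≤ _ := this
      _ = _ := by ring
  rw [sqDiff, ← eLpNorm_two_sq, ← eLpNorm_two_sq]
  calc _ ≤ ENNReal.ofReal (|t| * (eLpNorm v 2 μ).toReal) ^ 2 := by gcongr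
    _ = _ := by
      rw [ENNReal.ofReal_mul (abs_nonneg t), mul_pow, ENNReal.ofReal_toReal hv.eLpNorm_ne_top,
        ← ENNReal.ofReal_pow (abs_nonneg t), sq_abs]

/-- A function whose difference quotients stay bounded in `L²` has a weak derivative in `L²`,
whose norm is at most their lower limit. -/
theorem exists_isWeakDeriv {u : E → ℝ} (hu : MemLp u 2 μ) (e : E) {K : ℝ≥0∞} (hK : K ≠ ⊤)
    (hle : liminf (fun t : ℝ => sqDiff μ u (t • e) / ENNReal.ofReal (t ^ 2)) (𝓝[>] 0) ≤ K) :
    ∃ v : E → ℝ, MemLp v 2 μ ∧ IsWeakDeriv μ u v e ∧ ∫⁻ x, ‖v x‖ₑ ^ 2 ∂μ ≤ K := by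
  let C : ℝ := Real.sqrt K.toReal
  have hint : ∀ η : E → ℝ, ContDiff ℝ ∞ η → HasCompactSupport η →
      Integrable (fun x => fderiv ℝ η x e * u x) μ := fun η h1 h2 =>
    MemLp.integrable_mul (p := 2) (q := 2) (((h1.continuous_fderiv (by simp)).clm_apply
      continuous_const).memLp_of_hasCompactSupport (h2.fderiv_apply ℝ e)) hu
  have hdiff : ∀ η : E → ℝ, ContDiff ℝ ∞ η → Differentiable ℝ η := fun η h =>
    h.differentiable (by simp)
  obtain ⟨g, hg, hgC, hgL⟩ := exists_memLp_of_bounded (μ := μ)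
    (fun η => -∫ x, fderiv ℝ η x e * u x ∂μ) C (Real.sqrt_nonneg _)
    (fun η₁ η₂ h1 h2 h3 h4 => by
      rw [← neg_add, ← integral_add (hint _ h1 h2) (hint _ h3 h4)]
      congr 2
      ext x
      rw [fderiv_add (hdiff _ h1 x) (hdiff _ h3 x)]
      simp [add_mul])
    (fun a η h1 _ => by
      rw [mul_neg, ← integral_const_mul]
      congr 2
      ext x
      rw [fderiv_const_smul (hdiff _ h1 x)]
      simp [mul_assoc])
    (fun η h1 h2 => by
      have hη : MemLp η 2 μ := h1.continuous.memLp_of_hasCompactSupport h2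
      have hd := hasDerivAt_integral_translate (hu.locallyIntegrable one_le_two) h1 h2 e 0
      simp only [zero_smul, sub_zero] at hd
      set D := -∫ x, fderiv ℝ η x e * u x ∂μ with hD
      have hs : Tendsto (fun t : ℝ => |t⁻¹ * ∫ x, η x * (u (x + t • e) - u x) ∂μ|) (𝓝[>] 0)
          (𝓝 |D|) := by
        have := (hd.tendsto_slope_zero_right).abs
        refine this.congr' ?_
        filter_upwards with t
        rw [integral_mul_translate_sub hu hη]
        simp
      have hs2 : Tendsto (fun t : ℝ =>
          ENNReal.ofReal (|t⁻¹ * ∫ x, η x * (u (x + t • e) - u x) ∂μ| ^ 2)) (𝓝[>] 0)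
          (𝓝 (ENNReal.ofReal (|D| ^ 2))) := ENNReal.tendsto_ofReal (hs.pow 2)
      have hle2 : ENNReal.ofReal (|D| ^ 2) ≤ eLpNorm η 2 μ ^ 2 * K := by
        rw [← hs2.liminf_eq]
        have hne : eLpNorm η 2 μ ^ 2 ≠ ⊤ := ENNReal.pow_ne_top hη.eLpNorm_ne_top
        calc _ ≤ liminf (fun t : ℝ => eLpNorm η 2 μ ^ 2 *
              (sqDiff μ u (t • e) / ENNReal.ofReal (t ^ 2))) (𝓝[>] 0) := by
              refine liminf_le_liminf ?_
              filter_upwards [self_mem_nhdsWithin] with t ht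
              have ht : 0 < t := ht
              have hdm : MemLp (fun x => u (x + t • e) - u x) 2 μ := (memLp_translate hu _).sub hu
              rw [sqDiff, ← eLpNorm_two_sq, ← mul_div_assoc,
                ENNReal.le_div_iff_mul_le (by simp [ht.ne']) (by simp),
                ← ENNReal.ofReal_mul (by positivity), ← mul_pow, ← mul_pow,
                ← ENNReal.ofReal_toReal (ENNReal.mul_ne_top hη.eLpNorm_ne_top hdm.eLpNorm_ne_top),
                ← ENNReal.ofReal_pow (by positivity), ENNReal.toReal_mul]
              refine ENNReal.ofReal_le_ofReal (pow_le_pow_left₀ (by positivity) ?_ 2)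
              rw [abs_mul, abs_inv, abs_of_pos ht]
              calc _ = |∫ x, η x * (u (x + t • e) - u x) ∂μ| := by field_simp
                _ ≤ _ := abs_integral_mul_le hη hdm
          _ = eLpNorm η 2 μ ^ 2 * liminf (fun t : ℝ =>
              (sqDiff μ u (t • e) / ENNReal.ofReal (t ^ 2))) (𝓝[>] 0) :=
              ENNReal.liminf_const_mul_of_ne_top hne
          _ ≤ _ := by gcongr
      have h7 : |D| ^ 2 ≤ ((eLpNorm η 2 μ).toReal) ^ 2 * K.toReal := by
        have := ENNReal.toReal_mono (ENNReal.mul_ne_top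
          (ENNReal.pow_ne_top hη.eLpNorm_ne_top) hK) hle2
        rwa [ENNReal.toReal_ofReal (by positivity), ENNReal.toReal_mul, ENNReal.toReal_pow] at this
      refine abs_le_of_sq_le_sq' ?_ (by positivity) |>.2
      rw [mul_pow, Real.sq_sqrt ENNReal.toReal_nonneg]
      linarith)
  refine ⟨g, hg, fun η h1 h2 => ?_, ?_⟩
  · rw [← hgL η h1 h2, neg_neg]
  · rw [← eLpNorm_two_sq]
    calc _ ≤ ENNReal.ofReal C ^ 2 := by gcongr
      _ = K := by
        rw [← ENNReal.ofReal_pow (Real.sqrt_nonneg _), Real.sq_sqrt ENNReal.toReal_nonneg,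
          ENNReal.ofReal_toReal hK]

end WeakDerivative

/-! ### Sobolev functions on configuration space -/

/-- Superadditivity of the lower limit for finite sums, from Fatou's lemma for the counting
measure. -/
theorem sum_liminf_le {α ι : Type*} [Fintype ι] (l : Filter α) [l.IsCountablyGenerated]
    (f : ι → α → ℝ≥0∞) : ∑ i, liminf (f i) l ≤ liminf (fun a => ∑ i, f i a) l := by
  classical
  let _ : MeasurableSpace ι := ⊤
  have h := lintegral_liminf_le (μ := (Measure.count : Measure ι)) (f := fun a i => f i a)
    (u := l) (fun _ => measurable_from_top)
  simpa [lintegral_fintype] using h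

section SobolevTransfer

variable {N : ℕ}

theorem MemH1.weakPartial_spec {ψ : Config N → ℂ} (h : MemH1 ψ) (i : Fin N) (k : Fin 3) :
    MemLp (weakPartial ψ i k) 2 volume ∧ IsWeakPartial ψ i k (weakPartial ψ i k) := by
  have h1 := h.2 i k
  rw [weakPartial, dif_pos h1]
  exact h1.choose_spec

theorem integrable_smul_of_memLp {f : Config N → ℂ} (hf : MemLp f 2 volume) {η : Config N → ℝ}
    (h1 : Continuous η) (h2 : HasCompactSupport η) : Integrable (fun x => η x • f x) volume := by
  have h3 : MemLp η 2 volume := h1.memLp_of_hasCompactSupport h2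
  have h4 : MemLp (fun x => η x • f x) 1 volume := hf.smul h3
  exact memLp_one_iff_integrable.1 h4

theorem continuous_fderiv_test {E : Type*} [NormedAddCommGroup E] [NormedSpace ℝ E] {η : E → ℝ}
    (h1 : ContDiff ℝ ∞ η) (e : E) : Continuous (fun x => fderiv ℝ η x e) :=
  (h1.continuous_fderiv (by simp)).clm_apply continuous_const

/-- Real-linear functionals of a complex weak derivative are real weak derivatives. -/
theorem IsWeakPartial.clm_comp {ψ g : Config N → ℂ} {i : Fin N} {k : Fin 3}
    (h : IsWeakPartial ψ i k g) (hψ : MemLp ψ 2 volume) (hg : MemLp g 2 volume) (A : ℂ →L[ℝ] ℝ) :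
    IsWeakDeriv volume (fun x => A (ψ x)) (fun x => A (g x)) (coordDir i k) := by
  intro η h1 h2
  have h3 := congrArg A (h η h1 h2)
  rw [map_neg, ← A.integral_comp_comm (integrable_smul_of_memLp hψ
      (continuous_fderiv_test h1 _) (h2.fderiv_apply ℝ _)),
    ← A.integral_comp_comm (integrable_smul_of_memLp hg h1.continuous h2)] at h3
  simpa only [map_smul, smul_eq_mul] using h3

theorem enorm_sq_complex (z : ℂ) : ‖z‖ₑ ^ 2 = ‖z.re‖ₑ ^ 2 + ‖z.im‖ₑ ^ 2 := by
  simp only [← ofReal_norm]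
  rw [← ENNReal.ofReal_pow (norm_nonneg _), ← ENNReal.ofReal_pow (norm_nonneg _),
    ← ENNReal.ofReal_pow (norm_nonneg _), ← ENNReal.ofReal_add (by positivity) (by positivity)]
  congr 1
  rw [Complex.sq_norm, Complex.normSq_apply]
  simp [sq]

/-- Diamagnetic inequality in integrated form: the modulus of an `H¹` function has increments
controlled by the weak gradient. -/
theorem MemH1.sqDiff_norm_le {ψ : Config N → ℂ} (h : MemH1 ψ) {p : Config N → ℝ}
    (hp : p =ᵐ[volume] fun x => ‖ψ x‖) (i : Fin N) (k : Fin 3) (t : ℝ) :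
    sqDiff volume p (t • coordDir i k) ≤
      ENNReal.ofReal (t ^ 2) * ∫⁻ x, ‖weakPartial ψ i k x‖ₑ ^ 2 := by
  obtain ⟨hg, hw⟩ := h.weakPartial_spec i k
  set g := weakPartial ψ i k
  have hψ := h.1
  have hre := (hw.clm_comp hψ hg Complex.reCLM).sqDiff_le hψ.re hg.re t
  have him := (hw.clm_comp hψ hg Complex.imCLM).sqDiff_le hψ.im hg.im t
  have hsplit : ∫⁻ x, ‖g x‖ₑ ^ 2 = (∫⁻ x, ‖(g x).re‖ₑ ^ 2) + ∫⁻ x, ‖(g x).im‖ₑ ^ 2 := by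
    simp_rw [enorm_sq_complex]
    exact lintegral_add_left' (hg.re.aestronglyMeasurable.enorm.pow_const 2) _
  rw [hsplit, mul_add]
  refine le_trans ?_ (add_le_add hre him)
  unfold sqDiff
  set a := t • coordDir i k
  have hmR : AEMeasurable (fun x => ‖Complex.reCLM (ψ (x + a)) - Complex.reCLM (ψ x)‖ₑ ^ 2)
      volume := (((memLp_translate hψ.re a).sub hψ.re).aestronglyMeasurable.enorm).pow_const 2
  rw [← lintegral_add_left' hmR]
  have hp' : ∀ᵐ x ∂(volume : Measure (Config N)), p (x + a) = ‖ψ (x + a)‖ :=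
    (measurePreserving_add_right volume a).quasiMeasurePreserving.ae hp
  refine lintegral_mono_ae ?_
  filter_upwards [hp, hp'] with x h1 h2
  rw [h1, h2]
  have h3 := enorm_sq_complex (ψ (x + a) - ψ x)
  simp only [Complex.sub_re, Complex.sub_im] at h3
  simp only [Complex.reCLM_apply, Complex.imCLM_apply]
  rw [← h3, ← ofReal_norm, ← ofReal_norm]
  gcongr
  exact abs_norm_sub_norm_le _ _

theorem IsWeakPartial.ae_unique {ψ g g' : Config N → ℂ} {i : Fin N} {k : Fin 3}
    (h : IsWeakPartial ψ i k g) (h' : IsWeakPartial ψ i k g') (hg : MemLp g 2 volume)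
    (hg' : MemLp g' 2 volume) : g =ᵐ[volume] g' :=
  ae_eq_of_integral_contDiff_smul_eq (hg.locallyIntegrable one_le_two)
    (hg'.locallyIntegrable one_le_two) fun η h1 h2 => by
      have := (h η h1 h2).symm.trans (h' η h1 h2)
      exact neg_injective this

theorem lintegral_gradSq {ψ : Config N → ℂ} (h : MemH1 ψ) :
    ∫⁻ x, gradSq ψ x = ∑ i : Fin N, ∑ k : Fin 3, ∫⁻ x, ‖weakPartial ψ i k x‖ₑ ^ 2 := by
  have hm : ∀ i k, AEMeasurable (fun x => ‖weakPartial ψ i k x‖ₑ ^ 2) volume := fun i k =>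
    ((h.weakPartial_spec i k).1.aestronglyMeasurable.enorm).pow_const 2
  unfold gradSq
  rw [lintegral_finsetSum' _ (fun i _ => Finset.aemeasurable_fun_sum _ fun k _ => hm i k)]
  refine Finset.sum_congr rfl fun i _ => ?_
  rw [lintegral_finsetSum' _ (fun k _ => hm i k)]

/-- Control of the increments of a real function puts it in `H¹` and bounds its Dirichlet
integral. -/
theorem memH1_of_sqDiff_le {φ : Config N → ℝ} (hφ : MemLp φ 2 volume) {K : ℝ≥0∞} (hK : K ≠ ⊤)
    {h₀ : ℝ} (hh₀ : 0 < h₀)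
    (hle : ∀ t : ℝ, 0 < t → t ≤ h₀ →
      ∑ i : Fin N, ∑ k : Fin 3, sqDiff volume φ (t • coordDir i k) ≤ ENNReal.ofReal (t ^ 2) * K) :
    MemH1 (fun x => (φ x : ℂ)) ∧ ∫⁻ x, gradSq (fun x => (φ x : ℂ)) x ≤ K := by
  let ℓ : Fin N × Fin 3 → ℝ≥0∞ := fun q =>
    liminf (fun t : ℝ => sqDiff volume φ (t • coordDir q.1 q.2) / ENNReal.ofReal (t ^ 2)) (𝓝[>] 0)
  have hsum : ∑ q, ℓ q ≤ K := by
    refine (sum_liminf_le _ _).trans ?_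
    refine (liminf_le_liminf ?_).trans (liminf_const K).le
    filter_upwards [Ioc_mem_nhdsGT hh₀] with t ht
    have h1 := hle t ht.1 ht.2
    rw [← Fintype.sum_prod_type'] at h1
    simp_rw [ENNReal.div_eq_inv_mul]
    rw [← Finset.mul_sum, mul_comm, ← div_eq_mul_inv]
    exact ENNReal.div_le_of_le_mul' h1
  have hℓ : ∀ q, ℓ q ≤ K := fun q =>
    (Finset.single_le_sum (fun _ _ => zero_le) (Finset.mem_univ q)).trans hsum
  have hex : ∀ q : Fin N × Fin 3, ∃ v : Config N → ℝ, MemLp v 2 volume ∧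
      IsWeakDeriv volume φ v (coordDir q.1 q.2) ∧ ∫⁻ x, ‖v x‖ₑ ^ 2 ≤ ℓ q := fun q =>
    exists_isWeakDeriv hφ _ (ne_top_of_le_ne_top hK (hℓ q)) le_rfl
  choose v hv hw hvl using hex
  have hvc : ∀ q, MemLp (fun x => (v q x : ℂ)) 2 volume := fun q => (hv q).ofReal
  have hwc : ∀ q : Fin N × Fin 3,
      IsWeakPartial (fun x => (φ x : ℂ)) q.1 q.2 (fun x => (v q x : ℂ)) := by
    intro q η h1 h2
    have := congrArg (fun r : ℝ => (r : ℂ)) (hw q η h1 h2)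
    simp only [Complex.ofReal_neg, ← integral_complex_ofReal] at this
    simpa using this
  have hH1 : MemH1 (fun x => (φ x : ℂ)) := ⟨hφ.ofReal, fun i k => ⟨_, hvc (i, k), hwc (i, k)⟩⟩
  refine ⟨hH1, ?_⟩
  rw [lintegral_gradSq hH1, ← Fintype.sum_prod_type']
  refine (Finset.sum_le_sum fun q _ => ?_).trans hsum
  refine le_trans (le_of_eq ?_) (hvl q)
  obtain ⟨h1, h2⟩ := hH1.weakPartial_spec q.1 q.2
  refine lintegral_congr_ae ?_
  filter_upwards [h2.ae_unique (hwc q) h1 (hvc q)] with x hx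
  rw [hx]
  simp [← ofReal_norm]

end SobolevTransfer

/-! ### Finiteness of the Coulomb energy -/

section Hardy

/-- Testing a Lipschitz bounded field against `p²`: the line derivative is moved onto `p`. -/
theorem integral_lineDeriv_mul_sq_le {E : Type*} [NormedAddCommGroup E] [NormedSpace ℝ E]
    [FiniteDimensional ℝ E] [MeasurableSpace E] [BorelSpace E] {μ : Measure E}
    [μ.IsAddHaarMeasure] {p f : E → ℝ} (hp : MemLp p 2 μ) {K : NNReal} (hf : LipschitzWith K f)
    (hf1 : ∀ x, |f x| ≤ 1) (e : E) {T : ℝ≥0∞} (hT : T ≠ ⊤)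
    (hd : ∀ t : ℝ, sqDiff μ p (t • e) ≤ ENNReal.ofReal (t ^ 2) * T) :
    ∫ x, lineDeriv ℝ f x e * p x ^ 2 ∂μ ≤ 2 * Real.sqrt T.toReal * (eLpNorm p 2 μ).toReal := by
  have hq : Integrable (fun x => p x ^ 2) μ := hp.integrable_sq
  have hlim := hf.integral_inv_smul_sub_mul_tendsto_integral_lineDeriv_mul hq e
  refine le_of_tendsto hlim ?_
  filter_upwards [self_mem_nhdsWithin] with t ht
  have ht : 0 < t := ht
  set a := t • e with ha
  have hfm : AEStronglyMeasurable f μ := hf.continuous.aestronglyMeasurable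
  have hmul : ∀ {h : E → ℝ}, Integrable h μ → Integrable (fun x => f x * h x) μ := fun hh =>
    hh.bdd_mul hfm (Eventually.of_forall hf1)
  have hq' : Integrable (fun x => p (x + -a) ^ 2) μ := (memLp_translate hp (-a)).integrable_sq
  have hfa : Integrable (fun x => f (x + a) * p x ^ 2) μ := by
    have := (hmul hq').comp_add_right a
    simpa using this
  have hshift : ∫ x, f (x + a) * p x ^ 2 ∂μ = ∫ x, f x * p (x + -a) ^ 2 ∂μ := by
    have := integral_add_right_eq_self (μ := μ) (fun x => f x * p (x + -a) ^ 2) a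
    rw [← this]
    simp
  have h1 : ∫ x, t⁻¹ • (f (x + a) - f x) * p x ^ 2 ∂μ
      = t⁻¹ * ∫ x, f x * (p (x + -a) ^ 2 - p x ^ 2) ∂μ := by
    simp_rw [mul_sub, smul_eq_mul, mul_assoc, integral_const_mul, sub_mul]
    rw [integral_sub hfa (hmul hq), hshift, integral_sub (hmul hq') (hmul hq)]
  rw [h1, inv_mul_le_iff₀ ht]
  have hdm : MemLp (fun x => |p (x + -a) - p x|) 2 μ := ((memLp_translate hp _).sub hp).abs
  have hsm : MemLp (fun x => |p (x + -a)| + |p x|) 2 μ := (memLp_translate hp _).abs.add hp.abs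
  have h2 : ∫ x, f x * (p (x + -a) ^ 2 - p x ^ 2) ∂μ
      ≤ ∫ x, |p (x + -a) - p x| * (|p (x + -a)| + |p x|) ∂μ := by
    refine integral_mono (hmul (hq'.sub hq)) (MemLp.integrable_mul (p := 2) (q := 2) hdm hsm) ?_
    intro x
    calc f x * (p (x + -a) ^ 2 - p x ^ 2) ≤ |f x * (p (x + -a) ^ 2 - p x ^ 2)| := le_abs_self _
      _ = |f x| * |p (x + -a) ^ 2 - p x ^ 2| := abs_mul _ _
      _ ≤ 1 * |p (x + -a) ^ 2 - p x ^ 2| := by gcongr; exact hf1 x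
      _ = |p (x + -a) - p x| * |p (x + -a) + p x| := by rw [one_mul, ← abs_mul]; ring_nf
      _ ≤ _ := mul_le_mul_of_nonneg_left (abs_add_le _ _) (abs_nonneg _)
  have h3 := (le_abs_self _).trans (abs_integral_mul_le hdm hsm)
  have h4 : (eLpNorm (fun x => |p (x + -a) - p x|) 2 μ).toReal ≤ t * Real.sqrt T.toReal := by
    have h5 : eLpNorm (fun x => |p (x + -a) - p x|) 2 μ ^ 2 ≤ ENNReal.ofReal (t ^ 2) * T := by
      have := hd (-t)
      rw [neg_smul, neg_sq, ← ha, sqDiff, ← eLpNorm_two_sq] at this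
      have h7 : eLpNorm (fun x => |p (x + -a) - p x|) 2 μ
          = eLpNorm (fun x => p (x + -a) - p x) 2 μ := eLpNorm_norm (fun x => p (x + -a) - p x)
      rwa [h7]
    have h6 := ENNReal.toReal_mono (ENNReal.mul_ne_top ENNReal.ofReal_ne_top hT) h5
    rw [ENNReal.toReal_pow, ENNReal.toReal_mul, ENNReal.toReal_ofReal (by positivity)] at h6
    refine abs_le_of_sq_le_sq' ?_ (by positivity) |>.2
    rwa [mul_pow, Real.sq_sqrt ENNReal.toReal_nonneg]
  have h5 : (eLpNorm (fun x => |p (x + -a)| + |p x|) 2 μ).toReal ≤ 2 * (eLpNorm p 2 μ).toReal := by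
    have h7 : eLpNorm (fun x => |p (x + -a)| + |p x|) 2 μ ≤
        eLpNorm (fun x => |p (x + -a)|) 2 μ + eLpNorm (fun x => |p x|) 2 μ :=
      eLpNorm_add_le (memLp_translate hp (-a)).abs.aestronglyMeasurable
        hp.abs.aestronglyMeasurable (μ := μ) one_le_two
    have h8 : eLpNorm (fun x => |p (x + -a)|) 2 μ = eLpNorm p 2 μ :=
      (eLpNorm_norm (fun x => p (x + -a))).trans (eLpNorm_translate hp (-a))
    have h9 : eLpNorm (fun x => |p x|) 2 μ = eLpNorm p 2 μ := eLpNorm_norm p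
    rw [h8, h9] at h7
    refine (ENNReal.toReal_mono (ENNReal.add_ne_top.2 ⟨hp.2.ne, hp.2.ne⟩) h7).trans ?_
    rw [ENNReal.toReal_add hp.2.ne hp.2.ne, two_mul]
  calc _ ≤ _ := h2
    _ ≤ _ := h3
    _ ≤ (t * Real.sqrt T.toReal) * (2 * (eLpNorm p 2 μ).toReal) := by gcongr
    _ = _ := by ring

variable {N : ℕ}

/-- The smoothed distance `√(|x_i - x_j|² + δ²)`. -/
noncomputable def softDist (i j : Fin N) (δ : ℝ) (x : Config N) : ℝ :=
  Real.sqrt (‖x i - x j‖ ^ 2 + δ ^ 2)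

theorem softDist_ge {i j : Fin N} (δ : ℝ) (x : Config N) :
    δ ≤ softDist i j δ x := Real.le_sqrt_of_sq_le (by nlinarith [sq_nonneg ‖x i - x j‖])

theorem norm_le_softDist (i j : Fin N) (δ : ℝ) (x : Config N) :
    ‖x i - x j‖ ≤ softDist i j δ x := Real.le_sqrt_of_sq_le (by nlinarith [sq_nonneg δ])

theorem softDist_sq (i j : Fin N) (δ : ℝ) (x : Config N) :
    softDist i j δ x ^ 2 = ‖x i - x j‖ ^ 2 + δ ^ 2 := Real.sq_sqrt (by positivity)

theorem norm_sub_sub_le (i j : Fin N) (x y : Config N) :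
    ‖(x i - x j) - (y i - y j)‖ ≤ 2 * dist x y := by
  have h1 : (x i - x j) - (y i - y j) = (x i - y i) - (x j - y j) := by abel
  rw [h1]
  refine (norm_sub_le _ _).trans ?_
  rw [← dist_eq_norm, ← dist_eq_norm]
  linarith [dist_le_pi_dist x y i, dist_le_pi_dist x y j]

theorem abs_softDist_sub_le {i j : Fin N} {δ : ℝ} (hδ : 0 < δ) (x y : Config N) :
    |softDist i j δ x - softDist i j δ y| ≤ 2 * dist x y := by
  have h1 := softDist_sq i j δ x
  have h2 := softDist_sq i j δ y
  have h3 := norm_le_softDist i j δ x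
  have h4 := norm_le_softDist i j δ y
  have h5 := softDist_ge (i := i) (j := j) δ x
  have h6 := softDist_ge (i := i) (j := j) δ y
  have h7 := (abs_norm_sub_norm_le (x i - x j) (y i - y j)).trans (norm_sub_sub_le i j x y)
  set S := softDist i j δ x
  set S' := softDist i j δ y
  set a := ‖x i - x j‖
  set b := ‖y i - y j‖
  have ha : 0 ≤ a := norm_nonneg _
  have hb : 0 ≤ b := norm_nonneg _
  have h8 : (S - S') * (S + S') = (a - b) * (a + b) := by nlinarith
  have h9 : |S - S'| * (S + S') ≤ (2 * dist x y) * (S + S') := by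
    calc |S - S'| * (S + S') = |(S - S') * (S + S')| := by
          rw [abs_mul, abs_of_pos (by linarith : 0 < S + S')]
      _ = |a - b| * (a + b) := by rw [h8, abs_mul, abs_of_nonneg (by linarith : 0 ≤ a + b)]
      _ ≤ _ := by gcongr
  exact le_of_mul_le_mul_right h9 (by linarith)

theorem abs_coord_le (z : R3) (k : Fin 3) : |z k| ≤ ‖z‖ := PiLp.norm_apply_le z k

/-- The smoothed unit vector field `(x_i - x_j) / √(|x_i - x_j|² + δ²)`. -/
noncomputable def softField (i j : Fin N) (k : Fin 3) (δ : ℝ) (x : Config N) : ℝ :=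
  (x i - x j) k / softDist i j δ x

theorem abs_softField_le (i j : Fin N) (k : Fin 3) {δ : ℝ} (hδ : 0 < δ) (x : Config N) :
    |softField i j k δ x| ≤ 1 := by
  have h := softDist_ge (i := i) (j := j) δ x
  rw [softField, abs_div, abs_of_pos (hδ.trans_le h), div_le_one (hδ.trans_le h)]
  exact (abs_coord_le _ k).trans (norm_le_softDist i j δ x)

theorem lipschitz_softField (i j : Fin N) (k : Fin 3) {δ : ℝ} (hδ : 0 < δ) :
    LipschitzWith (Real.toNNReal (4 / δ)) (softField (N := N) i j k δ) := by
  refine LipschitzWith.of_dist_le_mul fun x y => ?_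
  rw [Real.coe_toNNReal _ (by positivity), Real.dist_eq]
  have h5 := softDist_ge (i := i) (j := j) δ x
  have h1 := abs_softDist_sub_le (i := i) (j := j) hδ x y
  have h2 := abs_softField_le i j k hδ y
  have h3 := (abs_coord_le _ k).trans (norm_sub_sub_le i j x y)
  have hS' : softDist i j δ y ≠ 0 := (hδ.trans_le (softDist_ge δ y)).ne'
  have h4 : (y i - y j) k = softField i j k δ y * softDist i j δ y := by
    rw [softField, div_mul_cancel₀ _ hS']
  have h6 : softField i j k δ x - softField i j k δ y =
      (((x i - x j) - (y i - y j)) k - softField i j k δ y *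
        (softDist i j δ x - softDist i j δ y)) / softDist i j δ x := by
    have : softDist i j δ x ≠ 0 := (hδ.trans_le h5).ne'
    rw [eq_div_iff this, sub_mul]
    have h7 : softField i j k δ x * softDist i j δ x = (x i - x j) k := by
      rw [softField, div_mul_cancel₀ _ this]
    have h8 : ((x i - x j) - (y i - y j)) k = (x i - x j) k - (y i - y j) k := rfl
    rw [h7, h8, h4]
    ring
  rw [h6, abs_div, abs_of_pos (hδ.trans_le h5), div_le_iff₀ (hδ.trans_le h5)]
  calc _ ≤ |((x i - x j) - (y i - y j)) k| + |softField i j k δ y| *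
        |softDist i j δ x - softDist i j δ y| := by
        rw [← abs_mul]; exact abs_sub _ _
    _ ≤ 2 * dist x y + 1 * (2 * dist x y) := by gcongr
    _ = 4 / δ * dist x y * δ := by field_simp; ring
    _ ≤ _ := by gcongr

theorem lineDeriv_softField {i j : Fin N} (hij : i ≠ j) (k : Fin 3) {δ : ℝ} (hδ : 0 < δ)
    (x : Config N) :
    lineDeriv ℝ (softField i j k δ) x (coordDir i k) =
      (softDist i j δ x)⁻¹ - (x i - x j) k ^ 2 * (softDist i j δ x)⁻¹ ^ 3 := by
  refine HasLineDerivAt.lineDeriv ?_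
  unfold HasLineDerivAt
  have h1 : ∀ t : ℝ, (x + t • coordDir i k) i - (x + t • coordDir i k) j
      = (x i - x j) + t • EuclideanSpace.single k (1 : ℝ) := by
    intro t
    simp [coordDir, hij.symm]
    abel
  have hk : ∀ t : ℝ, ((x i - x j) + t • EuclideanSpace.single k (1 : ℝ)) k = (x i - x j) k + t := by
    intro t
    simp
  have hn : ∀ t : ℝ, ‖(x i - x j) + t • EuclideanSpace.single k (1 : ℝ)‖ ^ 2
      = ‖x i - x j‖ ^ 2 + 2 * t * (x i - x j) k + t ^ 2 := by
    intro t
    rw [norm_add_sq_real, inner_smul_right, norm_smul, mul_pow]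
    simp [EuclideanSpace.inner_single_right]
    ring
  have h2 : (fun t : ℝ => softField i j k δ (x + t • coordDir i k)) = fun t : ℝ =>
      ((x i - x j) k + t) / Real.sqrt (‖x i - x j‖ ^ 2 + 2 * t * (x i - x j) k + t ^ 2 + δ ^ 2) := by
    ext t
    rw [softField, softDist, h1, hk, hn]
  rw [h2]
  set z := (x i - x j) k
  set S := softDist i j δ x with hS
  have hSpos : 0 < S := hδ.trans_le (softDist_ge δ x)
  have hS0 : Real.sqrt (‖x i - x j‖ ^ 2 + 2 * 0 * z + 0 ^ 2 + δ ^ 2) = S := by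
    rw [hS, softDist]; congr 1; ring
  have hq : HasDerivAt (fun t : ℝ => ‖x i - x j‖ ^ 2 + 2 * t * z + t ^ 2 + δ ^ 2) (2 * z) 0 := by
    have h5 : HasDerivAt (fun t : ℝ => 2 * t * z) (2 * 1 * z) 0 :=
      ((hasDerivAt_id (0 : ℝ)).const_mul 2).mul_const z
    have h6 : HasDerivAt (fun t : ℝ => t ^ 2) 0 0 := by
      simpa using hasDerivAt_pow 2 (0 : ℝ)
    have := ((h5.const_add (‖x i - x j‖ ^ 2)).add h6).add_const (δ ^ 2)
    simpa using this
  have hs := hq.sqrt (by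
    have : 0 < ‖x i - x j‖ ^ 2 + δ ^ 2 := by positivity
    simpa using this.ne')
  have hnum : HasDerivAt (fun t : ℝ => z + t) 1 0 := (hasDerivAt_id (0 : ℝ)).const_add z
  have hdiv := hnum.div hs (by rw [hS0]; exact hSpos.ne')
  rw [hS0] at hdiv
  have hval : S⁻¹ - z ^ 2 * S⁻¹ ^ 3 = (1 * S - (z + 0) * (2 * z / (2 * S))) / S ^ 2 := by
    field_simp
    ring
  rw [hval]
  exact hdiv

/-- The divergence of the smoothed unit field is at least `2 / √(|x_i - x_j|² + δ²)`. -/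
theorem two_inv_le_sum_lineDeriv {i j : Fin N} (hij : i ≠ j) {δ : ℝ} (hδ : 0 < δ) (x : Config N) :
    2 * (softDist i j δ x)⁻¹ ≤ ∑ k, lineDeriv ℝ (softField i j k δ) x (coordDir i k) := by
  simp_rw [lineDeriv_softField hij _ hδ]
  rw [Finset.sum_sub_distrib, ← Finset.sum_mul]
  have h1 : ∑ k, (x i - x j) k ^ 2 = ‖x i - x j‖ ^ 2 := by
    rw [EuclideanSpace.norm_sq_eq]
    simp
  have h2 := softDist_sq i j δ x
  have hS : 0 < softDist i j δ x := hδ.trans_le (softDist_ge δ x)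
  rw [h1]
  have h3 : ‖x i - x j‖ ^ 2 * (softDist i j δ x)⁻¹ ^ 3 ≤ (softDist i j δ x)⁻¹ := by
    calc _ ≤ softDist i j δ x ^ 2 * (softDist i j δ x)⁻¹ ^ 3 := by
          gcongr
          nlinarith [sq_nonneg δ]
      _ = _ := by field_simp
  simp only [Finset.sum_const, Finset.card_univ, Fintype.card_fin, nsmul_eq_mul]
  push_cast
  linarith

theorem continuous_softDist (i j : Fin N) (δ : ℝ) : Continuous (softDist (N := N) i j δ) := by
  unfold softDist
  fun_prop

/-- Hardy's inequality in qualitative form: a function with increments controlled in `L²` has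
finite Coulomb energy. -/
theorem lintegral_inv_edist_mul_sq_lt_top {p : Config N → ℝ} (hp : MemLp p 2 volume)
    {T : Fin N → Fin 3 → ℝ≥0∞} (hT : ∀ i k, T i k ≠ ⊤)
    (hd : ∀ i k (t : ℝ), sqDiff volume p (t • coordDir i k) ≤ ENNReal.ofReal (t ^ 2) * T i k)
    {i j : Fin N} (hij : i ≠ j) :
    ∫⁻ x, (edist (x i) (x j))⁻¹ * ‖p x‖ₑ ^ 2 < ⊤ := by
  set M : ℝ := ∑ k, 2 * Real.sqrt (T i k).toReal * (eLpNorm p 2 volume).toReal with hM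
  have hq : Integrable (fun x => p x ^ 2) volume := hp.integrable_sq
  have hint : ∀ δ : ℝ, 0 < δ → Integrable (fun x => (softDist i j δ x)⁻¹ * p x ^ 2) volume := by
    intro δ hδ
    refine hq.bdd_mul (c := δ⁻¹) ?_ ?_
    · exact ((continuous_softDist i j δ).inv₀ fun x =>
        (hδ.trans_le (softDist_ge δ x)).ne').aestronglyMeasurable
    · refine Eventually.of_forall fun x => ?_
      have := softDist_ge (i := i) (j := j) δ x
      rw [Real.norm_eq_abs, abs_of_pos (inv_pos.2 (hδ.trans_le this))]
      gcongr
  have hbound : ∀ δ : ℝ, 0 < δ → ∫ x, (softDist i j δ x)⁻¹ * p x ^ 2 ≤ M := by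
    intro δ hδ
    have hli : ∀ k, Integrable (fun x => lineDeriv ℝ (softField i j k δ) x (coordDir i k)
        * p x ^ 2) volume := fun k => hq.bdd_mul
      ((lipschitz_softField i j k hδ).memLp_lineDeriv (coordDir i k)).aestronglyMeasurable
      (Eventually.of_forall fun x => norm_lineDeriv_le_of_lipschitz ℝ (lipschitz_softField i j k hδ))
    calc ∫ x, (softDist i j δ x)⁻¹ * p x ^ 2
        ≤ ∫ x, ∑ k, lineDeriv ℝ (softField i j k δ) x (coordDir i k) * p x ^ 2 := by
          refine integral_mono (hint δ hδ) (integrable_finsetSum _ fun k _ => hli k) fun x => ?_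
          have h1 := two_inv_le_sum_lineDeriv hij hδ x
          have h2 : 0 < (softDist i j δ x)⁻¹ := inv_pos.2 (hδ.trans_le (softDist_ge δ x))
          simp only
          rw [← Finset.sum_mul]
          gcongr
          linarith
      _ = ∑ k, ∫ x, lineDeriv ℝ (softField i j k δ) x (coordDir i k) * p x ^ 2 :=
          integral_finsetSum _ fun k _ => hli k
      _ ≤ M := Finset.sum_le_sum fun k _ => integral_lineDeriv_mul_sq_le hp
          (lipschitz_softField i j k hδ) (abs_softField_le i j k hδ) _ (hT i k) (hd i k)
  let f : ℕ → Config N → ℝ≥0∞ := fun n x =>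
    ENNReal.ofReal ((softDist i j (1 / ((n : ℝ) + 1)) x)⁻¹ * p x ^ 2)
  have hδn : ∀ n : ℕ, 0 < 1 / ((n : ℝ) + 1) := fun n => Nat.one_div_pos_of_nat
  have hlim : ∀ᵐ x ∂(volume : Measure (Config N)),
      (edist (x i) (x j))⁻¹ * ‖p x‖ₑ ^ 2 ≤ liminf (fun n => f n x) atTop := by
    refine Eventually.of_forall fun x => ?_
    have h1 : Tendsto (fun n : ℕ => softDist i j (1 / ((n : ℝ) + 1)) x) atTop
        (𝓝 (dist (x i) (x j))) := by
      have hc : Continuous fun δ : ℝ => softDist i j δ x := by unfold softDist; fun_prop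
      have := (hc.tendsto 0).comp tendsto_one_div_add_atTop_nhds_zero_nat
      have h0 : softDist i j 0 x = dist (x i) (x j) := by
        rw [softDist, dist_eq_norm]
        simp
      rwa [h0] at this
    have h2 : Tendsto (fun n : ℕ => (ENNReal.ofReal (softDist i j (1 / ((n : ℝ) + 1)) x))⁻¹)
        atTop (𝓝 (edist (x i) (x j))⁻¹) := by
      rw [edist_dist]
      exact (ENNReal.tendsto_ofReal h1).inv
    have h3 : (edist (x i) (x j))⁻¹ = liminf (fun n : ℕ =>
        (ENNReal.ofReal (softDist i j (1 / ((n : ℝ) + 1)) x))⁻¹) atTop := h2.liminf_eq.symm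
    rw [h3, mul_comm, ← ENNReal.liminf_const_mul_of_ne_top (by simp)]
    refine liminf_le_liminf (Eventually.of_forall fun n => ?_)
    have hS : 0 < softDist i j (1 / ((n : ℝ) + 1)) x := (hδn n).trans_le (softDist_ge _ x)
    simp only [f]
    rw [ENNReal.ofReal_mul (by positivity), ENNReal.ofReal_inv_of_pos hS, mul_comm]
    gcongr
    rw [← ofReal_norm, ← ENNReal.ofReal_pow (norm_nonneg _), Real.norm_eq_abs, sq_abs]
  have hfm : ∀ n, AEMeasurable (f n) volume := fun n =>
    (hint _ (hδn n)).aestronglyMeasurable.aemeasurable.ennreal_ofReal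
  calc _ ≤ ∫⁻ x, liminf (fun n => f n x) atTop := lintegral_mono_ae hlim
    _ ≤ liminf (fun n => ∫⁻ x, f n x) atTop := lintegral_liminf_le' hfm
    _ ≤ liminf (fun _ : ℕ => ENNReal.ofReal M) atTop := by
        refine liminf_le_liminf (Eventually.of_forall fun n => ?_)
        simp only [f]
        rw [← ofReal_integral_eq_lintegral_ofReal (hint _ (hδn n))]
        · exact ENNReal.ofReal_le_ofReal (hbound _ (hδn n))
        · refine Eventually.of_forall fun x => ?_
          have := (hδn n).trans_le (softDist_ge (i := i) (j := j) _ x)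
          positivity
    _ < ⊤ := by simp

theorem lintegral_coulomb_mul_sq_ne_top {p : Config N → ℝ} (hp : MemLp p 2 volume)
    {T : Fin N → Fin 3 → ℝ≥0∞} (hT : ∀ i k, T i k ≠ ⊤)
    (hd : ∀ i k (t : ℝ), sqDiff volume p (t • coordDir i k) ≤ ENNReal.ofReal (t ^ 2) * T i k) :
    ∫⁻ x, coulomb x * ‖p x‖ₑ ^ 2 ≠ ⊤ := by
  have hm : ∀ i j : Fin N,
      AEMeasurable (fun x : Config N => (edist (x i) (x j))⁻¹ * ‖p x‖ₑ ^ 2) volume := fun i j =>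
    (((measurable_pi_apply i).edist (measurable_pi_apply j)).inv.aemeasurable).mul
      (hp.aestronglyMeasurable.enorm.pow_const 2)
  unfold coulomb
  simp_rw [Finset.sum_mul]
  rw [lintegral_finsetSum' _ (fun i _ => Finset.aemeasurable_fun_sum _ fun j _ => hm i j)]
  refine ENNReal.sum_ne_top.2 fun i _ => ?_
  rw [lintegral_finsetSum' _ (fun j _ => hm i j)]
  exact ENNReal.sum_ne_top.2 fun j hj =>
    (lintegral_inv_edist_mul_sq_lt_top hp hT hd (Finset.mem_Ioi.1 hj).ne).ne

end Hardy

/-! ### Marginals from the doubled configuration space -/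

section DoubledSpace

variable {N : ℕ}

/-- The space of pairs of configurations: the particles of the two copies are labelled by
`Fin N ⊕ Fin N`. -/
abbrev Doubled (N : ℕ) : Type := Fin N ⊕ Fin N → R3

/-- The `k`-th coordinate direction of particle `j` in the doubled space. -/
noncomputable def doubledDir (j : Fin N ⊕ Fin N) (k : Fin 3) : Doubled N :=
  Pi.single j (EuclideanSpace.single k (1 : ℝ))

theorem enorm_sq_real (a : ℝ) : ‖a‖ₑ ^ 2 = ENNReal.ofReal (a ^ 2) := by
  rw [← ofReal_norm, ← ENNReal.ofReal_pow (norm_nonneg _), Real.norm_eq_abs, sq_abs]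

theorem measurePreserving_sumElim :
    MeasurePreserving (fun q : Config N × Config N => (Sum.elim q.1 q.2 : Doubled N))
      (volume.prod volume) volume :=
  volume_measurePreserving_sumPiEquivProdPi_symm (ι := Fin N) (ι' := Fin N) fun _ => R3

theorem lintegral_doubled {f : Doubled N → ℝ≥0∞} (hf : Measurable f) :
    ∫⁻ z, f z = ∫⁻ x, ∫⁻ y, f (Sum.elim x y) := by
  rw [← measurePreserving_sumElim.lintegral_comp hf,
    lintegral_prod (fun q : Config N × Config N => f (Sum.elim q.1 q.2))
      (hf.comp measurePreserving_sumElim.measurable).aemeasurable]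

theorem measurePreserving_comp_perm {ι : Type*} [Fintype ι] (π : Equiv.Perm ι) :
    MeasurePreserving (fun z : ι → R3 => z ∘ π) volume volume := by
  have h := volume_measurePreserving_piCongrLeft (fun _ : ι => R3) π.symm
  have h2 : (fun z : ι → R3 => z ∘ π) = MeasurableEquiv.piCongrLeft (fun _ : ι => R3) π.symm := by
    ext z i
    have := MeasurableEquiv.piCongrLeft_apply_apply (β := fun _ : ι => R3) π.symm z (π i)
    simp only [Equiv.symm_apply_apply] at this
    simp [this]
  rwa [h2]

theorem lintegral_comp_perm {ι : Type*} [Fintype ι] (π : Equiv.Perm ι) {f : (ι → R3) → ℝ≥0∞}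
    (hf : Measurable f) : ∫⁻ z, f (z ∘ π) = ∫⁻ z, f z :=
  (measurePreserving_comp_perm π).lintegral_comp hf

theorem measurable_comp_index {ι κ : Type*} (f : κ → ι) : Measurable (fun z : ι → R3 => z ∘ f) :=
  measurable_pi_lambda _ fun _ => measurable_pi_apply _

theorem sumElim_measurable_right (x : Config N) :
    Measurable (fun y : Config N => (Sum.elim x y : Doubled N)) := by
  refine measurable_pi_lambda _ fun i => ?_
  rcases i with i | i <;> simp only [Sum.elim_inl, Sum.elim_inr]
  · exact measurable_const
  · exact measurable_pi_apply i

variable {ι : Type*} [Fintype ι]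

/-- The density at `x` of the first-copy marginal of `∑ₐ |Fₐ|²`. -/
noncomputable def fiberSq (F : ι → Doubled N → ℝ) (x : Config N) : ℝ≥0∞ :=
  ∑ a, ∫⁻ y, ‖F a (Sum.elim x y)‖ₑ ^ 2

/-- The nonnegative wave-function whose square is the first-copy marginal of `∑ₐ |Fₐ|²`.
Where the marginal is infinite its value is `0`; in the uses below this is a null set. -/
noncomputable def fiberNorm (F : ι → Doubled N → ℝ) (x : Config N) : ℝ :=
  Real.sqrt (fiberSq F x).toReal

variable {F : ι → Doubled N → ℝ} (hF : ∀ a, Measurable (F a))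

include hF

theorem measurable_fiberSq : Measurable (fiberSq F) := by
  refine Finset.measurable_fun_sum _ fun a _ => ?_
  have : Measurable (fun q : Config N × Config N => ‖F a (Sum.elim q.1 q.2)‖ₑ ^ 2) :=
    (((hF a).comp measurePreserving_sumElim.measurable).enorm).pow_const 2
  exact this.lintegral_prod_right'

theorem measurable_fiberNorm : Measurable (fiberNorm F) :=
  (measurable_fiberSq hF).ennreal_toReal.sqrt

theorem lintegral_mul_fiberSq {H : Config N → ℝ≥0∞} (hH : Measurable H) :
    ∫⁻ x, H x * fiberSq F x = ∑ a, ∫⁻ z : Doubled N, H (z ∘ Sum.inl) * ‖F a z‖ₑ ^ 2 := by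
  have hm : ∀ a, Measurable (fun z : Doubled N => H (z ∘ Sum.inl) * ‖F a z‖ₑ ^ 2) := fun a =>
    (hH.comp (measurable_comp_index _)).mul ((hF a).enorm.pow_const 2)
  simp_rw [lintegral_doubled (hm _)]
  rw [← lintegral_finsetSum]
  · refine lintegral_congr fun x => ?_
    rw [fiberSq, Finset.mul_sum]
    refine Finset.sum_congr rfl fun a _ => ?_
    rw [← lintegral_const_mul]
    · rfl
    · exact ((hF a).comp (sumElim_measurable_right x)).enorm.pow_const 2
  · intro a _
    have : Measurable (fun q : Config N × Config N =>
        H ((Sum.elim q.1 q.2 : Doubled N) ∘ Sum.inl) * ‖F a (Sum.elim q.1 q.2)‖ₑ ^ 2) :=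
      (hm a).comp measurePreserving_sumElim.measurable
    exact this.lintegral_prod_right'

variable (hfin : ∑ a, ∫⁻ z, ‖F a z‖ₑ ^ 2 ≠ ⊤)

include hfin

theorem ae_fiberSq_lt_top : ∀ᵐ x, fiberSq F x < ⊤ := by
  refine ae_lt_top (measurable_fiberSq hF) ?_
  have := lintegral_mul_fiberSq hF (H := fun _ => 1) measurable_const
  simp only [one_mul] at this
  rwa [this]

theorem ae_enorm_fiberNorm_sq : ∀ᵐ x, ‖fiberNorm F x‖ₑ ^ 2 = fiberSq F x := by
  filter_upwards [ae_fiberSq_lt_top hF hfin] with x hx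
  rw [enorm_sq_real, fiberNorm, Real.sq_sqrt ENNReal.toReal_nonneg, ENNReal.ofReal_toReal hx.ne]

theorem lintegral_mul_fiberNorm_sq {H : Config N → ℝ≥0∞} (hH : Measurable H) :
    ∫⁻ x, H x * ‖fiberNorm F x‖ₑ ^ 2 = ∑ a, ∫⁻ z : Doubled N, H (z ∘ Sum.inl) * ‖F a z‖ₑ ^ 2 := by
  rw [← lintegral_mul_fiberSq hF hH]
  refine lintegral_congr_ae ?_
  filter_upwards [ae_enorm_fiberNorm_sq hF hfin] with x hx
  rw [hx]

theorem memLp_fiberNorm : MemLp (fiberNorm F) 2 volume := by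
  refine ⟨(measurable_fiberNorm hF).aestronglyMeasurable, ?_⟩
  have h := lintegral_mul_fiberNorm_sq hF hfin (H := fun _ => 1) measurable_const
  simp only [one_mul, ← eLpNorm_two_sq] at h
  have h2 : eLpNorm (fiberNorm F) 2 volume ^ 2 ≠ ⊤ := by
    rw [h]
    simpa only [eLpNorm_two_sq] using hfin
  rw [lt_top_iff_ne_top]
  intro h3
  rw [h3] at h2
  simp at h2

omit hF hfin in
/-- The reverse triangle inequality for the `ℓ²`-sum of `L²` norms. -/
theorem enorm_sub_sqrt_sum_sq_le {f g : ι → Config N → ℝ} (hf : ∀ a, MemLp (f a) 2 volume)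
    (hg : ∀ a, MemLp (g a) 2 volume) :
    ‖Real.sqrt (∑ a, ∫⁻ y, ‖f a y‖ₑ ^ 2).toReal - Real.sqrt (∑ a, ∫⁻ y, ‖g a y‖ₑ ^ 2).toReal‖ₑ ^ 2
      ≤ ∑ a, ∫⁻ y, ‖f a y - g a y‖ₑ ^ 2 := by
  let nf : ι → ℝ := fun a => (eLpNorm (f a) 2 volume).toReal
  let ng : ι → ℝ := fun a => (eLpNorm (g a) 2 volume).toReal
  have key : ∀ h : ι → Config N → ℝ, (∀ a, MemLp (h a) 2 volume) →
      (∑ a, ∫⁻ y, ‖h a y‖ₑ ^ 2).toReal = ∑ a, (eLpNorm (h a) 2 volume).toReal ^ 2 := by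
    intro h hh
    simp_rw [← eLpNorm_two_sq]
    rw [ENNReal.toReal_sum fun a _ => ENNReal.pow_ne_top (hh a).eLpNorm_ne_top]
    simp
  have hnorm : ∀ v : ι → ℝ, Real.sqrt (∑ a, v a ^ 2) = ‖(WithLp.toLp 2 v : EuclideanSpace ℝ ι)‖ := by
    intro v
    rw [EuclideanSpace.norm_eq]
    simp
  rw [key f hf, key g hg, hnorm nf, hnorm ng, enorm_sq_real]
  have h1 : (‖(WithLp.toLp 2 nf : EuclideanSpace ℝ ι)‖ - ‖(WithLp.toLp 2 ng : EuclideanSpace ℝ ι)‖)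
      ^ 2 ≤ ∑ a, (eLpNorm (fun y => f a y - g a y) 2 volume).toReal ^ 2 := by
    calc _ ≤ ‖(WithLp.toLp 2 nf : EuclideanSpace ℝ ι) - WithLp.toLp 2 ng‖ ^ 2 := by
          rw [← sq_abs]
          gcongr
          exact abs_norm_sub_norm_le _ _
      _ = ∑ a, (nf a - ng a) ^ 2 := by
          rw [EuclideanSpace.norm_sq_eq]
          simp
      _ ≤ _ := by
          refine Finset.sum_le_sum fun a _ => ?_
          rw [← sq_abs]
          refine pow_le_pow_left₀ (abs_nonneg _) ?_ 2
          have h2 := abs_norm_sub_norm_le ((hf a).toLp (f a)) ((hg a).toLp (g a))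
          rw [← MemLp.toLp_sub, Lp.norm_toLp, Lp.norm_toLp, Lp.norm_toLp] at h2
          exact h2
  refine (ENNReal.ofReal_le_ofReal h1).trans ?_
  rw [ENNReal.ofReal_sum_of_nonneg fun a _ => by positivity]
  refine Finset.sum_le_sum fun a _ => ?_
  have h2 : MemLp (fun y => f a y - g a y) 2 volume := (hf a).sub (hg a)
  rw [ENNReal.ofReal_pow ENNReal.toReal_nonneg, ENNReal.ofReal_toReal h2.eLpNorm_ne_top,
    eLpNorm_two_sq]

/-- Convexity of the kinetic energy under marginals, in terms of increments. -/
theorem sqDiff_fiberNorm_le (e : Config N) :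
    sqDiff volume (fiberNorm F) e ≤ ∑ a, sqDiff volume (F a) (Sum.elim e 0) := by
  have hdm : ∀ a, Measurable (fun z : Doubled N => ‖F a (z + Sum.elim e 0) - F a z‖ₑ ^ 2) :=
    fun a => (((hF a).comp (measurable_id.add_const _)).sub (hF a)).enorm.pow_const 2
  unfold sqDiff
  simp_rw [lintegral_doubled (hdm _)]
  rw [← lintegral_finsetSum _ fun a _ => by
    have : Measurable (fun q : Config N × Config N =>
        ‖F a ((Sum.elim q.1 q.2 : Doubled N) + Sum.elim e 0) - F a (Sum.elim q.1 q.2)‖ₑ ^ 2) :=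
      (hdm a).comp measurePreserving_sumElim.measurable
    exact this.lintegral_prod_right']
  have h1 := ae_fiberSq_lt_top hF hfin
  have h2 : ∀ᵐ x, fiberSq F (x + e) < ⊤ :=
    (measurePreserving_add_right volume e).quasiMeasurePreserving.ae h1
  refine lintegral_mono_ae ?_
  filter_upwards [h1, h2] with x hx hxe
  have hmem : ∀ x, fiberSq F x < ⊤ → ∀ a, MemLp (fun y => F a (Sum.elim x y)) 2 volume := by
    intro x hx a
    refine ⟨((hF a).comp (sumElim_measurable_right x)).aestronglyMeasurable, ?_⟩
    have h3 : eLpNorm (fun y => F a (Sum.elim x y)) 2 volume ^ 2 < ⊤ := by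
      rw [eLpNorm_two_sq]
      refine lt_of_le_of_lt ?_ hx
      exact Finset.single_le_sum (f := fun a => ∫⁻ y, ‖F a (Sum.elim x y)‖ₑ ^ 2)
        (fun _ _ => zero_le) (Finset.mem_univ a)
    rw [lt_top_iff_ne_top] at h3 ⊢
    intro h4
    rw [h4] at h3
    simp at h3
  have h5 := enorm_sub_sqrt_sum_sq_le (hmem _ hxe) (hmem _ hx)
  have h6 : ∀ y : Config N, (Sum.elim x y : Doubled N) + Sum.elim e 0 = Sum.elim (x + e) y := by
    intro y
    ext i : 1
    rcases i with i | i <;> simp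
  simp_rw [h6]
  exact h5

end DoubledSpace

/-! ### Discrete IMS localization -/

section Localization

variable {E : Type*} [NormedAddCommGroup E] [NormedSpace ℝ E] [FiniteDimensional ℝ E]
  [MeasurableSpace E] [BorelSpace E] {μ : Measure E} [μ.IsAddHaarMeasure]

/-- `s ↦ √(1 - s²)` is `1`-Lipschitz on `[0, 1/2]`. -/
theorem abs_sqrt_one_sub_sq_sub_le {s s' : ℝ} (h0 : 0 ≤ s) (h1 : s ≤ 1 / 2) (h0' : 0 ≤ s')
    (h1' : s' ≤ 1 / 2) : (Real.sqrt (1 - s' ^ 2) - Real.sqrt (1 - s ^ 2)) ^ 2 ≤ (s' - s) ^ 2 := by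
  have hs : 0 ≤ 1 - s ^ 2 := by nlinarith
  have hs' : 0 ≤ 1 - s' ^ 2 := by nlinarith
  have h2 : 1 / 2 ≤ Real.sqrt (1 - s ^ 2) := Real.le_sqrt_of_sq_le (by nlinarith)
  have h2' : 1 / 2 ≤ Real.sqrt (1 - s' ^ 2) := Real.le_sqrt_of_sq_le (by nlinarith)
  have h3 := Real.sq_sqrt hs
  have h3' := Real.sq_sqrt hs'
  set c := Real.sqrt (1 - s ^ 2)
  set c' := Real.sqrt (1 - s' ^ 2)
  have h4 : (c' - c) * (c' + c) = -((s' - s) * (s' + s)) := by nlinarith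
  have h5 : ((c' - c) * (c' + c)) ^ 2 = (s' - s) ^ 2 * (s' + s) ^ 2 := by rw [h4]; ring
  have h6 : (c' - c) ^ 2 * 1 ≤ (c' - c) ^ 2 * (c' + c) ^ 2 := by
    gcongr
    nlinarith
  have h7 : (s' - s) ^ 2 * (s' + s) ^ 2 ≤ (s' - s) ^ 2 * 1 := by
    gcongr
    nlinarith
  nlinarith

/-- Discrete IMS localization formula: splitting a function with a quadratic partition of unity
costs the squared increments of the partition. -/
theorem sqDiff_localization_le {Ψ χ B : E → ℝ} (hΨ : Measurable Ψ) (hχ : Measurable χ)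
    (hB : Measurable B) (h0 : ∀ z, 0 ≤ χ z) (h1 : ∀ z, χ z ≤ 1 / 2) (e : E)
    (hl : ∀ z, |χ (z + e) - χ z| ≤ B z) (hr : ∀ z, |χ (z + e) - χ z| ≤ B (z + e)) :
    sqDiff μ (fun z => Real.sqrt (1 - χ z ^ 2) * Ψ z) e + sqDiff μ (fun z => χ z * Ψ z) e ≤
      sqDiff μ Ψ e + 2 * ∫⁻ z, ‖B z * Ψ z‖ₑ ^ 2 ∂μ := by
  have hpt : ∀ z, ‖Real.sqrt (1 - χ (z + e) ^ 2) * Ψ (z + e) - Real.sqrt (1 - χ z ^ 2) * Ψ z‖ₑ ^ 2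
      + ‖χ (z + e) * Ψ (z + e) - χ z * Ψ z‖ₑ ^ 2 ≤
      ‖Ψ (z + e) - Ψ z‖ₑ ^ 2 + (‖B z * Ψ z‖ₑ ^ 2 + ‖B (z + e) * Ψ (z + e)‖ₑ ^ 2) := by
    intro z
    simp only [enorm_sq_real]
    rw [← ENNReal.ofReal_add (by positivity) (by positivity),
      ← ENNReal.ofReal_add (by positivity) (by positivity),
      ← ENNReal.ofReal_add (by positivity) (by positivity)]
    refine ENNReal.ofReal_le_ofReal ?_
    have a1 := abs_sqrt_one_sub_sq_sub_le (h0 z) (h1 z) (h0 (z + e)) (h1 (z + e))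
    have a2 : 0 ≤ 1 - χ z ^ 2 := by nlinarith [h0 z, h1 z]
    have a3 : 0 ≤ 1 - χ (z + e) ^ 2 := by nlinarith [h0 (z + e), h1 (z + e)]
    have a4 := Real.sq_sqrt a2
    have a5 := Real.sq_sqrt a3
    have a6 : (χ (z + e) - χ z) ^ 2 ≤ B z ^ 2 := by
      rw [← sq_abs]; exact pow_le_pow_left₀ (abs_nonneg _) (hl z) 2
    have a7 : (χ (z + e) - χ z) ^ 2 ≤ B (z + e) ^ 2 := by
      rw [← sq_abs]; exact pow_le_pow_left₀ (abs_nonneg _) (hr z) 2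
    set c := Real.sqrt (1 - χ z ^ 2)
    set c' := Real.sqrt (1 - χ (z + e) ^ 2)
    set s := χ z
    set s' := χ (z + e)
    set u := Ψ z
    set u' := Ψ (z + e)
    have b1 : (c' * u' - c * u) ^ 2 + (s' * u' - s * u) ^ 2
        = (u' - u) ^ 2 + ((c' - c) ^ 2 + (s' - s) ^ 2) * (u' * u) := by
      linear_combination (u' ^ 2 - u' * u) * a5 + (u ^ 2 - u' * u) * a4
    have b2 : ((c' - c) ^ 2 + (s' - s) ^ 2) * (u' * u)
        ≤ ((c' - c) ^ 2 + (s' - s) ^ 2) * ((u' ^ 2 + u ^ 2) / 2) := by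
      gcongr
      nlinarith [sq_nonneg (u' - u)]
    have b3 : ((c' - c) ^ 2 + (s' - s) ^ 2) * ((u' ^ 2 + u ^ 2) / 2)
        ≤ (2 * (s' - s) ^ 2) * ((u' ^ 2 + u ^ 2) / 2) := by
      gcongr
      linarith
    have b4 : (s' - s) ^ 2 * u ^ 2 ≤ B z ^ 2 * u ^ 2 := by gcongr
    have b5 : (s' - s) ^ 2 * u' ^ 2 ≤ B (z + e) ^ 2 * u' ^ 2 := by gcongr
    rw [b1, mul_pow, mul_pow]
    linarith
  have hBΨ : Measurable (fun z => ‖B z * Ψ z‖ₑ ^ 2) := (hB.mul hΨ).enorm.pow_const 2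
  have hsh : Measurable (fun z : E => z + e) := measurable_id.add_const e
  have hχΨ : Measurable (fun z => χ z * Ψ z) := hχ.mul hΨ
  have hcΨ : Measurable (fun z => Real.sqrt (1 - χ z ^ 2) * Ψ z) :=
    ((hχ.pow_const 2).const_sub 1).sqrt.mul hΨ
  have htr : ∫⁻ z, ‖B (z + e) * Ψ (z + e)‖ₑ ^ 2 ∂μ = ∫⁻ z, ‖B z * Ψ z‖ₑ ^ 2 ∂μ :=
    lintegral_add_right_eq_self (fun z => ‖B z * Ψ z‖ₑ ^ 2) e
  have hm1 : Measurable (fun z => ‖Real.sqrt (1 - χ (z + e) ^ 2) * Ψ (z + e)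
      - Real.sqrt (1 - χ z ^ 2) * Ψ z‖ₑ ^ 2) := ((hcΨ.comp hsh).sub hcΨ).enorm.pow_const 2
  have hm2 : Measurable (fun z => ‖Ψ (z + e) - Ψ z‖ₑ ^ 2) :=
    ((hΨ.comp hsh).sub hΨ).enorm.pow_const 2
  unfold sqDiff
  rw [← lintegral_add_left hm1]
  refine (lintegral_mono hpt).trans (le_of_eq ?_)
  rw [lintegral_add_left hm2, lintegral_add_left hBΨ, htr, two_mul]

end Localization

/-! ### Exchanging a particle between two copies -/

section Competitor

variable {N : ℕ}

/-- The sum of the interactions `1 / |x_i - x_j|` over ordered pairs is twice the Coulomb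
interaction. -/
theorem two_mul_coulomb (x : Config N) :
    2 * coulomb x = ∑ i, ∑ j, if i = j then 0 else (edist (x i) (x j))⁻¹ := by
  have h1 : coulomb x = ∑ i, ∑ j, if i < j then (edist (x i) (x j))⁻¹ else 0 := by
    unfold coulomb
    refine Finset.sum_congr rfl fun i _ => ?_
    rw [← Finset.sum_filter]
    congr 1
    ext j
    simp
  have h2 : coulomb x = ∑ i, ∑ j, if j < i then (edist (x i) (x j))⁻¹ else 0 := by
    rw [h1, Finset.sum_comm]
    simp_rw [edist_comm]
  rw [two_mul]
  nth_rw 1 [h1]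
  rw [h2, ← Finset.sum_add_distrib]
  refine Finset.sum_congr rfl fun i _ => ?_
  rw [← Finset.sum_add_distrib]
  refine Finset.sum_congr rfl fun j _ => ?_
  rcases lt_trichotomy i j with h | h | h
  · simp [h, h.ne, h.not_gt]
  · simp [h]
  · simp [h, h.ne', h.not_gt]

/-- The order `i < j` in the definition of `coulomb` is immaterial. -/
theorem coulomb_comp_perm (σ : Equiv.Perm (Fin N)) (x : Config N) :
    coulomb (x ∘ σ) = coulomb x := by
  have h : 2 * coulomb (x ∘ σ) = 2 * coulomb x := by
    rw [two_mul_coulomb, two_mul_coulomb, ← Equiv.sum_comp σ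
      (fun i => ∑ j, if i = j then 0 else (edist (x i) (x j))⁻¹)]
    refine Finset.sum_congr rfl fun i _ => ?_
    rw [← Equiv.sum_comp σ (fun j => if σ i = j then 0 else (edist (x (σ i)) (x j))⁻¹)]
    simp
  exact (ENNReal.mul_right_inj two_ne_zero ENNReal.ofNat_ne_top).1 h

theorem measurable_coulomb : Measurable (coulomb (N := N)) := by
  unfold coulomb
  refine Finset.measurable_fun_sum _ fun i _ => Finset.measurable_fun_sum _ fun j _ => ?_
  exact ((measurable_pi_apply i).edist (measurable_pi_apply j)).inv

/-- Two independent copies of the wave-function `p`. -/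
def tensor (p : Config N → ℝ) (z : Doubled N) : ℝ := p (z ∘ Sum.inl) * p (z ∘ Sum.inr)

theorem measurable_tensor {p : Config N → ℝ} (hp : Measurable p) : Measurable (tensor p) :=
  (hp.comp (measurable_comp_index _)).mul (hp.comp (measurable_comp_index _))

theorem tensor_comp_sumComm (p : Config N → ℝ) (z : Doubled N) :
    tensor p (z ∘ Equiv.sumComm (Fin N) (Fin N)) = tensor p z := by
  unfold tensor
  rw [mul_comm]
  rfl

theorem lintegral_tensor_inl {p : Config N → ℝ} (hp : Measurable p) (h1 : ∫⁻ x, ‖p x‖ₑ ^ 2 = 1)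
    {H : Config N → ℝ≥0∞} (hH : Measurable H) :
    ∫⁻ z, H (z ∘ Sum.inl) * ‖tensor p z‖ₑ ^ 2 = ∫⁻ x, H x * ‖p x‖ₑ ^ 2 := by
  have hm : Measurable (fun z : Doubled N => H (z ∘ Sum.inl) * ‖tensor p z‖ₑ ^ 2) :=
    (hH.comp (measurable_comp_index _)).mul ((measurable_tensor hp).enorm.pow_const 2)
  rw [lintegral_doubled hm]
  refine lintegral_congr fun x => ?_
  have : ∀ y : Config N, H ((Sum.elim x y : Doubled N) ∘ Sum.inl) * ‖tensor p (Sum.elim x y)‖ₑ ^ 2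
      = H x * ‖p x‖ₑ ^ 2 * ‖p y‖ₑ ^ 2 := by
    intro y
    simp only [tensor, enorm_mul, mul_pow, Sum.elim_comp_inl, Sum.elim_comp_inr]
    ring
  simp_rw [this]
  rw [lintegral_const_mul _ (hp.enorm.pow_const 2), h1, mul_one]

theorem lintegral_tensor_inr {p : Config N → ℝ} (hp : Measurable p) (h1 : ∫⁻ x, ‖p x‖ₑ ^ 2 = 1)
    {H : Config N → ℝ≥0∞} (hH : Measurable H) :
    ∫⁻ z, H (z ∘ Sum.inr) * ‖tensor p z‖ₑ ^ 2 = ∫⁻ x, H x * ‖p x‖ₑ ^ 2 := by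
  rw [← lintegral_tensor_inl hp h1 hH, ← lintegral_comp_perm (Equiv.sumComm (Fin N) (Fin N))]
  · simp_rw [tensor_comp_sumComm]
    rfl
  · exact (hH.comp (measurable_comp_index _)).mul ((measurable_tensor hp).enorm.pow_const 2)

theorem sqDiff_comp_perm {U : Doubled N → ℝ} (hU : Measurable U)
    (π : Equiv.Perm (Fin N ⊕ Fin N)) (d : Doubled N) :
    sqDiff volume (fun z => U (z ∘ π)) d = sqDiff volume U (d ∘ π) := by
  unfold sqDiff
  have hm : Measurable (fun z => ‖U (z + d ∘ π) - U z‖ₑ ^ 2) :=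
    ((hU.comp (measurable_id.add_const _)).sub hU).enorm.pow_const 2
  rw [← lintegral_comp_perm π hm]
  rfl

theorem doubledDir_comp_perm (π : Equiv.Perm (Fin N ⊕ Fin N)) (j : Fin N ⊕ Fin N) (k : Fin 3)
    (t : ℝ) : (t • doubledDir j k) ∘ π = t • doubledDir (π.symm j) k := by
  funext i
  simp only [Function.comp_apply, Pi.smul_apply, doubledDir]
  congr 1
  by_cases h : π i = j
  · subst h
    simp
  · have h2 : i ≠ π.symm j := fun h3 => h (by simp [h3])
    rw [Pi.single_eq_of_ne h, Pi.single_eq_of_ne h2]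

theorem sumElim_coordDir (i : Fin N) (k : Fin 3) (t : ℝ) :
    (Sum.elim (t • coordDir i k) 0 : Doubled N) = t • doubledDir (Sum.inl i) k := by
  funext j
  rcases j with j | j
  · by_cases h : j = i
    · subst h
      simp [doubledDir, coordDir]
    · have h2 : (Sum.inl j : Fin N ⊕ Fin N) ≠ Sum.inl i := fun h3 => h (Sum.inl_injective h3)
      simp [doubledDir, coordDir, Pi.single_eq_of_ne h, Pi.single_eq_of_ne h2]
  · simp [doubledDir]

theorem sqDiff_tensor_inl {p : Config N → ℝ} (hp : Measurable p) (h1 : ∫⁻ x, ‖p x‖ₑ ^ 2 = 1)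
    (i : Fin N) (k : Fin 3) (t : ℝ) :
    sqDiff volume (tensor p) (t • doubledDir (Sum.inl i) k)
      = sqDiff volume p (t • coordDir i k) := by
  rw [← sumElim_coordDir]
  unfold sqDiff
  have ht := measurable_tensor hp
  have hm : Measurable (fun z : Doubled N =>
      ‖tensor p (z + Sum.elim (t • coordDir i k) 0) - tensor p z‖ₑ ^ 2) :=
    ((ht.comp (measurable_id.add_const _)).sub ht).enorm.pow_const 2
  rw [lintegral_doubled hm]
  refine lintegral_congr fun x => ?_
  have : ∀ y : Config N, ‖tensor p ((Sum.elim x y : Doubled N) + Sum.elim (t • coordDir i k) 0)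
      - tensor p (Sum.elim x y)‖ₑ ^ 2 = ‖p (x + t • coordDir i k) - p x‖ₑ ^ 2 * ‖p y‖ₑ ^ 2 := by
    intro y
    have h3 : ((Sum.elim x y : Doubled N) + Sum.elim (t • coordDir i k) 0) ∘ Sum.inl
        = x + t • coordDir i k := rfl
    have h4 : ((Sum.elim x y : Doubled N) + Sum.elim (t • coordDir i k) 0) ∘ Sum.inr = y := by
      funext l
      simp
    rw [tensor, tensor, h3, h4, Sum.elim_comp_inl, Sum.elim_comp_inr, ← sub_mul, enorm_mul, mul_pow]
  simp_rw [this]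
  rw [lintegral_const_mul _ (hp.enorm.pow_const 2), h1, mul_one]

theorem sqDiff_tensor_inr {p : Config N → ℝ} (hp : Measurable p) (h1 : ∫⁻ x, ‖p x‖ₑ ^ 2 = 1)
    (i : Fin N) (k : Fin 3) (t : ℝ) :
    sqDiff volume (tensor p) (t • doubledDir (Sum.inr i) k)
      = sqDiff volume p (t • coordDir i k) := by
  rw [← sqDiff_tensor_inl hp h1]
  have h := sqDiff_comp_perm (measurable_tensor hp) (Equiv.sumComm (Fin N) (Fin N))
    (t • doubledDir (Sum.inr i) k)
  simp_rw [tensor_comp_sumComm] at h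
  change sqDiff volume (tensor p) _ = _ at h
  rw [h, doubledDir_comp_perm]
  rfl

/-- The exchange of particle `i₀` between the two copies, performed if the flag is set. -/
def exchange (i₀ : Fin N) (c : Bool) : Equiv.Perm (Fin N ⊕ Fin N) :=
  if c then Equiv.swap (Sum.inl i₀) (Sum.inr i₀) else 1

/-- The exchange of the two copies, performed if the flag is set. -/
def flipCopies (b : Bool) : Equiv.Perm (Fin N ⊕ Fin N) :=
  if b then Equiv.sumComm (Fin N) (Fin N) else 1

/-- The relabellings used to symmetrize: permute the first copy, choose which copy is kept, and
exchange particle `i₀` between the copies. -/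
def relabel (i₀ : Fin N) (a : Equiv.Perm (Fin N) × Bool × Bool) : Equiv.Perm (Fin N ⊕ Fin N) :=
  Equiv.sumCongr a.1 1 * flipCopies a.2.1 * exchange i₀ a.2.2

/-- The Coulomb interaction of both copies. -/
noncomputable def pairCoulomb (z : Doubled N) : ℝ≥0∞ :=
  coulomb (z ∘ Sum.inl) + coulomb (z ∘ Sum.inr)

theorem measurable_pairCoulomb : Measurable (pairCoulomb (N := N)) :=
  (measurable_coulomb.comp (measurable_comp_index _)).add
    (measurable_coulomb.comp (measurable_comp_index _))

theorem exchange_symm (i₀ : Fin N) (c : Bool) : (exchange i₀ c).symm = exchange i₀ c := by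
  cases c
  · rfl
  · simp [exchange]

theorem relabel_symm_inl (i₀ : Fin N) (a : Equiv.Perm (Fin N) × Bool × Bool) (i : Fin N) :
    (relabel i₀ a).symm (Sum.inl i)
      = exchange i₀ a.2.2 (flipCopies a.2.1 (Sum.inl (a.1.symm i))) := by
  rw [Equiv.symm_apply_eq]
  simp only [relabel, Equiv.Perm.coe_mul, Function.comp_apply]
  have h1 : exchange i₀ a.2.2 (exchange i₀ a.2.2 (flipCopies a.2.1 (Sum.inl (a.1.symm i))))
      = flipCopies a.2.1 (Sum.inl (a.1.symm i)) := by
    nth_rw 1 [← exchange_symm]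
    exact Equiv.symm_apply_apply _ _
  rw [h1]
  rcases a with ⟨σ, b, c⟩
  cases b <;> simp [flipCopies]

theorem sum_flipCopies {M : Type*} [AddCommMonoid M] (f : Fin N ⊕ Fin N → M) :
    ∑ i, ∑ b : Bool, f (flipCopies b (Sum.inl i)) = ∑ j, f j := by
  rw [Fintype.sum_sum_type, ← Finset.sum_add_distrib]
  refine Finset.sum_congr rfl fun i _ => ?_
  simp [flipCopies, add_comm]

theorem exchange_sum_pair {M : Type*} [AddCommMonoid M] (i₀ : Fin N) (c : Bool) (i : Fin N)
    (f : Fin N ⊕ Fin N → M) :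
    ∑ b : Bool, f (exchange i₀ c (flipCopies b (Sum.inl i)))
      = ∑ b : Bool, f (flipCopies b (Sum.inl i)) := by
  cases c
  · rfl
  · by_cases h : i = i₀
    · subst h
      simp [exchange, flipCopies, add_comm]
    · have h1 : (Sum.inl i : Fin N ⊕ Fin N) ≠ Sum.inl i₀ := fun h3 => h (Sum.inl_injective h3)
      have h2 : (Sum.inr i : Fin N ⊕ Fin N) ≠ Sum.inr i₀ := fun h3 => h (Sum.inr_injective h3)
      simp [exchange, flipCopies, Equiv.swap_apply_of_ne_of_ne h1,
        Equiv.swap_apply_of_ne_of_ne _ h2]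

section Family

variable (i₀ : Fin N) (U : Bool → Doubled N → ℝ)

/-- The normalization of the symmetrized family: `2 (N!) κ² = 1`. -/
noncomputable def symmConst (N : ℕ) : ℝ :=
  Real.sqrt (1 / (2 * (Fintype.card (Equiv.Perm (Fin N)) : ℝ)))

/-- The family of amplitudes on the doubled space whose first-copy marginal is the competitor. -/
noncomputable def amplitudes (a : Equiv.Perm (Fin N) × Bool × Bool) (z : Doubled N) : ℝ :=
  symmConst N * U a.2.2 (z ∘ relabel i₀ a)

theorem two_mul_card_mul_symmConst :
    2 * ((Fintype.card (Equiv.Perm (Fin N)) : ℝ≥0∞) * ‖symmConst N‖ₑ ^ 2) = 1 := by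
  have hc : (0 : ℝ) < (Fintype.card (Equiv.Perm (Fin N)) : ℝ) := by
    exact_mod_cast Fintype.card_pos
  rw [enorm_sq_real, symmConst, Real.sq_sqrt (by positivity), ← ENNReal.ofReal_natCast,
    ← ENNReal.ofReal_mul hc.le, ← ENNReal.ofReal_ofNat 2, ← ENNReal.ofReal_mul (by norm_num),
    ENNReal.ofReal_eq_one]
  field_simp

variable {U} (hU : ∀ c, Measurable (U c))

include hU

theorem measurable_amplitudes (a : Equiv.Perm (Fin N) × Bool × Bool) :
    Measurable (amplitudes i₀ U a) :=
  ((hU _).comp (measurable_comp_index _)).const_mul _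

theorem lintegral_amplitudes {H : Config N → ℝ≥0∞} (hH : Measurable H)
    (a : Equiv.Perm (Fin N) × Bool × Bool) :
    ∫⁻ z : Doubled N, H (z ∘ Sum.inl) * ‖amplitudes i₀ U a z‖ₑ ^ 2 = ‖symmConst N‖ₑ ^ 2 *
      ∫⁻ z : Doubled N, H (fun i => z (exchange i₀ a.2.2 (flipCopies a.2.1 (Sum.inl (a.1.symm i)))))
        * ‖U a.2.2 z‖ₑ ^ 2 := by
  have hm : Measurable (fun z : Doubled N => H (z ∘ fun i =>
      exchange i₀ a.2.2 (flipCopies a.2.1 (Sum.inl (a.1.symm i)))) * ‖U a.2.2 z‖ₑ ^ 2) :=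
    (hH.comp (measurable_comp_index _)).mul ((hU _).enorm.pow_const 2)
  have h := lintegral_comp_perm (relabel i₀ a) hm
  change _ = _ * ∫⁻ z : Doubled N, H (z ∘ fun i =>
      exchange i₀ a.2.2 (flipCopies a.2.1 (Sum.inl (a.1.symm i)))) * ‖U a.2.2 z‖ₑ ^ 2
  rw [← h, ← lintegral_const_mul]
  · refine lintegral_congr fun z => ?_
    have h2 : ((z ∘ relabel i₀ a) ∘ fun i =>
        exchange i₀ a.2.2 (flipCopies a.2.1 (Sum.inl (a.1.symm i)))) = z ∘ Sum.inl := by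
      funext i
      simp only [Function.comp_apply, ← relabel_symm_inl, Equiv.apply_symm_apply]
    rw [h2, amplitudes, enorm_mul, mul_pow]
    ring
  · exact hm.comp (measurable_comp_index _)

/-- The Coulomb energy of the competitor is that of the two copies after the exchange. -/
theorem lintegral_pairCoulomb_competitor
    (hfin : ∑ a, ∫⁻ z, ‖amplitudes i₀ U a z‖ₑ ^ 2 ≠ ⊤) :
    2 * ∫⁻ x, coulomb x * ‖fiberNorm (amplitudes i₀ U) x‖ₑ ^ 2
      = ∑ c, ∫⁻ z, pairCoulomb (z ∘ exchange i₀ c) * ‖U c z‖ₑ ^ 2 := by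
  rw [lintegral_mul_fiberNorm_sq (measurable_amplitudes i₀ hU) hfin measurable_coulomb]
  simp_rw [lintegral_amplitudes i₀ hU measurable_coulomb]
  rw [Fintype.sum_prod_type]
  have h1 : ∀ (σ : Equiv.Perm (Fin N)) (q : Bool × Bool), ∫⁻ z : Doubled N, coulomb (fun i =>
      z (exchange i₀ q.2 (flipCopies q.1 (Sum.inl (σ.symm i))))) * ‖U q.2 z‖ₑ ^ 2
      = ∫⁻ z : Doubled N, coulomb (fun i =>
      z (exchange i₀ q.2 (flipCopies q.1 (Sum.inl i)))) * ‖U q.2 z‖ₑ ^ 2 := by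
    intro σ q
    refine lintegral_congr fun z => ?_
    rw [← coulomb_comp_perm σ.symm (fun i => z (exchange i₀ q.2 (flipCopies q.1 (Sum.inl i))))]
    rfl
  simp_rw [h1]
  rw [Finset.sum_const, Finset.card_univ, nsmul_eq_mul, ← Finset.mul_sum, ← mul_assoc,
    ← mul_assoc, mul_assoc 2, two_mul_card_mul_symmConst, one_mul, Fintype.sum_prod_type,
    Finset.sum_comm]
  refine Finset.sum_congr rfl fun c _ => ?_
  have hm : Measurable (fun z : Doubled N => coulomb ((z ∘ exchange i₀ c) ∘ Sum.inl)
      * ‖U c z‖ₑ ^ 2) :=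
    (measurable_coulomb.comp ((measurable_comp_index Sum.inl).comp (measurable_comp_index _))).mul
      ((hU c).enorm.pow_const 2)
  simp only [pairCoulomb, add_mul]
  rw [lintegral_add_left hm]
  simp only [Fintype.sum_bool, flipCopies, if_true]
  rw [add_comm]
  rfl

/-- The increments of the competitor are controlled by those of the amplitudes in all directions of
the doubled space; the exchange only permutes these directions. -/
theorem sum_sqDiff_competitor_le
    (hfin : ∑ a, ∫⁻ z, ‖amplitudes i₀ U a z‖ₑ ^ 2 ≠ ⊤) (t : ℝ) :
    2 * ∑ i, ∑ k, sqDiff volume (fiberNorm (amplitudes i₀ U)) (t • coordDir i k)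
      ≤ ∑ c, ∑ j, ∑ k, sqDiff volume (U c) (t • doubledDir j k) := by
  have h1 : ∀ (i : Fin N) (k : Fin 3) (a : Equiv.Perm (Fin N) × Bool × Bool),
      sqDiff volume (amplitudes i₀ U a) (Sum.elim (t • coordDir i k) 0)
        = ‖symmConst N‖ₑ ^ 2 * sqDiff volume (U a.2.2)
          (t • doubledDir (exchange i₀ a.2.2 (flipCopies a.2.1 (Sum.inl (a.1.symm i)))) k) := by
    intro i k a
    rw [sumElim_coordDir, ← relabel_symm_inl, ← doubledDir_comp_perm, ← sqDiff_comp_perm (hU _)]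
    unfold sqDiff
    rw [← lintegral_const_mul]
    · refine lintegral_congr fun z => ?_
      rw [amplitudes, amplitudes, ← mul_sub, enorm_mul, mul_pow]
    · have hm : Measurable (fun z : Doubled N => U a.2.2 (z ∘ relabel i₀ a)) :=
        (hU _).comp (measurable_comp_index _)
      exact ((hm.comp (measurable_id.add_const _)).sub hm).enorm.pow_const 2
  calc 2 * ∑ i, ∑ k, sqDiff volume (fiberNorm (amplitudes i₀ U)) (t • coordDir i k)
      ≤ 2 * ∑ i, ∑ k, ∑ a : Equiv.Perm (Fin N) × Bool × Bool, ‖symmConst N‖ₑ ^ 2 *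
          sqDiff volume (U a.2.2)
          (t • doubledDir (exchange i₀ a.2.2 (flipCopies a.2.1 (Sum.inl (a.1.symm i)))) k) := by
        gcongr with i _ k _
        refine (sqDiff_fiberNorm_le (measurable_amplitudes i₀ hU) hfin _).trans (le_of_eq ?_)
        exact Finset.sum_congr rfl fun a _ => h1 i k a
    _ = 2 * ∑ σ : Equiv.Perm (Fin N), ∑ c, ∑ k, ∑ i, ∑ b, ‖symmConst N‖ₑ ^ 2 *
          sqDiff volume (U c)
          (t • doubledDir (exchange i₀ c (flipCopies b (Sum.inl (σ.symm i)))) k) := by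
        congr 1
        simp_rw [Fintype.sum_prod_type]
        have e1 : ∀ (G : Fin N → Fin 3 → Equiv.Perm (Fin N) → Bool → Bool → ℝ≥0∞),
            ∑ i, ∑ k, ∑ σ, ∑ b, ∑ c, G i k σ b c = ∑ σ, ∑ c, ∑ k, ∑ i, ∑ b, G i k σ b c := by
          intro G
          calc _ = ∑ i, ∑ k, ∑ σ, ∑ c, ∑ b, G i k σ b c := by
                refine Finset.sum_congr rfl fun i _ => Finset.sum_congr rfl fun k _ =>
                  Finset.sum_congr rfl fun σ _ => Finset.sum_comm
            _ = ∑ k, ∑ i, ∑ σ, ∑ c, ∑ b, G i k σ b c := Finset.sum_comm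
            _ = ∑ k, ∑ σ, ∑ c, ∑ i, ∑ b, G i k σ b c := by
                refine Finset.sum_congr rfl fun k _ => ?_
                rw [Finset.sum_comm]
                exact Finset.sum_congr rfl fun σ _ => Finset.sum_comm
            _ = _ := by
                rw [Finset.sum_comm]
                exact Finset.sum_congr rfl fun σ _ => Finset.sum_comm
        exact e1 _
    _ = 2 * ∑ _σ : Equiv.Perm (Fin N), ‖symmConst N‖ₑ ^ 2 * ∑ c, ∑ k, ∑ j,
          sqDiff volume (U c) (t • doubledDir j k) := by
        congr 1
        refine Finset.sum_congr rfl fun σ _ => ?_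
        simp_rw [← Finset.mul_sum]
        congr 1
        refine Finset.sum_congr rfl fun c _ => Finset.sum_congr rfl fun k _ => ?_
        rw [Equiv.sum_comp σ.symm (fun i => ∑ b, sqDiff volume (U c)
          (t • doubledDir (exchange i₀ c (flipCopies b (Sum.inl i))) k)),
          sum_flipCopies (fun j => sqDiff volume (U c) (t • doubledDir (exchange i₀ c j) k)),
          Equiv.sum_comp (exchange i₀ c) (fun j => sqDiff volume (U c) (t • doubledDir j k))]
    _ = ∑ c, ∑ k, ∑ j, sqDiff volume (U c) (t • doubledDir j k) := by
        rw [Finset.sum_const, Finset.card_univ, nsmul_eq_mul, ← mul_assoc, ← mul_assoc,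
          mul_assoc 2, two_mul_card_mul_symmConst, one_mul]
    _ = _ := Finset.sum_congr rfl fun c _ => Finset.sum_comm

omit hU in
theorem fiberNorm_amplitudes_comp_perm (σ : Equiv.Perm (Fin N)) (x : Config N) :
    fiberNorm (amplitudes i₀ U) (x ∘ σ) = fiberNorm (amplitudes i₀ U) x := by
  unfold fiberNorm
  congr 2
  unfold fiberSq
  rw [Fintype.sum_prod_type, Fintype.sum_prod_type, ← Equiv.sum_comp (Equiv.mulLeft σ)
    (fun τ => ∑ q : Bool × Bool, ∫⁻ y, ‖amplitudes i₀ U (τ, q) (Sum.elim x y)‖ₑ ^ 2)]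
  refine Finset.sum_congr rfl fun τ _ => Finset.sum_congr rfl fun q _ => lintegral_congr fun y => ?_
  have h : (Sum.elim (x ∘ σ) y : Doubled N) ∘ relabel i₀ (τ, q)
      = (Sum.elim x y : Doubled N) ∘ relabel i₀ (Equiv.mulLeft σ τ, q) := by
    funext j
    simp only [relabel, Equiv.Perm.coe_mul, Function.comp_apply]
    rcases flipCopies q.1 (exchange i₀ q.2 j) with i | i <;> simp
  rw [amplitudes, amplitudes, h]

/-- The competitor has the same one-particle marginals as `p`. -/
theorem lintegral_marginal_competitor
    (hfin : ∑ a, ∫⁻ z, ‖amplitudes i₀ U a z‖ₑ ^ 2 ≠ ⊤) {p : Config N → ℝ} (hp : Measurable p)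
    (h1 : ∫⁻ x, ‖p x‖ₑ ^ 2 = 1)
    (hsum : ∀ z, ‖U false z‖ₑ ^ 2 + ‖U true z‖ₑ ^ 2 = ‖tensor p z‖ₑ ^ 2)
    {f : R3 → ℝ≥0∞} (hf : Measurable f)
    (hmarg : ∀ i j : Fin N, ∫⁻ x, f (x i) * ‖p x‖ₑ ^ 2 = ∫⁻ x, f (x j) * ‖p x‖ₑ ^ 2)
    (i : Fin N) :
    ∫⁻ x, f (x i) * ‖fiberNorm (amplitudes i₀ U) x‖ₑ ^ 2 = ∫⁻ x, f (x i) * ‖p x‖ₑ ^ 2 := by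
  have hfi : ∀ i : Fin N, Measurable fun x : Config N => f (x i) := fun i =>
    hf.comp (measurable_pi_apply i)
  have hfj : ∀ j : Fin N ⊕ Fin N, Measurable fun z : Doubled N => f (z j) := fun j =>
    hf.comp (measurable_pi_apply j)
  have hm : ∀ j c, Measurable (fun z : Doubled N => f (z j) * ‖U c z‖ₑ ^ 2) := fun j c =>
    (hfj j).mul ((hU c).enorm.pow_const 2)
  rw [lintegral_mul_fiberNorm_sq (measurable_amplitudes i₀ hU) hfin (hfi i)]
  simp_rw [lintegral_amplitudes i₀ hU (hfi i)]
  rw [Fintype.sum_prod_type]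
  have h2 : ∀ σ : Equiv.Perm (Fin N), ∑ q : Bool × Bool, ‖symmConst N‖ₑ ^ 2 * ∫⁻ z : Doubled N,
      f (z (exchange i₀ q.2 (flipCopies q.1 (Sum.inl (σ.symm i))))) * ‖U q.2 z‖ₑ ^ 2
      = ‖symmConst N‖ₑ ^ 2 * (2 * ∫⁻ x, f (x i) * ‖p x‖ₑ ^ 2) := by
    intro σ
    rw [← Finset.mul_sum, Fintype.sum_prod_type, Finset.sum_comm]
    congr 1
    have h3 : ∀ c, ∑ b, ∫⁻ z : Doubled N,
        f (z (exchange i₀ c (flipCopies b (Sum.inl (σ.symm i))))) * ‖U c z‖ₑ ^ 2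
        = ∑ b, ∫⁻ z : Doubled N, f (z (flipCopies b (Sum.inl (σ.symm i)))) * ‖U c z‖ₑ ^ 2 :=
      fun c => exchange_sum_pair i₀ c (σ.symm i)
        (fun j => ∫⁻ z : Doubled N, f (z j) * ‖U c z‖ₑ ^ 2)
    simp_rw [h3]
    rw [Finset.sum_comm]
    have h4 : ∀ j, ∑ c, ∫⁻ z : Doubled N, f (z j) * ‖U c z‖ₑ ^ 2
        = ∫⁻ z : Doubled N, f (z j) * ‖tensor p z‖ₑ ^ 2 := by
      intro j
      rw [Fintype.sum_bool, ← lintegral_add_left (hm j true)]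
      refine lintegral_congr fun z => ?_
      rw [← mul_add, add_comm, hsum]
    simp_rw [h4]
    simp only [Fintype.sum_bool, flipCopies, if_true]
    have h5 := lintegral_tensor_inl hp h1 (hfi (σ.symm i))
    have h6 := lintegral_tensor_inr hp h1 (hfi (σ.symm i))
    rw [two_mul, hmarg i (σ.symm i)]
    nth_rw 1 [← h6]
    rw [← h5]
    rfl
  simp_rw [h2]
  rw [Finset.sum_const, Finset.card_univ, nsmul_eq_mul, ← mul_assoc, ← mul_assoc, mul_comm _ 2,
    two_mul_card_mul_symmConst, one_mul]

theorem sum_lintegral_amplitudes {p : Config N → ℝ} (hp : Measurable p)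
    (h1 : ∫⁻ x, ‖p x‖ₑ ^ 2 = 1)
    (hsum : ∀ z, ‖U false z‖ₑ ^ 2 + ‖U true z‖ₑ ^ 2 = ‖tensor p z‖ₑ ^ 2) :
    ∑ a, ∫⁻ z, ‖amplitudes i₀ U a z‖ₑ ^ 2 ≠ ⊤ := by
  refine ENNReal.sum_ne_top.2 fun a _ => ?_
  have h2 := lintegral_amplitudes i₀ hU (H := fun _ => 1) measurable_const a
  simp only [one_mul] at h2
  rw [h2]
  refine ENNReal.mul_ne_top (by simp) ?_
  have h3 := lintegral_tensor_inl hp h1 (H := fun _ => 1) measurable_const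
  simp only [one_mul, h1] at h3
  refine ne_top_of_le_ne_top ENNReal.one_ne_top (h3 ▸ lintegral_mono fun z => ?_)
  rw [← hsum z]
  rcases a.2.2 with _ | _
  · exact le_self_add
  · exact le_add_self

end Family

end Competitor

/-! ### The energy balance of an exchange -/

section KeyInequality

variable {N : ℕ}

theorem HasOneBodyDensity.lintegral_eq {ψ : Config N → ℂ} {ρ : Measure R3}
    (h : HasOneBodyDensity ψ ρ) (hψ : AEStronglyMeasurable ψ volume) {f : R3 → ℝ≥0∞}
    (hf : Measurable f) (i : Fin N) :
    (N : ℝ≥0∞) * ∫⁻ x, f (x i) * ‖ψ x‖ₑ ^ 2 = ∫⁻ y, f y ∂ρ := by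
  rw [← h i, lintegral_smul_measure, lintegral_map hf (measurable_pi_apply i),
    lintegral_withDensity_eq_lintegral_mul₀ (g := fun x => f (x i)) (hψ.enorm.pow_const 2)
      (hf.comp (measurable_pi_apply i)).aemeasurable, smul_eq_mul]
  simp [mul_comm]

/-- Equal one-particle marginals give equal one-body densities. -/
theorem HasOneBodyDensity.of_marginals {ψ φ : Config N → ℂ} {ρ : Measure R3}
    (h : HasOneBodyDensity ψ ρ) (hψ : AEStronglyMeasurable ψ volume)
    (heq : ∀ (i : Fin N) (f : R3 → ℝ≥0∞), Measurable f →
      ∫⁻ x, f (x i) * ‖φ x‖ₑ ^ 2 = ∫⁻ x, f (x i) * ‖ψ x‖ₑ ^ 2) :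
    HasOneBodyDensity φ ρ := by
  intro i
  refine Measure.ext fun A hA => ?_
  have hf : Measurable (A.indicator (1 : R3 → ℝ≥0∞)) := measurable_one.indicator hA
  have h1 := h.lintegral_eq hψ hf i
  rw [← heq i _ hf, lintegral_indicator_one hA] at h1
  rw [← h1, Measure.smul_apply, smul_eq_mul, Measure.map_apply (measurable_pi_apply i) hA,
    withDensity_apply _ (measurable_pi_apply i hA),
    ← lintegral_indicator (measurable_pi_apply i hA)]
  congr 1
  refine lintegral_congr fun x => ?_
  by_cases hx : x i ∈ A
  · rw [Set.indicator_of_mem (show x ∈ (fun x : Config N => x i) ⁻¹' A from hx)]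
    simp [hx]
  · rw [Set.indicator_of_notMem (show x ∉ (fun x : Config N => x i) ⁻¹' A from hx)]
    simp [hx]

/-- The two amplitudes of the localized pair wave-function: the part that is left unchanged and the
part in which a particle is exchanged. -/
noncomputable def splitAmplitude (χ : Doubled N → ℝ) (p : Config N → ℝ) (c : Bool)
    (z : Doubled N) : ℝ :=
  if c then χ z * tensor p z else Real.sqrt (1 - χ z ^ 2) * tensor p z

/-- The energy balance of the exchange of particle `i₀` between two independent copies of the
minimizer: the Coulomb energy released is at most the kinetic cost of the localization. -/
theorem IsMinimizer.exchange_inequality {ε : ℝ} {ρ : Measure R3} {ψ : Config N → ℂ}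
    (hmin : IsMinimizer ε ρ ψ) {p : Config N → ℝ} (hp : Measurable p)
    (hpψ : p =ᵐ[volume] fun x => ‖ψ x‖) (h1 : ∫⁻ x, ‖p x‖ₑ ^ 2 = 1) (i₀ : Fin N)
    {χ : Doubled N → ℝ} (hχ : Measurable χ) (hχ0 : ∀ z, 0 ≤ χ z) (hχ1 : ∀ z, χ z ≤ 1 / 2)
    {B : Fin N ⊕ Fin N → Doubled N → ℝ} (hB : ∀ j, Measurable (B j))
    (hBfin : ∀ j, ∫⁻ z, ‖B j z * tensor p z‖ₑ ^ 2 ≠ ⊤) {h₀ : ℝ} (hh₀ : 0 < h₀)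
    (hl : ∀ j k (t : ℝ), 0 < t → t ≤ h₀ → ∀ z,
      |χ (z + t • doubledDir j k) - χ z| ≤ t * B j z ∧
      |χ (z + t • doubledDir j k) - χ z| ≤ t * B j (z + t • doubledDir j k)) :
    ∫⁻ z, pairCoulomb z * ‖χ z * tensor p z‖ₑ ^ 2 ≠ ⊤ ∧
    ∫⁻ z, pairCoulomb z * ‖χ z * tensor p z‖ₑ ^ 2 ≤
      (∫⁻ z, pairCoulomb (z ∘ exchange i₀ true) * ‖χ z * tensor p z‖ₑ ^ 2) +
      2 * ENNReal.ofReal ε * ∑ j, ∑ _k : Fin 3, ∫⁻ z, ‖B j z * tensor p z‖ₑ ^ 2 := by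
  obtain ⟨⟨hH1, -, hdens⟩, hmin⟩ := hmin
  have hψm := hH1.1.aestronglyMeasurable
  have hpe : (fun x => ‖p x‖ₑ ^ 2) =ᵐ[volume] fun x => ‖ψ x‖ₑ ^ 2 := by
    filter_upwards [hpψ] with x hx
    rw [hx, enorm_norm]
  have hpL : MemLp p 2 volume := (memLp_congr_ae hpψ).2 hH1.1.norm
  have hN : (N : ℝ≥0∞) ≠ 0 := by
    have : N ≠ 0 := fun h => by subst h; exact i₀.elim0
    exact_mod_cast this
  have hcongr : ∀ H : Config N → ℝ≥0∞, ∫⁻ x, H x * ‖p x‖ₑ ^ 2 = ∫⁻ x, H x * ‖ψ x‖ₑ ^ 2 := by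
    intro H
    refine lintegral_congr_ae ?_
    filter_upwards [hpe] with x hx
    rw [hx]
  have hmarg : ∀ f : R3 → ℝ≥0∞, Measurable f → ∀ i j : Fin N,
      ∫⁻ x, f (x i) * ‖p x‖ₑ ^ 2 = ∫⁻ x, f (x j) * ‖p x‖ₑ ^ 2 := by
    intro f hf i j
    rw [hcongr, hcongr]
    have := (hdens.lintegral_eq hψm hf i).trans (hdens.lintegral_eq hψm hf j).symm
    exact (ENNReal.mul_right_inj hN (ENNReal.natCast_ne_top N)).1 this
  set T : Fin N → Fin 3 → ℝ≥0∞ := fun i k => ∫⁻ x, ‖weakPartial ψ i k x‖ₑ ^ 2 with hTdef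
  have hT : ∀ i k, T i k ≠ ⊤ := fun i k => by
    simp only [hTdef]
    rw [← eLpNorm_two_sq]
    exact ENNReal.pow_ne_top (hH1.weakPartial_spec i k).1.eLpNorm_ne_top
  have hd : ∀ i k (t : ℝ), sqDiff volume p (t • coordDir i k) ≤ ENNReal.ofReal (t ^ 2) * T i k :=
    fun i k t => hH1.sqDiff_norm_le hpψ i k t
  have hVfin := lintegral_coulomb_mul_sq_ne_top hpL hT hd
  -- the amplitudes of the competitor
  let U := splitAmplitude χ p
  have htm := measurable_tensor hp
  have hU : ∀ c, Measurable (U c) := by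
    intro c
    cases c
    · exact ((hχ.pow_const 2).const_sub 1).sqrt.mul htm
    · exact hχ.mul htm
  have hsum : ∀ z, ‖U false z‖ₑ ^ 2 + ‖U true z‖ₑ ^ 2 = ‖tensor p z‖ₑ ^ 2 := by
    intro z
    have h2 : 0 ≤ 1 - χ z ^ 2 := by nlinarith [hχ0 z, hχ1 z]
    simp only [U, splitAmplitude, Bool.false_eq_true, if_false, if_true, enorm_sq_real]
    rw [← ENNReal.ofReal_add (by positivity) (by positivity), mul_pow, mul_pow, Real.sq_sqrt h2]
    congr 1
    ring
  have hfin := sum_lintegral_amplitudes i₀ hU hp h1 hsum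
  set φ := fiberNorm (amplitudes i₀ U) with hφdef
  have hφL : MemLp φ 2 volume := memLp_fiberNorm (measurable_amplitudes i₀ hU) hfin
  set S : ℝ≥0∞ := ∑ j, ∑ _k : Fin 3, ∫⁻ z, ‖B j z * tensor p z‖ₑ ^ 2 with hS
  have hSfin : S ≠ ⊤ := ENNReal.sum_ne_top.2 fun j _ => ENNReal.sum_ne_top.2 fun _ _ => hBfin j
  have hTsum : ∑ i, ∑ k, T i k ≠ ⊤ :=
    ENNReal.sum_ne_top.2 fun i _ => ENNReal.sum_ne_top.2 fun k _ => hT i k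
  -- kinetic energy of the competitor
  have hkin : ∀ t : ℝ, 0 < t → t ≤ h₀ →
      ∑ i, ∑ k, sqDiff volume φ (t • coordDir i k)
        ≤ ENNReal.ofReal (t ^ 2) * ((∑ i, ∑ k, T i k) + S) := by
    intro t ht ht0
    have h2 := sum_sqDiff_competitor_le i₀ hU hfin t
    have h3 : ∀ j k, sqDiff volume (U false) (t • doubledDir j k)
        + sqDiff volume (U true) (t • doubledDir j k) ≤
        sqDiff volume (tensor p) (t • doubledDir j k)
          + 2 * (ENNReal.ofReal (t ^ 2) * ∫⁻ z, ‖B j z * tensor p z‖ₑ ^ 2) := by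
      intro j k
      have h4 := sqDiff_localization_le (μ := (volume : Measure (Doubled N))) htm hχ
        ((hB j).const_mul t) hχ0 hχ1 (t • doubledDir j k)
        (fun z => (hl j k t ht ht0 z).1) (fun z => (hl j k t ht ht0 z).2)
      refine h4.trans (le_of_eq ?_)
      congr 2
      have hm : Measurable (fun z => ‖B j z * tensor p z‖ₑ ^ 2) :=
        ((hB j).mul htm).enorm.pow_const 2
      rw [← lintegral_const_mul _ hm]
      refine lintegral_congr fun z => ?_
      rw [mul_assoc, enorm_mul, mul_pow, enorm_sq_real t]
    have h5 : ∑ j, ∑ k, sqDiff volume (tensor p) (t • doubledDir j k)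
        ≤ 2 * (ENNReal.ofReal (t ^ 2) * ∑ i, ∑ k, T i k) := by
      rw [Fintype.sum_sum_type]
      simp_rw [sqDiff_tensor_inl hp h1, sqDiff_tensor_inr hp h1]
      rw [← two_mul]
      refine mul_le_mul_right ?_ 2
      rw [Finset.mul_sum]
      refine Finset.sum_le_sum fun i _ => ?_
      rw [Finset.mul_sum]
      exact Finset.sum_le_sum fun k _ => hd i k t
    have h6 : 2 * ∑ i, ∑ k, sqDiff volume φ (t • coordDir i k)
        ≤ 2 * (ENNReal.ofReal (t ^ 2) * ((∑ i, ∑ k, T i k) + S)) := by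
      calc _ ≤ _ := h2
        _ = ∑ j, ∑ k, (sqDiff volume (U false) (t • doubledDir j k)
            + sqDiff volume (U true) (t • doubledDir j k)) := by
            rw [Fintype.sum_bool, add_comm]
            simp_rw [Finset.sum_add_distrib]
        _ ≤ ∑ j, ∑ k, (sqDiff volume (tensor p) (t • doubledDir j k)
            + 2 * (ENNReal.ofReal (t ^ 2) * ∫⁻ z, ‖B j z * tensor p z‖ₑ ^ 2)) :=
            Finset.sum_le_sum fun j _ => Finset.sum_le_sum fun k _ => h3 j k
        _ = (∑ j, ∑ k, sqDiff volume (tensor p) (t • doubledDir j k))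
            + 2 * (ENNReal.ofReal (t ^ 2) * S) := by
            simp_rw [Finset.sum_add_distrib, hS, Finset.mul_sum]
        _ ≤ _ := by
            rw [mul_add, mul_add]
            gcongr
    exact (ENNReal.mul_le_mul_iff_right two_ne_zero ENNReal.ofNat_ne_top).1 h6
  obtain ⟨hφH1, hφT⟩ := memH1_of_sqDiff_le hφL (ENNReal.add_ne_top.2 ⟨hTsum, hSfin⟩) hh₀ hkin
  -- the competitor is admissible
  have hφe : ∀ x, ‖(φ x : ℂ)‖ₑ = ‖φ x‖ₑ := fun x => by
    simp [← ofReal_norm]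
  have hadm : Admissible ρ (fun x => (φ x : ℂ)) := by
    refine ⟨hφH1, fun σ => Eventually.of_forall fun x => ?_, ?_⟩
    · exact congrArg _ (fiberNorm_amplitudes_comp_perm i₀ σ x)
    · refine hdens.of_marginals hψm fun i f hf => ?_
      simp_rw [hφe]
      rw [lintegral_marginal_competitor i₀ hU hfin hp h1 hsum hf (hmarg f hf) i, hcongr]
  have hE := hmin _ hadm
  -- split the energies
  have hgm : ∀ {η : Config N → ℂ}, MemH1 η → AEMeasurable (fun x => ENNReal.ofReal ε * gradSq η x)
      volume := by
    intro η hη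
    refine AEMeasurable.const_mul ?_ _
    exact Finset.aemeasurable_fun_sum _ fun i _ => Finset.aemeasurable_fun_sum _ fun k _ =>
      (hη.weakPartial_spec i k).1.aestronglyMeasurable.enorm.pow_const 2
  have hEψ : energy ε ψ = ENNReal.ofReal ε * (∑ i, ∑ k, T i k)
      + ∫⁻ x, coulomb x * ‖p x‖ₑ ^ 2 := by
    rw [energy, lintegral_add_left' (hgm hH1), lintegral_const_mul' _ _ ENNReal.ofReal_ne_top,
      lintegral_gradSq hH1, hcongr]
  have hEφ : energy ε (fun x => (φ x : ℂ)) ≤ ENNReal.ofReal ε * ((∑ i, ∑ k, T i k) + S)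
      + ∫⁻ x, coulomb x * ‖φ x‖ₑ ^ 2 := by
    rw [energy, lintegral_add_left' (hgm hφH1), lintegral_const_mul' _ _ ENNReal.ofReal_ne_top]
    simp_rw [hφe]
    gcongr
  have hV : ∫⁻ x, coulomb x * ‖p x‖ₑ ^ 2 ≤ ENNReal.ofReal ε * S
      + ∫⁻ x, coulomb x * ‖φ x‖ₑ ^ 2 := by
    have h2 := hE.trans hEφ
    rw [hEψ, mul_add, add_assoc] at h2
    exact (ENNReal.add_le_add_iff_left (ENNReal.mul_ne_top ENNReal.ofReal_ne_top hTsum)).1 h2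
  have hVφ := lintegral_pairCoulomb_competitor i₀ hU hfin
  rw [Fintype.sum_bool] at hVφ
  have hm1 : Measurable (fun z : Doubled N => coulomb (z ∘ Sum.inl) * ‖tensor p z‖ₑ ^ 2) :=
    (measurable_coulomb.comp (measurable_comp_index _)).mul (htm.enorm.pow_const 2)
  have hVp : 2 * ∫⁻ x, coulomb x * ‖p x‖ₑ ^ 2 = ∫⁻ z, pairCoulomb z * ‖tensor p z‖ₑ ^ 2 := by
    simp only [pairCoulomb, add_mul]
    rw [lintegral_add_left hm1, lintegral_tensor_inl hp h1 measurable_coulomb,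
      lintegral_tensor_inr hp h1 measurable_coulomb, two_mul]
  have hm2 : Measurable (fun z : Doubled N => pairCoulomb z * ‖U false z‖ₑ ^ 2) :=
    measurable_pairCoulomb.mul ((hU false).enorm.pow_const 2)
  have hVsplit : ∫⁻ z, pairCoulomb z * ‖tensor p z‖ₑ ^ 2
      = (∫⁻ z, pairCoulomb z * ‖U false z‖ₑ ^ 2) + ∫⁻ z, pairCoulomb z * ‖U true z‖ₑ ^ 2 := by
    rw [← lintegral_add_left hm2]
    refine lintegral_congr fun z => ?_
    rw [← mul_add, hsum]
  have hVpfin : ∫⁻ z, pairCoulomb z * ‖tensor p z‖ₑ ^ 2 ≠ ⊤ := by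
    rw [← hVp]
    exact ENNReal.mul_ne_top ENNReal.ofNat_ne_top hVfin
  rw [hVsplit] at hVpfin
  obtain ⟨hf1, hf2⟩ := ENNReal.add_ne_top.1 hVpfin
  have hUt : U true = fun z => χ z * tensor p z := by
    ext z
    simp [U, splitAmplitude]
  have hexf : ∀ z : Doubled N, z ∘ exchange i₀ false = z := fun z => rfl
  rw [hUt] at hf2
  refine ⟨hf2, ?_⟩
  have h2 : 2 * ∫⁻ x, coulomb x * ‖p x‖ₑ ^ 2 ≤ 2 * (ENNReal.ofReal ε * S
      + ∫⁻ x, coulomb x * ‖φ x‖ₑ ^ 2) := by gcongr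
  rw [hVp, hVsplit, mul_add, hVφ] at h2
  simp_rw [hexf] at h2
  rw [hUt] at h2
  have h3 : (∫⁻ z, pairCoulomb z * ‖U false z‖ₑ ^ 2)
      + ∫⁻ z, pairCoulomb z * ‖χ z * tensor p z‖ₑ ^ 2 ≤
      (∫⁻ z, pairCoulomb z * ‖U false z‖ₑ ^ 2) +
      ((∫⁻ z, pairCoulomb (z ∘ exchange i₀ true) * ‖χ z * tensor p z‖ₑ ^ 2) +
        2 * ENNReal.ofReal ε * S) := by
    refine h2.trans (le_of_eq ?_)
    ring
  exact (ENNReal.add_le_add_iff_left hf1).1 h3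

end KeyInequality

/-! ### The exchange amplitude -/

section Cutoffs

variable {N : ℕ}

/-- Moving one particle by `t` changes every interparticle distance by at most `t`. -/
theorem abs_dist_shift_sub_le {j a b : Fin N ⊕ Fin N} (hab : a ≠ b) (k : Fin 3) {t : ℝ}
    (ht : 0 ≤ t) (z : Doubled N) :
    |dist ((z + t • doubledDir j k) a) ((z + t • doubledDir j k) b) - dist (z a) (z b)| ≤ t := by
  have hstep : ∀ c, dist ((z + t • doubledDir j k) c) (z c) = if c = j then t else 0 := by
    intro c
    rw [dist_eq_norm]
    simp only [Pi.add_apply, add_sub_cancel_left, Pi.smul_apply, doubledDir]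
    split_ifs with h
    · subst h
      simp [norm_smul, abs_of_nonneg ht]
    · simp [Pi.single_eq_of_ne h]
  have h1 := dist_dist_dist_le ((z + t • doubledDir j k) a) ((z + t • doubledDir j k) b) (z a) (z b)
  rw [Real.dist_eq, hstep, hstep] at h1
  refine h1.trans ?_
  split_ifs with h2 h3
  · exact absurd (h2.trans h3.symm) hab
  · simp
  · simp
  · simpa using ht

theorem dist_shift_eq {j a b : Fin N ⊕ Fin N} (ha : j ≠ a) (hb : j ≠ b) (k : Fin 3) (t : ℝ)
    (z : Doubled N) :
    dist ((z + t • doubledDir j k) a) ((z + t • doubledDir j k) b) = dist (z a) (z b) := by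
  simp [doubledDir, Pi.single_eq_of_ne ha.symm, Pi.single_eq_of_ne hb.symm]

/-- The radial weight `(e^{-γ s} - e^{-γ R})₊`. -/
noncomputable def radialWeight (γ R s : ℝ) : ℝ := max (Real.exp (-γ * s) - Real.exp (-γ * R)) 0

theorem radialWeight_nonneg (γ R s : ℝ) : 0 ≤ radialWeight γ R s := le_max_right _ _

theorem radialWeight_le_one {γ R s : ℝ} (hγ : 0 ≤ γ) (hs : 0 ≤ s) : radialWeight γ R s ≤ 1 := by
  refine max_le ?_ zero_le_one
  have h1 : Real.exp (-γ * s) ≤ 1 := Real.exp_le_one_iff.2 (by nlinarith)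
  linarith [Real.exp_pos (-γ * R)]

theorem exp_le_radialWeight_add (γ R s : ℝ) :
    Real.exp (-γ * s) ≤ radialWeight γ R s + Real.exp (-γ * R) := by
  linarith [le_max_left (Real.exp (-γ * s) - Real.exp (-γ * R)) 0,
    show radialWeight γ R s = max (Real.exp (-γ * s) - Real.exp (-γ * R)) 0 from rfl]

theorem abs_radialWeight_sub_le {γ : ℝ} (hγ : 0 ≤ γ) (R : ℝ) {s s' τ : ℝ} (h : |s' - s| ≤ τ)
    (hτ : γ * τ ≤ 1) :
    |radialWeight γ R s' - radialWeight γ R s|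
      ≤ τ * (2 * γ * (radialWeight γ R s + Real.exp (-γ * R))) := by
  have h1 : |radialWeight γ R s' - radialWeight γ R s| ≤
      |Real.exp (-γ * s') - Real.exp (-γ * s)| := by
    refine (abs_max_sub_max_le_abs _ _ _).trans (le_of_eq ?_)
    congr 1
    ring
  have h2 : Real.exp (-γ * s') - Real.exp (-γ * s)
      = Real.exp (-γ * s) * (Real.exp (-γ * (s' - s)) - 1) := by
    rw [mul_sub, ← Real.exp_add]
    ring_nf
  have h3 : |-γ * (s' - s)| ≤ γ * τ := by
    rw [abs_mul, abs_neg, abs_of_nonneg hγ]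
    gcongr
  have h4 := Real.abs_exp_sub_one_le (h3.trans hτ)
  calc _ ≤ _ := h1
    _ = Real.exp (-γ * s) * |Real.exp (-γ * (s' - s)) - 1| := by
        rw [h2, abs_mul, abs_of_pos (Real.exp_pos _)]
    _ ≤ (radialWeight γ R s + Real.exp (-γ * R)) * (2 * (γ * τ)) := by
        have h5 := exp_le_radialWeight_add γ R s
        have h6 := Real.exp_pos (-γ * s)
        exact mul_le_mul h5 (h4.trans (by linarith)) (abs_nonneg _) (by linarith)
    _ = _ := by ring

/-- The proximity function: `1` below distance `β / 2`, `0` beyond `β`, linear in between. -/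
noncomputable def proximity (β s : ℝ) : ℝ := max (min (2 - 2 / β * s) 1) 0

theorem proximity_nonneg (β s : ℝ) : 0 ≤ proximity β s := le_max_right _ _

theorem proximity_eq_one {β s : ℝ} (hβ : 0 < β) (h : s ≤ β / 2) : proximity β s = 1 := by
  have h1 : 2 / β * s ≤ 1 := by
    calc 2 / β * s ≤ 2 / β * (β / 2) := by gcongr
      _ = 1 := by field_simp
  rw [proximity, min_eq_right (by linarith)]
  simp

theorem proximity_eq_zero {β s : ℝ} (hβ : 0 < β) (h : β ≤ s) : proximity β s = 0 := by
  have h1 : 2 ≤ 2 / β * s := by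
    calc (2 : ℝ) = 2 / β * β := by field_simp
      _ ≤ 2 / β * s := by gcongr
  exact max_eq_right ((min_le_left _ _).trans (by linarith))

theorem abs_proximity_sub_le {β : ℝ} (hβ : 0 < β) (s s' : ℝ) :
    |proximity β s' - proximity β s| ≤ 2 / β * |s' - s| := by
  refine (abs_max_sub_max_le_abs _ _ _).trans ?_
  refine (abs_min_sub_min_le_max _ _ _ _).trans ?_
  have h1 : 2 - 2 / β * s' - (2 - 2 / β * s) = -(2 / β * (s' - s)) := by ring
  rw [h1, abs_neg, abs_mul, abs_of_pos (by positivity : 0 < 2 / β)]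
  simp only [sub_self, abs_zero]
  exact max_le le_rfl (by positivity)

theorem continuous_radialWeight (γ R : ℝ) : Continuous (radialWeight γ R) := by
  unfold radialWeight
  fun_prop

theorem continuous_proximity (β : ℝ) : Continuous (proximity β) := by
  unfold proximity
  fun_prop

/-- The cutoff to pairs of configurations in which exchanging particle `i₀` creates no pair of
particles at distance less than `β / 2`. -/
noncomputable def exchangeCutoff (i₀ : Fin N) (β : ℝ) (z : Doubled N) : ℝ :=
  max (1 - ∑ j ∈ Finset.univ.erase i₀,
    (proximity β (dist (z (Sum.inr i₀)) (z (Sum.inl j))) +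
      proximity β (dist (z (Sum.inl i₀)) (z (Sum.inr j))))) 0

theorem exchangeCutoff_nonneg (i₀ : Fin N) (β : ℝ) (z : Doubled N) :
    0 ≤ exchangeCutoff i₀ β z := le_max_right _ _

theorem exchangeCutoff_le_one (i₀ : Fin N) (β : ℝ) (z : Doubled N) :
    exchangeCutoff i₀ β z ≤ 1 := by
  refine max_le ?_ zero_le_one
  have : 0 ≤ ∑ j ∈ Finset.univ.erase i₀,
      (proximity β (dist (z (Sum.inr i₀)) (z (Sum.inl j))) +
      proximity β (dist (z (Sum.inl i₀)) (z (Sum.inr j)))) :=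
    Finset.sum_nonneg fun j _ => add_nonneg (proximity_nonneg _ _) (proximity_nonneg _ _)
  linarith

theorem abs_exchangeCutoff_sub_le (i₀ : Fin N) {β : ℝ} (hβ : 0 < β) (j : Fin N ⊕ Fin N)
    (k : Fin 3) {t : ℝ} (ht : 0 ≤ t) (z : Doubled N) :
    |exchangeCutoff i₀ β (z + t • doubledDir j k) - exchangeCutoff i₀ β z|
      ≤ t * (4 * N / β) := by
  refine (abs_max_sub_max_le_abs _ _ _).trans ?_
  rw [sub_sub_sub_cancel_left, ← Finset.sum_sub_distrib]
  refine (Finset.abs_sum_le_sum_abs _ _).trans ?_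
  have hterm : ∀ l ∈ Finset.univ.erase i₀,
      |(proximity β (dist (z (Sum.inr i₀)) (z (Sum.inl l))) +
        proximity β (dist (z (Sum.inl i₀)) (z (Sum.inr l)))) -
      (proximity β (dist ((z + t • doubledDir j k) (Sum.inr i₀))
          ((z + t • doubledDir j k) (Sum.inl l))) +
        proximity β (dist ((z + t • doubledDir j k) (Sum.inl i₀))
          ((z + t • doubledDir j k) (Sum.inr l))))| ≤ 4 / β * t := by
    intro l _
    have h1 := abs_dist_shift_sub_le (j := j) (a := Sum.inr i₀) (b := Sum.inl l) (by simp) k ht z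
    have h2 := abs_dist_shift_sub_le (j := j) (a := Sum.inl i₀) (b := Sum.inr l) (by simp) k ht z
    rw [abs_sub_comm] at h1 h2
    have h3 := (abs_proximity_sub_le hβ _ _).trans
      (mul_le_mul_of_nonneg_left h1 (by positivity : 0 ≤ 2 / β))
    have h4 := (abs_proximity_sub_le hβ _ _).trans
      (mul_le_mul_of_nonneg_left h2 (by positivity : 0 ≤ 2 / β))
    rw [add_sub_add_comm]
    refine (abs_add_le _ _).trans ((add_le_add h3 h4).trans (le_of_eq ?_))
    ring
  refine (Finset.sum_le_sum hterm).trans ?_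
  rw [Finset.sum_const, nsmul_eq_mul]
  have hcard : ((Finset.univ.erase i₀).card : ℝ) ≤ N := by
    have := Finset.card_le_univ (Finset.univ.erase i₀)
    rw [Fintype.card_fin] at this
    exact_mod_cast this
  calc _ ≤ (N : ℝ) * (4 / β * t) := by gcongr
    _ = _ := by ring

/-- The distance between particles `i₀` and `i₁` of the first copy. -/
noncomputable def pairDist (i₀ i₁ : Fin N) (z : Doubled N) : ℝ :=
  dist (z (Sum.inl i₀)) (z (Sum.inl i₁))

/-- The amplitude with which particle `i₀` is exchanged: an Agmon weight in `|x_{i₀} - x_{i₁}|`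
times the cutoff to harmless exchanges. -/
noncomputable def exchangeAmplitude (i₀ i₁ : Fin N) (β γ R : ℝ) (z : Doubled N) : ℝ :=
  1 / 2 * (radialWeight γ R (pairDist i₀ i₁ z) * exchangeCutoff i₀ β z)

open Classical in
/-- A pointwise bound for the difference quotients of `exchangeAmplitude` in the directions of
particle `j`. -/
noncomputable def amplitudeSlope (i₀ i₁ : Fin N) (β γ R : ℝ) (j : Fin N ⊕ Fin N)
    (z : Doubled N) : ℝ :=
  1 / 2 * ((if j = Sum.inl i₀ ∨ j = Sum.inl i₁ then
    2 * γ * (radialWeight γ R (pairDist i₀ i₁ z) + Real.exp (-γ * R)) else 0) +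
    4 * N / β * radialWeight γ R (pairDist i₀ i₁ z))

theorem continuous_pairDist (i₀ i₁ : Fin N) : Continuous (pairDist i₀ i₁) := by
  unfold pairDist
  fun_prop

theorem continuous_exchangeCutoff (i₀ : Fin N) (β : ℝ) : Continuous (exchangeCutoff i₀ β) := by
  unfold exchangeCutoff
  have := continuous_proximity β
  fun_prop

theorem measurable_exchangeAmplitude (i₀ i₁ : Fin N) (β γ R : ℝ) :
    Measurable (exchangeAmplitude i₀ i₁ β γ R) :=
  ((((continuous_radialWeight γ R).comp (continuous_pairDist i₀ i₁)).mul
    (continuous_exchangeCutoff i₀ β)).const_mul _).measurable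

theorem measurable_amplitudeSlope (i₀ i₁ : Fin N) (β γ R : ℝ) (j : Fin N ⊕ Fin N) :
    Measurable (amplitudeSlope i₀ i₁ β γ R j) := by
  have h : Continuous fun z => radialWeight γ R (pairDist (N := N) i₀ i₁ z) :=
    (continuous_radialWeight γ R).comp (continuous_pairDist i₀ i₁)
  unfold amplitudeSlope
  split_ifs
  · exact Continuous.measurable (by fun_prop)
  · exact Continuous.measurable (by fun_prop)

theorem exchangeAmplitude_nonneg (i₀ i₁ : Fin N) (β γ R : ℝ) (z : Doubled N) :
    0 ≤ exchangeAmplitude i₀ i₁ β γ R z :=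
  mul_nonneg (by norm_num) (mul_nonneg (radialWeight_nonneg _ _ _) (exchangeCutoff_nonneg _ _ _))

theorem exchangeAmplitude_le_half (i₀ i₁ : Fin N) (β : ℝ) {γ : ℝ} (hγ : 0 ≤ γ) (R : ℝ)
    (z : Doubled N) : exchangeAmplitude i₀ i₁ β γ R z ≤ 1 / 2 := by
  have h0 : 0 ≤ pairDist i₀ i₁ z := dist_nonneg
  have h1 := radialWeight_le_one (R := R) hγ h0
  have h2 := mul_le_one₀ h1 (exchangeCutoff_nonneg i₀ β z) (exchangeCutoff_le_one i₀ β z)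
  unfold exchangeAmplitude
  linarith

theorem abs_exchangeAmplitude_sub_le {i₀ i₁ : Fin N} (hne : i₀ ≠ i₁) {β γ : ℝ} (hβ : 0 < β)
    (hγ : 0 ≤ γ) (R : ℝ) (j : Fin N ⊕ Fin N) (k : Fin 3) {t : ℝ} (ht : 0 ≤ t) (htγ : γ * t ≤ 1)
    (z : Doubled N) :
    |exchangeAmplitude i₀ i₁ β γ R (z + t • doubledDir j k) - exchangeAmplitude i₀ i₁ β γ R z|
        ≤ t * amplitudeSlope i₀ i₁ β γ R j z ∧
    |exchangeAmplitude i₀ i₁ β γ R (z + t • doubledDir j k) - exchangeAmplitude i₀ i₁ β γ R z|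
        ≤ t * amplitudeSlope i₀ i₁ β γ R j (z + t • doubledDir j k) := by
  classical
  have hθ := abs_exchangeCutoff_sub_le i₀ hβ j k ht z
  set z' := z + t • doubledDir j k with hz'
  have hg0 := radialWeight_nonneg γ R (pairDist i₀ i₁ z)
  have hg0' := radialWeight_nonneg γ R (pairDist i₀ i₁ z')
  have hθ0 := exchangeCutoff_nonneg i₀ β z
  have hθ0' := exchangeCutoff_nonneg i₀ β z'
  have hθ1 := exchangeCutoff_le_one i₀ β z
  have hθ1' := exchangeCutoff_le_one i₀ β z'
  have hgz : |radialWeight γ R (pairDist i₀ i₁ z') - radialWeight γ R (pairDist i₀ i₁ z)| ≤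
      t * (if j = Sum.inl i₀ ∨ j = Sum.inl i₁ then
        2 * γ * (radialWeight γ R (pairDist i₀ i₁ z) + Real.exp (-γ * R)) else 0) ∧
      |radialWeight γ R (pairDist i₀ i₁ z') - radialWeight γ R (pairDist i₀ i₁ z)| ≤
      t * (if j = Sum.inl i₀ ∨ j = Sum.inl i₁ then
        2 * γ * (radialWeight γ R (pairDist i₀ i₁ z') + Real.exp (-γ * R)) else 0) := by
    have hab : (Sum.inl i₀ : Fin N ⊕ Fin N) ≠ Sum.inl i₁ := fun h => hne (Sum.inl_injective h)
    split_ifs with h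
    · have h1 : |pairDist i₀ i₁ z' - pairDist i₀ i₁ z| ≤ t :=
        abs_dist_shift_sub_le (j := j) hab k ht z
      refine ⟨abs_radialWeight_sub_le hγ R h1 htγ, ?_⟩
      rw [abs_sub_comm] at h1 ⊢
      exact abs_radialWeight_sub_le hγ R h1 htγ
    · rw [not_or] at h
      have h1 : pairDist i₀ i₁ z' = pairDist i₀ i₁ z := dist_shift_eq h.1 h.2 k t z
      simp [h1]
  unfold exchangeAmplitude amplitudeSlope
  set w := if j = Sum.inl i₀ ∨ j = Sum.inl i₁ then
        2 * γ * (radialWeight γ R (pairDist i₀ i₁ z) + Real.exp (-γ * R)) else 0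
  set w' := if j = Sum.inl i₀ ∨ j = Sum.inl i₁ then
        2 * γ * (radialWeight γ R (pairDist i₀ i₁ z') + Real.exp (-γ * R)) else 0
  set g := radialWeight γ R (pairDist i₀ i₁ z)
  set g' := radialWeight γ R (pairDist i₀ i₁ z')
  set θ := exchangeCutoff i₀ β z
  set θ' := exchangeCutoff i₀ β z'
  constructor
  · have e : 1 / 2 * (g' * θ') - 1 / 2 * (g * θ) = 1 / 2 * ((g' - g) * θ' + g * (θ' - θ)) := by ring
    rw [e, abs_mul, abs_of_pos (by norm_num : (0 : ℝ) < 1 / 2)]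
    have e2 : |(g' - g) * θ' + g * (θ' - θ)| ≤ t * w * 1 + g * (t * (4 * N / β)) := by
      refine (abs_add_le _ _).trans ?_
      rw [abs_mul, abs_mul, abs_of_nonneg hθ0', abs_of_nonneg hg0]
      exact add_le_add (mul_le_mul hgz.1 hθ1' hθ0' ((abs_nonneg _).trans hgz.1))
        (mul_le_mul_of_nonneg_left hθ hg0)
    linarith
  · have e : 1 / 2 * (g' * θ') - 1 / 2 * (g * θ) = 1 / 2 * ((g' - g) * θ + g' * (θ' - θ)) := by ring
    rw [e, abs_mul, abs_of_pos (by norm_num : (0 : ℝ) < 1 / 2)]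
    have e2 : |(g' - g) * θ + g' * (θ' - θ)| ≤ t * w' * 1 + g' * (t * (4 * N / β)) := by
      refine (abs_add_le _ _).trans ?_
      rw [abs_mul, abs_mul, abs_of_nonneg hθ0, abs_of_nonneg hg0']
      exact add_le_add (mul_le_mul hgz.2 hθ1 hθ0 ((abs_nonneg _).trans hgz.2))
        (mul_le_mul_of_nonneg_left hθ hg0')
    linarith

/-- The interactions of a configuration that do not involve the particle `i₀`. -/
noncomputable def restCoulomb (i₀ : Fin N) (x : Config N) : ℝ≥0∞ :=
  ∑ i ∈ Finset.univ.erase i₀, ∑ j ∈ Finset.Ioi i, (edist (x i) (x j))⁻¹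

theorem coulomb_eq_add_rest {i₀ : Fin N} (hmin : ∀ j, i₀ ≤ j) (x : Config N) :
    coulomb x = (∑ j ∈ Finset.univ.erase i₀, (edist (x i₀) (x j))⁻¹) + restCoulomb i₀ x := by
  have h : Finset.Ioi i₀ = Finset.univ.erase i₀ := by
    ext j
    simp [lt_iff_le_and_ne, hmin j, eq_comm]
  rw [coulomb, ← Finset.add_sum_erase _ _ (Finset.mem_univ i₀), h, restCoulomb]

theorem restCoulomb_congr {i₀ : Fin N} (hmin : ∀ j, i₀ ≤ j) {x x' : Config N}
    (h : ∀ j, j ≠ i₀ → x j = x' j) : restCoulomb i₀ x = restCoulomb i₀ x' := by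
  refine Finset.sum_congr rfl fun i hi => Finset.sum_congr rfl fun j hj => ?_
  rw [h i (Finset.ne_of_mem_erase hi), h j ((hmin i).trans_lt (Finset.mem_Ioi.1 hj)).ne']

/-- Where the exchange amplitude does not vanish, the exchange of particle `i₀` replaces the
interaction of two close particles by interactions at distance at least `β / 2`. -/
theorem pairCoulomb_exchange_add_le {i₀ i₁ : Fin N} (hmin : ∀ j, i₀ ≤ j) (hne : i₀ ≠ i₁)
    {β γ R : ℝ} (hβ : 0 < β) (hR : 0 < R) (hγ : 0 ≤ γ) {z : Doubled N}
    (hz : exchangeAmplitude i₀ i₁ β γ R z ≠ 0) :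
    pairCoulomb (z ∘ exchange i₀ true) + ENNReal.ofReal (1 / R) ≤
      pairCoulomb z + ENNReal.ofReal (4 * N / β) := by
  have hg : radialWeight γ R (pairDist i₀ i₁ z) ≠ 0 := fun h => hz (by simp [exchangeAmplitude, h])
  have hθ : exchangeCutoff i₀ β z ≠ 0 := fun h => hz (by simp [exchangeAmplitude, h])
  have hr : pairDist i₀ i₁ z ≤ R := by
    by_contra! h
    refine hg (max_eq_right ?_)
    have : Real.exp (-γ * pairDist i₀ i₁ z) ≤ Real.exp (-γ * R) :=
      Real.exp_le_exp.2 (by nlinarith)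
    linarith
  have hsum : ∑ j ∈ Finset.univ.erase i₀,
      (proximity β (dist (z (Sum.inr i₀)) (z (Sum.inl j))) +
      proximity β (dist (z (Sum.inl i₀)) (z (Sum.inr j)))) < 1 := by
    by_contra! h
    exact hθ (max_eq_right (by linarith))
  have hfar : ∀ j ∈ Finset.univ.erase i₀, β / 2 ≤ dist (z (Sum.inr i₀)) (z (Sum.inl j)) ∧
      β / 2 ≤ dist (z (Sum.inl i₀)) (z (Sum.inr j)) := by
    intro j hj
    have h1 := (Finset.single_le_sum (f := fun j =>
      proximity β (dist (z (Sum.inr i₀)) (z (Sum.inl j))) +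
      proximity β (dist (z (Sum.inl i₀)) (z (Sum.inr j))))
      (fun j _ => add_nonneg (proximity_nonneg _ _) (proximity_nonneg _ _)) hj).trans_lt hsum
    constructor
    · by_contra! h
      rw [proximity_eq_one hβ h.le] at h1
      linarith [proximity_nonneg β (dist (z (Sum.inl i₀)) (z (Sum.inr j)))]
    · by_contra! h
      rw [proximity_eq_one hβ h.le] at h1
      linarith [proximity_nonneg β (dist (z (Sum.inr i₀)) (z (Sum.inl j)))]
  have hinv : ∀ a b : R3, β / 2 ≤ dist a b → (edist a b)⁻¹ ≤ ENNReal.ofReal (2 / β) := by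
    intro a b h
    rw [edist_dist, ← ENNReal.ofReal_inv_of_pos (by linarith)]
    refine ENNReal.ofReal_le_ofReal ?_
    calc (dist a b)⁻¹ ≤ (β / 2)⁻¹ := by gcongr
      _ = 2 / β := by rw [inv_div]
  have hexl : ∀ j, j ≠ i₀ → (z ∘ exchange i₀ true) (Sum.inl j) = z (Sum.inl j) := by
    intro j hj
    simp [exchange, Equiv.swap_apply_of_ne_of_ne (show (Sum.inl j : Fin N ⊕ Fin N) ≠ Sum.inl i₀
      from fun h => hj (Sum.inl_injective h))]
  have hexr : ∀ j, j ≠ i₀ → (z ∘ exchange i₀ true) (Sum.inr j) = z (Sum.inr j) := by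
    intro j hj
    simp [exchange, Equiv.swap_apply_of_ne_of_ne (show (Sum.inr j : Fin N ⊕ Fin N) ≠ Sum.inl i₀
      by simp) (show (Sum.inr j : Fin N ⊕ Fin N) ≠ Sum.inr i₀ from fun h => hj (Sum.inr_injective h))]
  have hexl0 : (z ∘ exchange i₀ true) (Sum.inl i₀) = z (Sum.inr i₀) := by simp [exchange]
  have hexr0 : (z ∘ exchange i₀ true) (Sum.inr i₀) = z (Sum.inl i₀) := by simp [exchange]
  set ρl := restCoulomb i₀ (z ∘ Sum.inl) with hρl
  set ρr := restCoulomb i₀ (z ∘ Sum.inr) with hρr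
  have hcl : restCoulomb i₀ ((z ∘ exchange i₀ true) ∘ Sum.inl) = ρl :=
    restCoulomb_congr hmin fun j hj => hexl j hj
  have hcr : restCoulomb i₀ ((z ∘ exchange i₀ true) ∘ Sum.inr) = ρr :=
    restCoulomb_congr hmin fun j hj => hexr j hj
  have hup : pairCoulomb (z ∘ exchange i₀ true) ≤ ENNReal.ofReal (4 * N / β) + (ρl + ρr) := by
    rw [pairCoulomb, coulomb_eq_add_rest hmin, coulomb_eq_add_rest hmin, hcl, hcr,
      add_add_add_comm]
    gcongr
    rw [← Finset.sum_add_distrib]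
    calc _ ≤ ∑ _j ∈ Finset.univ.erase i₀, ENNReal.ofReal (4 / β) := by
          refine Finset.sum_le_sum fun j hj => ?_
          have hj' := Finset.ne_of_mem_erase hj
          have e1 : 4 / β = 2 / β + 2 / β := by ring
          rw [e1, ENNReal.ofReal_add (by positivity) (by positivity)]
          simp only [Function.comp_apply] at hexl hexr hexl0 hexr0 ⊢
          rw [hexl j hj', hexr j hj', hexl0, hexr0]
          exact add_le_add (hinv _ _ (hfar j hj).1) (hinv _ _ (hfar j hj).2)
      _ = ((Finset.univ.erase i₀).card : ℝ≥0∞) * ENNReal.ofReal (4 / β) := by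
          rw [Finset.sum_const, nsmul_eq_mul]
      _ ≤ (N : ℝ≥0∞) * ENNReal.ofReal (4 / β) := by
          gcongr
          exact (Finset.card_le_univ _).trans (by simp)
      _ = ENNReal.ofReal (4 * N / β) := by
          rw [← ENNReal.ofReal_natCast, ← ENNReal.ofReal_mul (by positivity)]
          congr 1
          ring
  have hdown : ENNReal.ofReal (1 / R) + (ρl + ρr) ≤ pairCoulomb z := by
    rw [pairCoulomb, coulomb_eq_add_rest hmin, coulomb_eq_add_rest hmin, add_add_add_comm]
    gcongr
    refine le_add_right ?_
    have h1 : (edist (z (Sum.inl i₀)) (z (Sum.inl i₁)))⁻¹ ≤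
        ∑ j ∈ Finset.univ.erase i₀, (edist ((z ∘ Sum.inl) i₀) ((z ∘ Sum.inl) j))⁻¹ :=
      Finset.single_le_sum (f := fun j => (edist ((z ∘ Sum.inl) i₀) ((z ∘ Sum.inl) j))⁻¹)
        (fun _ _ => zero_le) (Finset.mem_erase.2 ⟨hne.symm, Finset.mem_univ i₁⟩)
    refine le_trans ?_ h1
    rw [one_div, ENNReal.ofReal_inv_of_pos hR, ENNReal.inv_le_inv, edist_dist]
    exact ENNReal.ofReal_le_ofReal hr
  calc _ ≤ ENNReal.ofReal (4 * N / β) + (ρl + ρr) + ENNReal.ofReal (1 / R) := by gcongr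
    _ = (ENNReal.ofReal (1 / R) + (ρl + ρr)) + ENNReal.ofReal (4 * N / β) := by ring
    _ ≤ _ := by gcongr

end Cutoffs

/-! ### The Agmon estimate -/

section Decay

variable {N : ℕ}

theorem lintegral_ball_le {ψ : Config N → ℂ} {ρ : Measure R3} (hdens : HasOneBodyDensity ψ ρ)
    (hψ : AEStronglyMeasurable ψ volume) (hN : N ≠ 0) {β : ℝ} {K : ℝ≥0∞} (hκ : kappa N ρ β ≤ K)
    (y : R3) (i : Fin N) :
    ∫⁻ x, (Metric.ball y β).indicator 1 (x i) * ‖ψ x‖ₑ ^ 2 ≤ K := by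
  have hN0 : (N : ℝ≥0∞) ≠ 0 := by exact_mod_cast hN
  have h1 := hdens.lintegral_eq hψ
    (measurable_one.indicator (measurableSet_ball : MeasurableSet (Metric.ball y β))) i
  rw [lintegral_indicator_one measurableSet_ball] at h1
  have h2 : ρ (Metric.ball y β) / (N : ℝ≥0∞) ≤ K :=
    (le_iSup (fun x : R3 => ρ (Metric.ball x β) / (N : ℝ≥0∞)) y).trans hκ
  rw [← h1, mul_comm, ENNReal.mul_div_cancel_right hN0 (ENNReal.natCast_ne_top N)] at h2
  exact h2

/-- Whatever the first configuration is, at least half of the mass of the second one allows the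
exchange. -/
theorem half_le_lintegral_exchangeCutoff {p : Config N → ℝ} (hp : Measurable p)
    (h1 : ∫⁻ x, ‖p x‖ₑ ^ 2 = 1) (hN : 2 ≤ N) (i₀ : Fin N) {β : ℝ} (hβ : 0 < β)
    (hball : ∀ (y : R3) (i : Fin N), ∫⁻ x, (Metric.ball y β).indicator 1 (x i) * ‖p x‖ₑ ^ 2
      ≤ ENNReal.ofReal (1 / (4 * ((N : ℝ) - 1)))) (x : Config N) :
    1 / 2 ≤ ∫⁻ y : Config N, ENNReal.ofReal (exchangeCutoff i₀ β (Sum.elim x y) ^ 2)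
      * ‖p y‖ₑ ^ 2 := by
  have hN1 : (1 : ℝ) ≤ (N : ℝ) - 1 := by
    have : (2 : ℝ) ≤ N := by exact_mod_cast hN
    linarith
  let b : R3 → R3 → ℝ≥0∞ := fun c w => (Metric.ball c β).indicator 1 w
  have hb : ∀ c, Measurable (b c) := fun c => measurable_one.indicator measurableSet_ball
  have hbm : ∀ c (i : Fin N), Measurable (fun y : Config N => b c (y i) * ‖p y‖ₑ ^ 2) := fun c i =>
    ((hb c).comp (measurable_pi_apply i)).mul (hp.enorm.pow_const 2)
  have hpt : ∀ y : Config N, 1 ≤ ENNReal.ofReal (exchangeCutoff i₀ β (Sum.elim x y) ^ 2) +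
      ∑ j ∈ Finset.univ.erase i₀, (b (x j) (y i₀) + b (x i₀) (y j)) := by
    intro y
    by_cases hy : ∀ j ∈ Finset.univ.erase i₀, β ≤ dist (y i₀) (x j) ∧ β ≤ dist (x i₀) (y j)
    · have h2 : exchangeCutoff i₀ β (Sum.elim x y) = 1 := by
        unfold exchangeCutoff
        rw [Finset.sum_eq_zero]
        · simp
        · intro j hj
          simp only [Sum.elim_inl, Sum.elim_inr]
          rw [proximity_eq_zero hβ (hy j hj).1, proximity_eq_zero hβ (hy j hj).2, add_zero]
      rw [h2]
      simp
    · push Not at hy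
      obtain ⟨j, hj, h2⟩ := hy
      refine le_add_left (le_trans ?_ (Finset.single_le_sum
        (f := fun j => b (x j) (y i₀) + b (x i₀) (y j)) (fun _ _ => zero_le) hj))
      by_cases h3 : β ≤ dist (y i₀) (x j)
      · have h4 : y j ∈ Metric.ball (x i₀) β := by
          rw [Metric.mem_ball, dist_comm]
          exact h2 h3
        simp [b, h4]
      · have h4 : y i₀ ∈ Metric.ball (x j) β := by
          rw [Metric.mem_ball]
          exact not_le.1 h3
        simp [b, h4]
  have hcard : ((Finset.univ.erase i₀).card : ℝ) = (N : ℝ) - 1 := by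
    rw [Finset.card_erase_of_mem (Finset.mem_univ _), Finset.card_univ, Fintype.card_fin,
      Nat.cast_sub (by omega), Nat.cast_one]
  have hcm : Measurable (fun y : Config N =>
      ENNReal.ofReal (exchangeCutoff i₀ β (Sum.elim x y) ^ 2) * ‖p y‖ₑ ^ 2) := by
    have : Measurable (fun y : Config N => exchangeCutoff i₀ β (Sum.elim x y)) :=
      (continuous_exchangeCutoff i₀ β).measurable.comp (sumElim_measurable_right x)
    exact (this.pow_const 2).ennreal_ofReal.mul (hp.enorm.pow_const 2)
  have hsum : ∫⁻ y : Config N, (∑ j ∈ Finset.univ.erase i₀, (b (x j) (y i₀) + b (x i₀) (y j)))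
      * ‖p y‖ₑ ^ 2 ≤ 1 / 2 := by
    simp_rw [Finset.sum_mul, add_mul]
    have hm : ∀ j : Fin N, Measurable (fun y : Config N =>
        b (x j) (y i₀) * ‖p y‖ₑ ^ 2 + b (x i₀) (y j) * ‖p y‖ₑ ^ 2) := fun j =>
      (hbm _ _).add (hbm _ _)
    rw [lintegral_finsetSum _ fun j _ => hm j]
    calc _ ≤ ∑ _j ∈ Finset.univ.erase i₀, (ENNReal.ofReal (1 / (4 * ((N : ℝ) - 1)))
          + ENNReal.ofReal (1 / (4 * ((N : ℝ) - 1)))) := by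
          refine Finset.sum_le_sum fun j _ => ?_
          rw [lintegral_add_left (hbm _ _)]
          exact add_le_add (hball _ _) (hball _ _)
      _ = 1 / 2 := by
          rw [Finset.sum_const, nsmul_eq_mul, ← ENNReal.ofReal_add (by positivity) (by positivity),
            ← ENNReal.ofReal_natCast, hcard, ← ENNReal.ofReal_mul (by linarith)]
          have e1 : ((N : ℝ) - 1) * (1 / (4 * ((N : ℝ) - 1)) + 1 / (4 * ((N : ℝ) - 1))) = 1 / 2 := by
            field_simp
            norm_num
          rw [e1, ENNReal.ofReal_div_of_pos two_pos]
          simp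
  have htot : 1 ≤ (∫⁻ y : Config N, ENNReal.ofReal (exchangeCutoff i₀ β (Sum.elim x y) ^ 2)
      * ‖p y‖ₑ ^ 2) + 1 / 2 := by
    calc (1 : ℝ≥0∞) = ∫⁻ y, ‖p y‖ₑ ^ 2 := h1.symm
      _ ≤ ∫⁻ y : Config N, (ENNReal.ofReal (exchangeCutoff i₀ β (Sum.elim x y) ^ 2) * ‖p y‖ₑ ^ 2 +
          (∑ j ∈ Finset.univ.erase i₀, (b (x j) (y i₀) + b (x i₀) (y j))) * ‖p y‖ₑ ^ 2) := by
          refine lintegral_mono fun y => ?_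
          simp only
          rw [← add_mul]
          exact le_mul_of_one_le_left' (hpt y)
      _ ≤ _ := by
          rw [lintegral_add_left hcm]
          gcongr
  have h3 : (1 : ℝ≥0∞) = 1 / 2 + 1 / 2 := by simp [ENNReal.inv_two_add_inv_two]
  have h4 : (1 / 2 : ℝ≥0∞) ≠ ⊤ := by simp
  exact (ENNReal.add_le_add_iff_right h4).1 (h3.symm.le.trans htot)

/-- The mass of `p²` with the squared Agmon weight. -/
noncomputable def weightedMass (p : Config N → ℝ) (i₀ i₁ : Fin N) (γ R : ℝ) : ℝ≥0∞ :=
  ∫⁻ x, ENNReal.ofReal (radialWeight γ R (dist (x i₀) (x i₁)) ^ 2) * ‖p x‖ₑ ^ 2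

theorem measurable_weight (i₀ i₁ : Fin N) (γ R : ℝ) : Measurable fun x : Config N =>
    ENNReal.ofReal (radialWeight γ R (dist (x i₀) (x i₁)) ^ 2) := by
  have h := continuous_radialWeight γ R
  have h2 : Continuous fun x : Config N => radialWeight γ R (dist (x i₀) (x i₁)) :=
    h.comp (by fun_prop)
  exact (h2.pow 2).measurable.ennreal_ofReal

theorem weightedMass_le_one {p : Config N → ℝ} (h1 : ∫⁻ x, ‖p x‖ₑ ^ 2 = 1) (i₀ i₁ : Fin N)
    {γ : ℝ} (hγ : 0 ≤ γ) (R : ℝ) : weightedMass p i₀ i₁ γ R ≤ 1 := by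
  rw [← h1]
  refine lintegral_mono fun x => mul_le_of_le_one_left' ?_
  rw [ENNReal.ofReal_le_one]
  exact pow_le_one₀ (radialWeight_nonneg _ _ _) (radialWeight_le_one hγ dist_nonneg)

/-- The factor `8` is `(1/2)⁻²` from the amplitude times `2` from the mass lost to the cutoff. -/
theorem weightedMass_le_lintegral_amplitude {p : Config N → ℝ} (hp : Measurable p)
    (h1 : ∫⁻ x, ‖p x‖ₑ ^ 2 = 1) (hN : 2 ≤ N) (i₀ i₁ : Fin N) {β : ℝ} (hβ : 0 < β)
    (hball : ∀ (y : R3) (i : Fin N), ∫⁻ x, (Metric.ball y β).indicator 1 (x i) * ‖p x‖ₑ ^ 2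
      ≤ ENNReal.ofReal (1 / (4 * ((N : ℝ) - 1)))) (γ R : ℝ) :
    weightedMass p i₀ i₁ γ R
      ≤ 8 * ∫⁻ z, ‖exchangeAmplitude i₀ i₁ β γ R z * tensor p z‖ₑ ^ 2 := by
  have hm : Measurable (fun z : Doubled N => ‖exchangeAmplitude i₀ i₁ β γ R z * tensor p z‖ₑ ^ 2) :=
    ((measurable_exchangeAmplitude i₀ i₁ β γ R).mul (measurable_tensor hp)).enorm.pow_const 2
  rw [lintegral_doubled hm, ← lintegral_const_mul' _ _ (by simp)]
  refine lintegral_mono fun x => ?_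
  have h2 : ∀ y : Config N, ‖exchangeAmplitude i₀ i₁ β γ R (Sum.elim x y)
      * tensor p (Sum.elim x y)‖ₑ ^ 2 =
      (ENNReal.ofReal (1 / 4) * ENNReal.ofReal (radialWeight γ R (dist (x i₀) (x i₁)) ^ 2)
        * ‖p x‖ₑ ^ 2) * (ENNReal.ofReal (exchangeCutoff i₀ β (Sum.elim x y) ^ 2) * ‖p y‖ₑ ^ 2) := by
    intro y
    have e1 : exchangeAmplitude i₀ i₁ β γ R (Sum.elim x y) * tensor p (Sum.elim x y)
        = (1 / 2) * radialWeight γ R (dist (x i₀) (x i₁)) * p x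
          * (exchangeCutoff i₀ β (Sum.elim x y) * p y) := by
      simp only [exchangeAmplitude, tensor, pairDist, Sum.elim_inl, Sum.elim_comp_inl,
        Sum.elim_comp_inr]
      ring
    rw [e1]
    simp only [enorm_mul, mul_pow, enorm_sq_real]
    norm_num
  simp_rw [h2]
  rw [lintegral_const_mul' _ _ (by
    refine ENNReal.mul_ne_top (ENNReal.mul_ne_top ENNReal.ofReal_ne_top ENNReal.ofReal_ne_top) ?_
    simp)]
  have h3 := half_le_lintegral_exchangeCutoff hp h1 hN i₀ hβ hball x
  set G := ENNReal.ofReal (radialWeight γ R (dist (x i₀) (x i₁)) ^ 2)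
  calc G * ‖p x‖ₑ ^ 2 = 8 * (ENNReal.ofReal (1 / 4) * G * ‖p x‖ₑ ^ 2 * (1 / 2)) := by
        have e2 : (8 : ℝ≥0∞) * (ENNReal.ofReal (1 / 4) * (1 / 2)) = 1 := by
          have e3 : (1 / 2 : ℝ≥0∞) = ENNReal.ofReal (1 / 2) := by
            rw [ENNReal.ofReal_div_of_pos two_pos]
            simp
          rw [e3, ← ENNReal.ofReal_ofNat 8, ← ENNReal.ofReal_mul (by norm_num),
            ← ENNReal.ofReal_mul (by norm_num)]
          norm_num
        calc G * ‖p x‖ₑ ^ 2 = (8 * (ENNReal.ofReal (1 / 4) * (1 / 2))) * (G * ‖p x‖ₑ ^ 2) := by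
              rw [e2, one_mul]
          _ = _ := by ring
    _ ≤ _ := by gcongr

theorem lintegral_slope_le {p : Config N → ℝ} (hp : Measurable p)
    (h1 : ∫⁻ x, ‖p x‖ₑ ^ 2 = 1) (i₀ i₁ : Fin N) (β γ R : ℝ) (j : Fin N ⊕ Fin N) :
    ∫⁻ z, ‖amplitudeSlope i₀ i₁ β γ R j z * tensor p z‖ₑ ^ 2 ≤
      ((if j = Sum.inl i₀ then 1 else 0) + (if j = Sum.inl i₁ then 1 else 0)) *
        (ENNReal.ofReal (4 * γ ^ 2) *
          (weightedMass p i₀ i₁ γ R + ENNReal.ofReal (Real.exp (-γ * R) ^ 2))) +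
        ENNReal.ofReal (1 / 2 * (4 * N / β) ^ 2) * weightedMass p i₀ i₁ γ R := by
  classical
  set E := Real.exp (-γ * R) with hE
  have hEp : 0 < E := Real.exp_pos _
  set c : ℝ≥0∞ := (if j = Sum.inl i₀ then 1 else 0) + (if j = Sum.inl i₁ then 1 else 0) with hc
  let W : Config N → ℝ≥0∞ := fun x =>
    ENNReal.ofReal (radialWeight γ R (dist (x i₀) (x i₁)) ^ 2)
  have hW : Measurable W := measurable_weight i₀ i₁ γ R
  have hpt : ∀ z : Doubled N, ‖amplitudeSlope i₀ i₁ β γ R j z‖ₑ ^ 2 ≤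
      c * (ENNReal.ofReal (4 * γ ^ 2) * (W (z ∘ Sum.inl) + ENNReal.ofReal (E ^ 2)))
        + ENNReal.ofReal (1 / 2 * (4 * N / β) ^ 2) * W (z ∘ Sum.inl) := by
    intro z
    have hg : W (z ∘ Sum.inl) = ENNReal.ofReal (radialWeight γ R (pairDist i₀ i₁ z) ^ 2) := rfl
    rw [hg, enorm_sq_real]
    unfold amplitudeSlope
    set g := radialWeight γ R (pairDist i₀ i₁ z)
    rw [← ENNReal.ofReal_add (by positivity) (by positivity),
      ← ENNReal.ofReal_mul (by positivity), ← ENNReal.ofReal_mul (by positivity)]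
    split_ifs with h
    · have hc1 : 1 ≤ c := by
        rcases h with h | h
        · simp [hc, h]
        · simp [hc, h]
      refine le_trans ?_ (add_le_add_left (le_mul_of_one_le_left' hc1) _)
      rw [← ENNReal.ofReal_add (by positivity) (by positivity)]
      refine ENNReal.ofReal_le_ofReal ?_
      nlinarith [sq_nonneg (2 * γ * (g + E) - 4 * N / β * g), sq_nonneg (γ * (g - E))]
    · refine le_add_left (ENNReal.ofReal_le_ofReal ?_)
      nlinarith [sq_nonneg (4 * N / β * g)]
  have hm : Measurable (fun z => ‖tensor p z‖ₑ ^ 2) := (measurable_tensor hp).enorm.pow_const 2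
  have hH : Measurable (fun x => c * (ENNReal.ofReal (4 * γ ^ 2) * (W x + ENNReal.ofReal (E ^ 2)))
        + ENNReal.ofReal (1 / 2 * (4 * N / β) ^ 2) * W x) :=
    (((hW.add_const _).const_mul _).const_mul _).add (hW.const_mul _)
  calc _ ≤ ∫⁻ z : Doubled N, (c * (ENNReal.ofReal (4 * γ ^ 2) *
          (W (z ∘ Sum.inl) + ENNReal.ofReal (E ^ 2)))
        + ENNReal.ofReal (1 / 2 * (4 * N / β) ^ 2) * W (z ∘ Sum.inl)) * ‖tensor p z‖ₑ ^ 2 := by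
        refine lintegral_mono fun z => ?_
        rw [enorm_mul, mul_pow]
        exact mul_le_mul_left (hpt z) _
    _ = ∫⁻ x, (c * (ENNReal.ofReal (4 * γ ^ 2) * (W x + ENNReal.ofReal (E ^ 2)))
        + ENNReal.ofReal (1 / 2 * (4 * N / β) ^ 2) * W x) * ‖p x‖ₑ ^ 2 :=
        lintegral_tensor_inl hp h1 hH
    _ = ∫⁻ x, (c * (ENNReal.ofReal (4 * γ ^ 2) * (W x * ‖p x‖ₑ ^ 2 + ENNReal.ofReal (E ^ 2) *
        ‖p x‖ₑ ^ 2)) + ENNReal.ofReal (1 / 2 * (4 * N / β) ^ 2) * (W x * ‖p x‖ₑ ^ 2)) := by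
        refine lintegral_congr fun x => ?_
        ring
    _ = _ := by
        have hpm : Measurable (fun x => ‖p x‖ₑ ^ 2) := hp.enorm.pow_const 2
        have hWp : Measurable (fun x => W x * ‖p x‖ₑ ^ 2) := hW.mul hpm
        have hs : Measurable (fun x => W x * ‖p x‖ₑ ^ 2 + ENNReal.ofReal (E ^ 2) * ‖p x‖ₑ ^ 2) :=
          hWp.add (hpm.const_mul _)
        rw [lintegral_add_left ((hs.const_mul _).const_mul _),
          lintegral_const_mul _ (hs.const_mul _), lintegral_const_mul _ hs,
          lintegral_add_left hWp, lintegral_const_mul _ hpm, h1, mul_one,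
          lintegral_const_mul _ hWp]
        rfl

theorem sum_lintegral_slope_le {p : Config N → ℝ} (hp : Measurable p)
    (h1 : ∫⁻ x, ‖p x‖ₑ ^ 2 = 1) (i₀ i₁ : Fin N) (β γ R : ℝ) :
    ∑ j, ∑ _k : Fin 3, ∫⁻ z, ‖amplitudeSlope i₀ i₁ β γ R j z * tensor p z‖ₑ ^ 2 ≤
      ENNReal.ofReal (24 * γ ^ 2) *
          (weightedMass p i₀ i₁ γ R + ENNReal.ofReal (Real.exp (-γ * R) ^ 2)) +
        ENNReal.ofReal (3 * N * (4 * N / β) ^ 2) * weightedMass p i₀ i₁ γ R := by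
  calc _ ≤ ∑ j, ∑ _k : Fin 3, _ := Finset.sum_le_sum fun j _ => Finset.sum_le_sum fun _ _ =>
        lintegral_slope_le hp h1 i₀ i₁ β γ R j
    _ = _ := by
        set M := weightedMass p i₀ i₁ γ R
        set e := ENNReal.ofReal (Real.exp (-γ * R) ^ 2)
        simp only [Finset.sum_const, Finset.card_univ, Fintype.card_fin]
        rw [← Finset.smul_sum, Finset.sum_add_distrib, ← Finset.sum_mul, Finset.sum_add_distrib]
        simp only [Finset.sum_ite_eq', Finset.mem_univ, if_true, Finset.sum_const,
          Finset.card_univ, Fintype.card_sum, Fintype.card_fin, nsmul_eq_mul]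
        have e1 : ENNReal.ofReal (24 * γ ^ 2) = 3 * (1 + 1) * ENNReal.ofReal (4 * γ ^ 2) := by
          rw [show (24 : ℝ) * γ ^ 2 = 6 * (4 * γ ^ 2) by ring, ENNReal.ofReal_mul (by norm_num)]
          norm_num
        have e2 : ENNReal.ofReal (3 * N * (4 * N / β) ^ 2)
            = 3 * ((N : ℝ≥0∞) + N) * ENNReal.ofReal (1 / 2 * (4 * N / β) ^ 2) := by
          rw [show 3 * (N : ℝ) * (4 * N / β) ^ 2 = (3 * (N + N)) * (1 / 2 * (4 * N / β) ^ 2) by ring,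
            ENNReal.ofReal_mul (by positivity), ENNReal.ofReal_mul (by norm_num),
            ENNReal.ofReal_add (by positivity) (by positivity), ENNReal.ofReal_natCast]
          norm_num
        rw [e1, e2]
        push_cast
        ring

/-- The numerical content of the decay estimate: the kinetic cost is absorbed by the Coulomb gain. -/
theorem le_of_energy_balance {ε α β N γ a i e : ℝ} (hε : 0 < ε) (hα : 0 < α) (hN : 1 ≤ N)
    (hβ : 32 * N * α ≤ β) (hεα : 18 * (ε * N) ≤ α) (hγ : γ ^ 2 * (9216 * (ε * α)) = 1)
    (hi : 0 ≤ i) (ha : i ≤ 8 * a)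
    (h : 1 / (4 * α) * a ≤ 2 * ε * (24 * γ ^ 2 * (i + e) + 3 * N * (4 * N / β) ^ 2 * i)
      + 4 * N / β * a) : i ≤ e := by
  have hβ0 : 0 < β := lt_of_lt_of_le (by positivity) hβ
  have hΛ : 4 * N / β ≤ 1 / (8 * α) := by
    rw [div_le_div_iff₀ hβ0 (by positivity)]
    linarith
  have hΛ0 : 0 ≤ 4 * N / β := by positivity
  set Λ := 4 * N / β
  have ha0 : 0 ≤ a := by linarith
  have h1 : Λ * a ≤ 1 / (8 * α) * a := by gcongr
  have h2 : 3 * N * Λ ^ 2 * i ≤ 3 * N * (1 / (8 * α)) ^ 2 * i := by gcongr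
  have h3 : 1 / (4 * α) * a = 2 * (1 / (8 * α) * a) := by
    field_simp
    ring
  have h4 : 1 / (8 * α) * a ≤ 2 * ε * (24 * γ ^ 2 * (i + e) + 3 * N * (1 / (8 * α)) ^ 2 * i) := by
    have : 2 * ε * (24 * γ ^ 2 * (i + e) + 3 * N * Λ ^ 2 * i) ≤
        2 * ε * (24 * γ ^ 2 * (i + e) + 3 * N * (1 / (8 * α)) ^ 2 * i) := by gcongr
    linarith
  -- multiply by `64 α`
  have h5 : i ≤ 3072 * ((γ ^ 2 * (ε * α)) * (i + e)) + 6 * (ε * N) / α * i := by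
    have h6 : 64 * α * (1 / (8 * α) * a) = 8 * a := by
      field_simp
      norm_num
    have h7 : 64 * α * (2 * ε * (24 * γ ^ 2 * (i + e) + 3 * N * (1 / (8 * α)) ^ 2 * i))
        = 3072 * ((γ ^ 2 * (ε * α)) * (i + e)) + 6 * (ε * N) / α * i := by
      field_simp
      ring
    have h8 := mul_le_mul_of_nonneg_left h4 (by positivity : 0 ≤ 64 * α)
    rw [h6, h7] at h8
    linarith
  have h9 : γ ^ 2 * (ε * α) = 1 / 9216 := by linarith
  have h10 : 6 * (ε * N) / α ≤ 1 / 3 := by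
    rw [div_le_iff₀ hα]
    linarith
  have h11 : 6 * (ε * N) / α * i ≤ 1 / 3 * i := by gcongr
  rw [h9] at h5
  linarith

/-- Agmon estimate: the weighted mass of the minimizer is bounded by the squared weight at the
outer radius. -/
theorem IsMinimizer.weightedMass_le {ε : ℝ} (hε : 0 < ε) {ρ : Measure R3} {ψ : Config N → ℂ}
    (hmin : IsMinimizer ε ρ ψ) {p : Config N → ℝ} (hp : Measurable p)
    (hpψ : p =ᵐ[volume] fun x => ‖ψ x‖) (h1 : ∫⁻ x, ‖p x‖ₑ ^ 2 = 1) (hN : 2 ≤ N)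
    {i₀ i₁ : Fin N} (hi₀ : ∀ j, i₀ ≤ j) (hne : i₀ ≠ i₁) {α β : ℝ} (hα : 0 < α)
    (hβ : 32 * N * α ≤ β) (hεα : 18 * (ε * N) ≤ α)
    (hball : ∀ (y : R3) (i : Fin N), ∫⁻ x, (Metric.ball y β).indicator 1 (x i) * ‖p x‖ₑ ^ 2
      ≤ ENNReal.ofReal (1 / (4 * ((N : ℝ) - 1)))) {γ : ℝ} (hγ0 : 0 < γ)
    (hγ : γ ^ 2 * (9216 * (ε * α)) = 1) :
    weightedMass p i₀ i₁ γ (4 * α) ≤ ENNReal.ofReal (Real.exp (-γ * (4 * α)) ^ 2) := by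
  have hN1 : (1 : ℝ) ≤ N := by exact_mod_cast (show 1 ≤ N by omega)
  have hβ0 : 0 < β := lt_of_lt_of_le (by positivity) hβ
  set R := 4 * α with hR
  have hR0 : 0 < R := by positivity
  set χ := exchangeAmplitude i₀ i₁ β γ R with hχ
  set A := ∫⁻ z, ‖χ z * tensor p z‖ₑ ^ 2 with hA
  set I := weightedMass p i₀ i₁ γ R with hI
  set e := Real.exp (-γ * R) ^ 2 with he
  have hI1 : I ≤ 1 := weightedMass_le_one h1 i₀ i₁ hγ0.le R
  have hIfin : I ≠ ⊤ := ne_top_of_le_ne_top ENNReal.one_ne_top hI1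
  have htm := measurable_tensor hp
  have hχm : Measurable χ := measurable_exchangeAmplitude i₀ i₁ β γ R
  have hχtm : Measurable (fun z => ‖χ z * tensor p z‖ₑ ^ 2) := (hχm.mul htm).enorm.pow_const 2
  have hAfin : A ≠ ⊤ := by
    have h2 := lintegral_tensor_inl hp h1 (H := fun _ => 1) measurable_const
    simp only [one_mul, h1] at h2
    refine ne_top_of_le_ne_top ENNReal.one_ne_top (h2 ▸ lintegral_mono fun z => ?_)
    rw [enorm_mul, mul_pow]
    refine mul_le_of_le_one_left' ?_
    rw [enorm_sq_real, ENNReal.ofReal_le_one]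
    have h3 := exchangeAmplitude_nonneg i₀ i₁ β γ R z
    have h4 := exchangeAmplitude_le_half i₀ i₁ β hγ0.le R z
    exact pow_le_one₀ h3 (h4.trans (by norm_num))
  have hAI : I ≤ 8 * A := weightedMass_le_lintegral_amplitude hp h1 hN i₀ i₁ hβ0 hball γ R
  obtain ⟨hXfin, hX⟩ := hmin.exchange_inequality hp hpψ h1 i₀ (χ := χ) hχm
    (exchangeAmplitude_nonneg i₀ i₁ β γ R) (exchangeAmplitude_le_half i₀ i₁ β hγ0.le R)
    (B := amplitudeSlope i₀ i₁ β γ R) (measurable_amplitudeSlope i₀ i₁ β γ R)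
    (fun j => by
      refine ne_top_of_le_ne_top ?_ (lintegral_slope_le hp h1 i₀ i₁ β γ R j)
      refine ENNReal.add_ne_top.2 ⟨ENNReal.mul_ne_top ?_ (ENNReal.mul_ne_top ENNReal.ofReal_ne_top
        (ENNReal.add_ne_top.2 ⟨hIfin, ENNReal.ofReal_ne_top⟩)),
        ENNReal.mul_ne_top ENNReal.ofReal_ne_top hIfin⟩
      split_ifs <;> simp)
    -- steps of length at most `1 / γ` keep the increments of the exponential weight linear
    (h₀ := 1 / γ) (by positivity)
    (fun j k t ht htγ z => abs_exchangeAmplitude_sub_le hne hβ0 hγ0.le R j k ht.le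
      (by rw [le_div_iff₀ hγ0] at htγ; linarith) z)
  set X := ∫⁻ z, pairCoulomb z * ‖χ z * tensor p z‖ₑ ^ 2
  set X' := ∫⁻ z, pairCoulomb (z ∘ exchange i₀ true) * ‖χ z * tensor p z‖ₑ ^ 2
  set S := ∑ j, ∑ _k : Fin 3, ∫⁻ z, ‖amplitudeSlope i₀ i₁ β γ R j z * tensor p z‖ₑ ^ 2
  have hgain : X' + ENNReal.ofReal (1 / R) * A ≤ X + ENNReal.ofReal (4 * N / β) * A := by
    have hm1 : Measurable (fun z : Doubled N =>
        pairCoulomb (z ∘ exchange i₀ true) * ‖χ z * tensor p z‖ₑ ^ 2) :=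
      (measurable_pairCoulomb.comp (measurable_comp_index _)).mul hχtm
    have hm2 : Measurable (fun z : Doubled N => pairCoulomb z * ‖χ z * tensor p z‖ₑ ^ 2) :=
      measurable_pairCoulomb.mul hχtm
    rw [hA, ← lintegral_const_mul _ hχtm, ← lintegral_const_mul _ hχtm, ← lintegral_add_left hm1,
      ← lintegral_add_left hm2]
    refine lintegral_mono fun z => ?_
    rw [← add_mul, ← add_mul]
    by_cases hz : χ z = 0
    · simp [hz]
    · exact mul_le_mul_left (pairCoulomb_exchange_add_le hi₀ hne hβ0 hR0 hγ0.le hz) _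
  have hX'fin : X' ≠ ⊤ := by
    refine ne_top_of_le_ne_top ?_ (le_self_add.trans hgain)
    exact ENNReal.add_ne_top.2 ⟨hXfin, ENNReal.mul_ne_top ENNReal.ofReal_ne_top hAfin⟩
  have hbal : ENNReal.ofReal (1 / R) * A ≤
      2 * ENNReal.ofReal ε * (ENNReal.ofReal (24 * γ ^ 2) * (I + ENNReal.ofReal e) +
        ENNReal.ofReal (3 * N * (4 * N / β) ^ 2) * I) + ENNReal.ofReal (4 * N / β) * A := by
    have h2 : X' + ENNReal.ofReal (1 / R) * A ≤
        X' + (2 * ENNReal.ofReal ε * S + ENNReal.ofReal (4 * N / β) * A) := by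
      refine hgain.trans ?_
      rw [← add_assoc]
      gcongr
    refine ((ENNReal.add_le_add_iff_left hX'fin).1 h2).trans ?_
    gcongr
    exact sum_lintegral_slope_le hp h1 i₀ i₁ β γ R
  have hAr : A = ENNReal.ofReal A.toReal := (ENNReal.ofReal_toReal hAfin).symm
  have hIr : I = ENNReal.ofReal I.toReal := (ENNReal.ofReal_toReal hIfin).symm
  have hA0 : 0 ≤ A.toReal := ENNReal.toReal_nonneg
  have hI0 : 0 ≤ I.toReal := ENNReal.toReal_nonneg
  have he0 : 0 ≤ e := by positivity
  rw [hIr]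
  refine ENNReal.ofReal_le_ofReal (le_of_energy_balance (a := A.toReal) hε hα hN1 hβ hεα hγ hI0 ?_ ?_)
  · have h2 := ENNReal.toReal_mono (ENNReal.mul_ne_top ENNReal.ofNat_ne_top hAfin) hAI
    simpa using h2
  · rw [hAr, hIr, ← ENNReal.ofReal_ofNat 2] at hbal
    rw [← ENNReal.ofReal_add hI0 he0, ← ENNReal.ofReal_mul (by positivity),
      ← ENNReal.ofReal_mul (by positivity), ← ENNReal.ofReal_mul (by positivity),
      ← ENNReal.ofReal_mul (by positivity), ← ENNReal.ofReal_mul (by positivity),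
      ← ENNReal.ofReal_add (by positivity) (by positivity),
      ← ENNReal.ofReal_mul (by positivity),
      ← ENNReal.ofReal_add (by positivity) (by positivity)] at hbal
    exact (ENNReal.ofReal_le_ofReal_iff (by positivity)).1 hbal

end Decay

/-! ### Summation over pairs of particles -/

section OffDiagonal

variable {N : ℕ}

theorem exists_perm_two {i₀ i₁ i j : Fin N} (h : i₀ ≠ i₁) (hij : i ≠ j) :
    ∃ σ : Equiv.Perm (Fin N), σ i₀ = i ∧ σ i₁ = j := by
  refine ⟨(Equiv.swap i₀ i).trans (Equiv.swap (Equiv.swap i₀ i i₁) j), ?_, ?_⟩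
  · have h1 : i ≠ Equiv.swap i₀ i i₁ := fun h2 => by
      have h3 : Equiv.swap i₀ i i₀ = Equiv.swap i₀ i i₁ := by rw [Equiv.swap_apply_left]; exact h2
      exact h ((Equiv.swap i₀ i).injective h3)
    rw [Equiv.trans_apply, Equiv.swap_apply_left, Equiv.swap_apply_of_ne_of_ne h1 hij]
  · rw [Equiv.trans_apply, Equiv.swap_apply_left]

theorem measurableSet_pair (i j : Fin N) (α : ℝ) :
    MeasurableSet {x : Config N | dist (x i) (x j) ≤ α} :=
  measurableSet_le ((measurable_pi_apply i).dist (measurable_pi_apply j)) measurable_const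

/-- By symmetry every pair of particles has the same probability of being close. -/
theorem IsSymmetric.lintegral_pair_eq {ψ : Config N → ℂ} (h : IsSymmetric ψ)
    {i₀ i₁ i j : Fin N} (hne : i₀ ≠ i₁) (hij : i ≠ j) (α : ℝ) :
    ∫⁻ x in {x : Config N | dist (x i) (x j) ≤ α}, ‖ψ x‖ₑ ^ 2
      = ∫⁻ x in {x : Config N | dist (x i₀) (x i₁) ≤ α}, ‖ψ x‖ₑ ^ 2 := by
  obtain ⟨σ, rfl, rfl⟩ := exists_perm_two hne hij
  have hmp := measurePreserving_comp_perm (ι := Fin N) σ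
  have hemb : MeasurableEmbedding (fun z : Config N => z ∘ σ) := by
    refine MeasurableEquiv.measurableEmbedding
      { toFun := fun z : Config N => z ∘ σ, invFun := fun z => z ∘ σ.symm, left_inv := ?_,
        right_inv := ?_, measurable_toFun := measurable_comp_index _,
        measurable_invFun := measurable_comp_index _ }
    · intro z; funext l; simp
    · intro z; funext l; simp
  rw [← hmp.setLIntegral_comp_preimage_emb hemb (fun x => ‖ψ x‖ₑ ^ 2)
    {x : Config N | dist (x i₀) (x i₁) ≤ α}]
  change _ = ∫⁻ x in {x : Config N | dist (x (σ i₀)) (x (σ i₁)) ≤ α}, ‖ψ (x ∘ σ)‖ₑ ^ 2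
  refine lintegral_congr_ae (ae_restrict_of_ae ?_)
  filter_upwards [h σ] with x hx
  change _ = ‖ψ (fun l => x (σ l))‖ₑ ^ 2
  rw [hx]

theorem lintegral_enlargedDiagonal_le {ψ : Config N → ℂ} (h : IsSymmetric ψ) {i₀ i₁ : Fin N}
    (hne : i₀ ≠ i₁) (α : ℝ) :
    ∫⁻ x in enlargedDiagonal N α, ‖ψ x‖ₑ ^ 2
      ≤ (N : ℝ≥0∞) ^ 2 * ∫⁻ x in {x : Config N | dist (x i₀) (x i₁) ≤ α}, ‖ψ x‖ₑ ^ 2 := by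
  set m := ∫⁻ x in {x : Config N | dist (x i₀) (x i₁) ≤ α}, ‖ψ x‖ₑ ^ 2
  let D : Fin N × Fin N → Set (Config N) := fun q => {x | q.1 ≠ q.2 ∧ dist (x q.1) (x q.2) ≤ α}
  have hD : enlargedDiagonal N α = ⋃ q, D q := by
    ext x
    simp [enlargedDiagonal, D]
  rw [hD]
  refine (lintegral_iUnion_le _ _).trans ?_
  rw [tsum_fintype]
  calc _ ≤ ∑ _q : Fin N × Fin N, m := by
        refine Finset.sum_le_sum fun q _ => ?_
        by_cases hq : q.1 = q.2
        · simp [D, hq]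
        · exact (lintegral_mono_set fun x hx => hx.2).trans (h.lintegral_pair_eq hne hq α).le
    _ = _ := by
        rw [Finset.sum_const, Finset.card_univ, Fintype.card_prod, Fintype.card_fin, nsmul_eq_mul]
        push_cast
        ring

/-- The mass near a collision of two particles, from the weighted mass. -/
theorem lintegral_pair_le_of_weightedMass {p : Config N → ℝ} (hp : Measurable p) {i₀ i₁ : Fin N}
    {γ α : ℝ} (hγα : 1 ≤ 3 * (γ * α)) (hγ : 0 ≤ γ)
    (h : weightedMass p i₀ i₁ γ (4 * α) ≤ ENNReal.ofReal (Real.exp (-γ * (4 * α)) ^ 2)) :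
    ∫⁻ x in {x : Config N | dist (x i₀) (x i₁) ≤ α}, ‖p x‖ₑ ^ 2
      ≤ ENNReal.ofReal (4 * Real.exp (-6 * (γ * α))) := by
  set q := γ * α with hq
  set m := ∫⁻ x in {x : Config N | dist (x i₀) (x i₁) ≤ α}, ‖p x‖ₑ ^ 2 with hm
  have hd : 1 / 2 * Real.exp (-q) ≤ Real.exp (-γ * α) - Real.exp (-γ * (4 * α)) := by
    have e1 : -γ * α = -q := by rw [hq]; ring
    have e2 : -γ * (4 * α) = -q + -(3 * q) := by rw [hq]; ring
    have e3 : Real.exp (-(3 * q)) ≤ 1 / 2 := by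
      rw [Real.exp_neg, one_div]
      refine inv_anti₀ two_pos ?_
      linarith [Real.add_one_le_exp (3 * q)]
    rw [e1, e2, Real.exp_add]
    nlinarith [Real.exp_pos (-q)]
  have h1 : ENNReal.ofReal ((1 / 2 * Real.exp (-q)) ^ 2) * m ≤ weightedMass p i₀ i₁ γ (4 * α) := by
    rw [hm, ← lintegral_const_mul _ (hp.enorm.pow_const 2), weightedMass]
    refine le_trans ?_ (setLIntegral_le_lintegral {x : Config N | dist (x i₀) (x i₁) ≤ α} _)
    refine setLIntegral_mono ((measurable_weight i₀ i₁ γ (4 * α)).mul (hp.enorm.pow_const 2))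
      fun x hx => ?_
    refine mul_le_mul_left (ENNReal.ofReal_le_ofReal ?_) _
    refine pow_le_pow_left₀ (by positivity) (hd.trans ?_) 2
    refine le_trans ?_ (le_max_left _ _)
    have hx' : dist (x i₀) (x i₁) ≤ α := hx
    have := Real.exp_le_exp.2 (show -γ * α ≤ -γ * dist (x i₀) (x i₁) by nlinarith)
    linarith
  have h2 : m * ENNReal.ofReal ((1 / 2 * Real.exp (-q)) ^ 2)
      ≤ ENNReal.ofReal (Real.exp (-γ * (4 * α)) ^ 2) := by
    rw [mul_comm]
    exact h1.trans h
  have hpos : 0 < (1 / 2 * Real.exp (-q)) ^ 2 := by positivity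
  have h3 := (ENNReal.le_div_iff_mul_le (Or.inl (by simp))
    (Or.inl ENNReal.ofReal_ne_top)).2 h2
  rw [← ENNReal.ofReal_div_of_pos hpos] at h3
  refine h3.trans (ENNReal.ofReal_le_ofReal (le_of_eq ?_))
  rw [div_eq_iff hpos.ne', mul_pow, ← Real.exp_nat_mul, ← Real.exp_nat_mul]
  have e4 : 4 * Real.exp (-6 * q) * ((1 / 2) ^ 2 * Real.exp ((2 : ℕ) * -q))
      = Real.exp (-6 * q) * Real.exp ((2 : ℕ) * -q) := by ring
  rw [e4, ← Real.exp_add]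
  congr 1
  rw [hq]
  push_cast
  ring

theorem sq_mul_exp_le {N s : ℝ} (hN : 0 ≤ N) (hs : 400 * N ≤ s) :
    N ^ 2 * (4 * Real.exp (-(s / 16))) ≤ Real.exp (-(1 / 24) * s) := by
  have h1 : Real.exp (-(s / 16)) = Real.exp (-(1 / 24) * s) * Real.exp (-(s / 48)) := by
    rw [← Real.exp_add]
    congr 1
    ring
  have h2 : 4 * N ^ 2 * Real.exp (-(s / 48)) ≤ 1 := by
    rw [Real.exp_neg, ← div_eq_mul_inv, div_le_one (Real.exp_pos _)]
    have h3 : 2 * N ≤ Real.exp (s / 96) := by linarith [Real.add_one_le_exp (s / 96)]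
    have h4 : Real.exp (s / 48) = Real.exp (s / 96) ^ 2 := by
      rw [← Real.exp_nat_mul]
      congr 1
      push_cast
      ring
    rw [h4]
    nlinarith
  rw [h1]
  nlinarith [Real.exp_pos (-(1 / 24) * s)]

/-- Off-diagonal localization with the explicit universal constant `10⁻⁴`. -/
theorem IsMinimizer.integral_enlargedDiagonal_le (hN : 2 ≤ N) {ρ : Measure R3}
    (hρ : ρ Set.univ = (N : ℝ≥0∞)) {ε : ℝ} (hε : 0 < ε) {ψ : Config N → ℂ}
    (hmin : IsMinimizer ε ρ ψ) {β : ℝ}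
    (hκ : kappa N ρ β ≤ ENNReal.ofReal (1 / (4 * ((N : ℝ) - 1)))) {α : ℝ} (hα : 0 < α)
    (hαβ : α ≤ β / (32 * (N : ℝ))) (hεα : ε * (N : ℝ) ^ 2 ≤ 1 / 10000 * (α / 16)) :
    ∫ x in enlargedDiagonal N α, ‖ψ x‖ ^ 2 ≤ Real.exp (-(1 / 24) * Real.sqrt (α / ε)) := by
  obtain ⟨⟨hH1, hsymm, hdens⟩, -⟩ := id hmin
  have hψm := hH1.1.aestronglyMeasurable
  have hN2 : (2 : ℝ) ≤ N := by exact_mod_cast hN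
  have hN0 : N ≠ 0 := by omega
  -- a measurable representative of the modulus
  let p : Config N → ℝ := fun x => ‖hψm.mk ψ x‖
  have hp : Measurable p := hψm.stronglyMeasurable_mk.norm.measurable
  have hpψ : p =ᵐ[volume] fun x => ‖ψ x‖ := by
    filter_upwards [hψm.ae_eq_mk] with x hx
    simp only [p]
    rw [← hx]
  have hpe : (fun x => ‖p x‖ₑ ^ 2) =ᵐ[volume] fun x => ‖ψ x‖ₑ ^ 2 := by
    filter_upwards [hpψ] with x hx
    rw [hx, enorm_norm]
  let i₀ : Fin N := ⟨0, by omega⟩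
  let i₁ : Fin N := ⟨1, by omega⟩
  have hne : i₀ ≠ i₁ := by simp [i₀, i₁]
  have hi₀ : ∀ j, i₀ ≤ j := fun j => Fin.mk_le_of_le_val (Nat.zero_le _)
  have h1 : ∫⁻ x, ‖p x‖ₑ ^ 2 = 1 := by
    rw [lintegral_congr_ae hpe]
    have h2 := hdens.lintegral_eq hψm (f := fun _ => 1) measurable_const i₀
    simp only [one_mul, lintegral_one, hρ] at h2
    have h3 : (N : ℝ≥0∞) * ∫⁻ x, ‖ψ x‖ₑ ^ 2 = (N : ℝ≥0∞) * 1 := by rw [h2, mul_one]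
    exact (ENNReal.mul_right_inj (by exact_mod_cast hN0) (ENNReal.natCast_ne_top N)).1 h3
  have hball : ∀ (y : R3) (i : Fin N), ∫⁻ x, (Metric.ball y β).indicator 1 (x i) * ‖p x‖ₑ ^ 2
      ≤ ENNReal.ofReal (1 / (4 * ((N : ℝ) - 1))) := by
    intro y i
    refine le_trans (le_of_eq (lintegral_congr_ae ?_)) (lintegral_ball_le hdens hψm hN0 hκ y i)
    filter_upwards [hpe] with x hx
    rw [hx]
  have hβ : 32 * (N : ℝ) * α ≤ β := by
    rw [le_div_iff₀ (by positivity)] at hαβ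
    linarith
  have hεα' : 18 * (ε * N) ≤ α := by
    have : ε * N * 2 ≤ ε * (N : ℝ) ^ 2 := by
      rw [sq, ← mul_assoc]
      gcongr
    linarith
  set s := Real.sqrt (α / ε) with hs
  have hs0 : 0 ≤ s := Real.sqrt_nonneg _
  have hs2 : s ^ 2 = α / ε := Real.sq_sqrt (by positivity)
  have hsN : 400 * (N : ℝ) ≤ s := by
    refine Real.le_sqrt_of_sq_le ?_
    rw [le_div_iff₀ hε]
    nlinarith
  -- the Agmon rate, with `γ α = s / 96`
  have hs1 : 0 < s := by linarith
  set γ := s / (96 * α) with hγdef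
  have hγ0 : 0 < γ := by positivity
  have hγ : γ ^ 2 * (9216 * (ε * α)) = 1 := by
    rw [hγdef, div_pow, hs2]
    field_simp
    norm_num
  have hγα : γ * α = s / 96 := by
    rw [hγdef]
    field_simp
  have hW := hmin.weightedMass_le hε hp hpψ h1 hN hi₀ hne hα hβ hεα' hball hγ0 hγ
  have hm := lintegral_pair_le_of_weightedMass hp (by rw [hγα]; linarith) hγ0.le hW
  rw [setLIntegral_congr_fun_ae (measurableSet_pair i₀ i₁ α) (hpe.mono fun x hx _ => hx), hγα,
    show -6 * (s / 96) = -(s / 16) by ring] at hm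
  have hD := (lintegral_enlargedDiagonal_le hsymm hne α).trans
    (mul_le_mul_right hm ((N : ℝ≥0∞) ^ 2))
  rw [← ENNReal.ofReal_natCast, ← ENNReal.ofReal_pow (by positivity),
    ← ENNReal.ofReal_mul (by positivity)] at hD
  have hint : ∫ x in enlargedDiagonal N α, ‖ψ x‖ ^ 2
      = (∫⁻ x in enlargedDiagonal N α, ‖ψ x‖ₑ ^ 2).toReal := by
    have hsm : AEStronglyMeasurable (fun x => ‖ψ x‖ ^ 2) volume := hψm.norm.pow 2
    rw [integral_eq_lintegral_of_nonneg_ae (Eventually.of_forall fun x => sq_nonneg _)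
      hsm.restrict]
    congr 1
    refine lintegral_congr fun x => ?_
    rw [ENNReal.ofReal_pow (norm_nonneg _), ofReal_norm]
  rw [hint]
  refine (ENNReal.toReal_le_of_le_ofReal (by positivity) hD).trans ?_
  exact sq_mul_exp_le (by positivity) hsN

end OffDiagonal

end LevyLieb

/-- Exponential off-diagonal localization for Coulomb. The condition `ε N² ≪ α / 16` is
`ε N² ≤ c (α / 16)` with a universal constant `c > 0`. -/
theorem theorem1p1 :
    ∃ c : ℝ, 0 < c ∧
      ∀ (N : ℕ), 2 ≤ N →
      ∀ (ρ : MeasureTheory.Measure LevyLieb.R3), ρ Set.univ = (N : ENNReal) →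
      ∀ (ε : ℝ), 0 < ε →
      ∀ (ψ : LevyLieb.Config N → ℂ), LevyLieb.IsMinimizer ε ρ ψ →
      ∀ (β : ℝ), LevyLieb.kappa N ρ β ≤ ENNReal.ofReal (1 / (4 * ((N : ℝ) - 1))) →
      ∀ (α : ℝ), 0 < α → α ≤ β / (32 * (N : ℝ)) →
        ε * (N : ℝ) ^ 2 ≤ c * (α / 16) →
        ∫ x in LevyLieb.enlargedDiagonal N α, ‖ψ x‖ ^ 2 ≤
          Real.exp (-(1 / 24) * Real.sqrt (α / ε)) :=
  ⟨1 / 10000, by norm_num, fun _ hN _ hρ _ hε _ hmin _ hκ _ hα hαβ hεα =>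
    hmin.integral_enlargedDiagonal_le hN hρ hε hκ hα hαβ hεα⟩
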